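/- Let $n\ge 1$, let $M$ be a closed smooth manifold of dimension $n+1$ with a smooth Riemannian metric $g$, and let $\Sigma\subset M$ be a closed, smooth, embedded hypersurface that is minimal for $g$ (its mean curvature vector vanishes). For a metric $\tilde g$ on $M$ for which $\Sigma$ is minimal, let $L_{\Sigma,\tilde g}X=\Delta^\perp_{\Sigma,\tilde g}X+\bigl(\mathrm{Ric}_{\tilde g}(N,N)+|A_{\Sigma,\tilde g}|^2\bigr)X$ be the Jacobi operator on smooth normal vector fields $X$ of $\Sigma$, where $N$ is a local unit normal and $A_{\Sigma,\tilde g}$ the second fundamental form. Let $\mathrm{spec}(L_{\Sigma,\tilde g})$ be the set of $\lambda\in\mathbb R$ such that $L_{\Sigma,\tilde g}X+\lambda X=0$ for some smooth normal field $X\not\equiv 0$. Call $\Sigma$ nondegenerate for $\tilde g$ if $L_{\Sigma,\tilde g}X=0$ has only the solution $X=0$ among smooth normal fields. Then there are a smooth function $h:M\to\mathbb R$ which equals $d_g(\cdot,\Sigma)^2$ on a neighbourhood of $\Sigma$, and smooth metrics $g_i$ on $M$, with $g_i=\exp(2h/i)\,g$ for every integer $i\ge 1$, such that 1. $g_i\to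 g$ in the $C^\infty$ topology; 2. for every $i\ge 1$, $\Sigma$ is minimal for $g_i$, the normal fields of $\Sigma$ for $g_i$ and for $g$ are the same, $L_{\Sigma,g_i}X=L_{\Sigma,g}X-\frac{2n}{i}X$ for all of them, and $$\mathrm{spec}(L_{\Sigma,g_i})=\mathrm{spec}(L_{\Sigma,g})+\frac{2n}{i};$$ 3. there is $i_0$ such that $\Sigma$ is nondegenerate for $g_i$ for every $i\ge i_0$. In particular, $(g_i)_{i\ge \max(i_0,1)}$ is a sequence of metrics converging smoothly to $g$, for each of which $\Sigma$ is a nondegenerate minimal hypersurface. -/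

import Mathlib

open Set Filter Topology Manifold
open scoped ContDiff

noncomputable section

namespace MinimalHypersurface

/-- Euclidean space of dimension `m`, on which manifolds of dimension `m` are modelled. -/
abbrev Euc (m : ℕ) : Type := EuclideanSpace ℝ (Fin m)

/-- A field of bilinear forms on `Euc m`: the coefficients of a metric in a chart. -/
abbrev BilinField (m : ℕ) : Type := Euc m → Euc m →L[ℝ] Euc m →L[ℝ] ℝ

/-! ### Formulas in a chart

`G` is a metric on (an open subset of) `Euc m`, and `F : Euc n → Euc m` is an immersion near the
point under consideration. If `B` is a nondegenerate bilinear form and `ℓ` a linear form, then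
`B.inverse ℓ` is the vector `w` with `B w = ℓ`, that is, indices are raised with `B.inverse`. -/

/-- The `a`-th standard basis vector. -/
def stdVec {m : ℕ} (a : Fin m) : Euc m := EuclideanSpace.single a 1

/-- The dual basis vector `eᵃ = ∑ b, Bᵃᵇ e_b`, where `(Bᵃᵇ)` is the inverse matrix of `B`. -/
def raisedVec {m : ℕ} (B : Euc m →L[ℝ] Euc m →L[ℝ] ℝ) (a : Fin m) : Euc m :=
  B.inverse (EuclideanSpace.proj a : Euc m →L[ℝ] ℝ)

/-- The trace `∑ a b, Bᵃᵇ T(e_a, e_b)` of a bilinear map `T` with respect to the metric `B`. -/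
def traceWith {m : ℕ} {V : Type*} [AddCommGroup V] (B : Euc m →L[ℝ] Euc m →L[ℝ] ℝ)
    (T : Euc m → Euc m → V) : V :=
  ∑ a, T (stdVec a) (raisedVec B a)

/-- The Christoffel symbols of the Levi-Civita connection: `Γ(u, v)` is the vector with
`2 G(Γ(u, v), w) = (D_u G)(v, w) + (D_v G)(u, w) - (D_w G)(u, v)` for all `w`. -/
def christoffel {m : ℕ} (G : BilinField m) (x u v : Euc m) : Euc m :=
  (G x).inverse ((1 / 2 : ℝ) •
    (fderiv ℝ G x u v + fderiv ℝ G x v u - ((fderiv ℝ G x).flip u).flip v))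

/-- The curvature tensor `R(u, v)w = ∇_u ∇_v w - ∇_v ∇_u w` (constant `u`, `v`, `w`). -/
def curvature {m : ℕ} (G : BilinField m) (x u v w : Euc m) : Euc m :=
  fderiv ℝ (fun y => christoffel G y v w) x u - fderiv ℝ (fun y => christoffel G y u w) x v
    + christoffel G x u (christoffel G x v w) - christoffel G x v (christoffel G x u w)

/-- The Ricci tensor `Ric(v, w)`, the trace of `u ↦ R(u, v)w`. -/
def ricci {m : ℕ} (G : BilinField m) (x v w : Euc m) : ℝ :=
  ∑ a, (curvature G x (stdVec a) v w) a

/-- The metric induced by the map `F`. -/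
def inducedMetric {n m : ℕ} (G : BilinField m) (F : Euc n → Euc m) : BilinField n :=
  fun x => (G (F x)).bilinearComp (fderiv ℝ F x) (fderiv ℝ F x)

/-- The component of `w` orthogonal to the image of the differential of `F` at `x`. -/
def normalPart {n m : ℕ} (G : BilinField m) (F : Euc n → Euc m) (x : Euc n) (w : Euc m) : Euc m :=
  w - fderiv ℝ F x ((inducedMetric G F x).inverse ((G (F x) w).comp (fderiv ℝ F x)))

/-- The Levi-Civita covariant derivative of a vector field `X` along `F`, in the direction `u`. -/
def covDeriv {n m : ℕ} (G : BilinField m) (F : Euc n → Euc m) (X : Euc n → Euc m)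
    (x u : Euc n) : Euc m :=
  fderiv ℝ X x u + christoffel G (F x) (fderiv ℝ F x u) (X x)

/-- The normal connection `∇^⊥_u X`. -/
def normalDeriv {n m : ℕ} (G : BilinField m) (F : Euc n → Euc m) (X : Euc n → Euc m)
    (x u : Euc n) : Euc m :=
  normalPart G F x (covDeriv G F X x u)

/-- The second fundamental form `A(u, v) = (∇_u (dF v))^⊥`. -/
def secondForm {n m : ℕ} (G : BilinField m) (F : Euc n → Euc m) (x u v : Euc n) : Euc m :=
  normalDeriv G F (fun y => fderiv ℝ F y v) x u

/-- The mean curvature vector, the trace of the second fundamental form. -/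
def meanCurvature {n m : ℕ} (G : BilinField m) (F : Euc n → Euc m) (x : Euc n) : Euc m :=
  traceWith (inducedMetric G F x) (secondForm G F x)

/-- The squared norm `|A|²` of the second fundamental form. -/
def normSqSecondForm {n m : ℕ} (G : BilinField m) (F : Euc n → Euc m) (x : Euc n) : ℝ :=
  ∑ a, ∑ b, G (F x) (secondForm G F x (stdVec a) (stdVec b))
    (secondForm G F x (raisedVec (inducedMetric G F x) a) (raisedVec (inducedMetric G F x) b))

/-- The normal Laplacian `Δ^⊥ X`, the trace of the second covariant derivative
`∇^⊥_u ∇^⊥_v X - ∇^⊥_{∇_u v} X`. -/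
def normalLaplacian {n m : ℕ} (G : BilinField m) (F : Euc n → Euc m) (X : Euc n → Euc m)
    (x : Euc n) : Euc m :=
  traceWith (inducedMetric G F x) fun u v =>
    normalDeriv G F (fun y => normalDeriv G F X y v) x u
      - normalDeriv G F X x (christoffel (inducedMetric G F) x u v)

/-- `N` is a unit normal vector of `F` at `x`. -/
def IsUnitNormal {n m : ℕ} (G : BilinField m) (F : Euc n → Euc m) (x : Euc n) (N : Euc m) : Prop :=
  G (F x) N N = 1 ∧ ∀ u, G (F x) N (fderiv ℝ F x u) = 0

/-- A unit normal vector of `F` at `x`. In codimension one it is unique up to sign, and the sign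
does not matter where it is used. -/
def unitNormal {n m : ℕ} (G : BilinField m) (F : Euc n → Euc m) (x : Euc n) : Euc m :=
  Classical.epsilon (IsUnitNormal G F x)

/-- The Jacobi operator of a hypersurface, `L X = Δ^⊥ X + (Ric(N, N) + |A|²) X`. -/
def jacobiInChart {n : ℕ} (G : BilinField (n + 1)) (F : Euc n → Euc (n + 1))
    (X : Euc n → Euc (n + 1)) (x : Euc n) : Euc (n + 1) :=
  normalLaplacian G F X x
    + (ricci G (F x) (unitNormal G F x) (unitNormal G F x) + normSqSecondForm G F x) • X x

/-! ### Riemannian metrics on a manifold -/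

/-- Smooth Riemannian metrics on an `m`-dimensional manifold `M`. -/
abbrev Metric (m : ℕ) (M : Type*) [TopologicalSpace M] [ChartedSpace (Euc m) M]
    [IsManifold (𝓡 m) ∞ M] :=
  Bundle.ContMDiffRiemannianMetric (𝓡 m) ∞ (Euc m) (fun x : M => TangentSpace (𝓡 m) x)

section Ambient

variable {m : ℕ} {M : Type*} [TopologicalSpace M] [ChartedSpace (Euc m) M] [IsManifold (𝓡 m) ∞ M]

/-- The coefficients of the metric `g` in the preferred chart around `x₀`: the pull-back of `g`
by the inverse of the chart (meaningful on the target of the chart, an open set). -/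
def coeff (g : Metric m M) (x₀ : M) : BilinField m := fun y =>
  let B : Euc m →L[ℝ] Euc m →L[ℝ] ℝ := g.inner ((extChartAt (𝓡 m) x₀).symm y)
  let A : Euc m →L[ℝ] Euc m := mfderiv (𝓡 m) (𝓡 m) (extChartAt (𝓡 m) x₀).symm y
  B.bilinearComp A A

/-- Convergence of metrics in the smooth topology (for a compact manifold): in the charts, the
coefficients converge with all their derivatives, uniformly on compact sets. -/
def TendstoSmoothly (G : ℕ → Metric m M) (g : Metric m M) : Prop :=
  ∀ (x₀ : M) (k : ℕ) (K : Set (Euc m)), IsCompact K → K ⊆ (extChartAt (𝓡 m) x₀).target →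
    TendstoUniformlyOn (fun i => iteratedFDeriv ℝ k (coeff (G i) x₀))
      (iteratedFDeriv ℝ k (coeff g x₀)) atTop K

open scoped Bundle in
/-- The Riemannian distance from the point `x` to the set `A` for the metric `g`. -/
def distToSet (g : Metric m M) (A : Set M) (x : M) : ℝ :=
  letI : Bundle.RiemannianBundle (fun x : M => TangentSpace (𝓡 m) x) := ⟨g.toRiemannianMetric⟩
  (⨅ y ∈ A, riemannianEDist (𝓡 m) x y).toReal

end Ambient

/-! ### Hypersurfaces, given by an embedding `ι : S → M` -/

section Hypersurface

variable {n : ℕ} {M : Type*} [TopologicalSpace M] [ChartedSpace (Euc (n + 1)) M]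
  [IsManifold (𝓡 (n + 1)) ∞ M] {S : Type*} [TopologicalSpace S] [ChartedSpace (Euc n) S]

/-- The map `ι` read in the preferred charts around `p` and `ι p`. -/
def mapInChart (ι : S → M) (p : S) : Euc n → Euc (n + 1) := fun y =>
  extChartAt (𝓡 (n + 1)) (ι p) (ι ((extChartAt (𝓡 n) p).symm y))

/-- A vector field along `ι` read in the preferred charts around `p` and `ι p`. -/
def fieldInChart (ι : S → M) (X : (p : S) → TangentSpace (𝓡 (n + 1)) (ι p)) (p : S) :
    Euc n → Euc (n + 1) := fun y =>
  mfderiv (𝓡 (n + 1)) (𝓡 (n + 1)) (extChartAt (𝓡 (n + 1)) (ι p))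
    (ι ((extChartAt (𝓡 n) p).symm y)) (X ((extChartAt (𝓡 n) p).symm y))

/-- `ι` is minimal for the metric `g`: its mean curvature vector vanishes everywhere. -/
def IsMinimal (g : Metric (n + 1) M) (ι : S → M) : Prop :=
  ∀ p : S, meanCurvature (coeff g (ι p)) (mapInChart ι p) (extChartAt (𝓡 n) p p) = 0

/-- Smooth normal vector fields along `ι`, i.e. smooth sections of its normal bundle. -/
def IsNormalField (g : Metric (n + 1) M) (ι : S → M)
    (X : (p : S) → TangentSpace (𝓡 (n + 1)) (ι p)) : Prop :=
  ContMDiff (𝓡 n) (𝓡 (n + 1)).tangent ∞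
      (fun p => (⟨ι p, X p⟩ : TangentBundle (𝓡 (n + 1)) M)) ∧
    ∀ (p : S) (v : TangentSpace (𝓡 n) p),
      g.inner (ι p) (X p) (mfderiv (𝓡 n) (𝓡 (n + 1)) ι p v) = 0

/-- The Jacobi operator `L X = Δ^⊥ X + (Ric(N, N) + |A|²) X`, computed at `p` in the preferred
charts around `p` and `ι p`, as a tangent vector of `M` at `ι p`. -/
def jacobiOperator (g : Metric (n + 1) M) (ι : S → M)
    (X : (p : S) → TangentSpace (𝓡 (n + 1)) (ι p)) (p : S) : TangentSpace (𝓡 (n + 1)) (ι p) :=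
  (mfderiv (𝓡 (n + 1)) (𝓡 (n + 1)) (extChartAt (𝓡 (n + 1)) (ι p)) (ι p)).inverse
    (jacobiInChart (coeff g (ι p)) (mapInChart ι p) (fieldInChart ι X p) (extChartAt (𝓡 n) p p))

/-- The spectrum of the Jacobi operator (of a closed hypersurface): the real numbers `c` for which
`L X + c X = 0` has a smooth normal solution `X ≠ 0`. -/
def jacobiSpectrum (g : Metric (n + 1) M) (ι : S → M) : Set ℝ :=
  {c | ∃ X : (p : S) → TangentSpace (𝓡 (n + 1)) (ι p), IsNormalField g ι X ∧ (∃ p, X p ≠ 0) ∧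
    ∀ p, jacobiOperator g ι X p + c • X p = 0}

/-- `ι` is nondegenerate: the only normal Jacobi field is zero. -/
def IsNondegenerate (g : Metric (n + 1) M) (ι : S → M) : Prop :=
  ∀ X : (p : S) → TangentSpace (𝓡 (n + 1)) (ι p), IsNormalField g ι X →
    (∀ p, jacobiOperator g ι X p = 0) → ∀ p, X p = 0

end Hypersurface

end MinimalHypersurface

end

/-! ### Riemannian metrics and Christoffel symbols in a chart -/

noncomputable section

namespace MinimalHypersurface

variable {m n : ℕ}

set_option synthInstance.maxHeartbeats 200000

/-! The function `h` is a squared distance near the hypersurface `Σ`, so `u = h/i` and its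
differential vanish along `Σ`. There `g` and `exp(2u) g` have the same values and the same
Christoffel symbols; hence the induced metric, the normal connection and Laplacian, the second
fundamental form and the mean curvature are unchanged. Only the first derivatives of the Christoffel
symbols change, through the Hessian of `u`, which is `(2/i) ν ⊗ ν` with `ν = g(N, ·)`. Taking a
trace, `Ric(N, N)` drops by `n · 2/i`. So `L` becomes `L - 2n/i` and the spectrum is translated
(`IsFlatConformal.ricci_eq`, `IsFlatConformal.jacobiInChart_eq`, `jacobiOperator_conformalMetric`).
Smooth convergence holds because `exp(2 s h) g` depends smoothly on `(s, x)`.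

That `h` exists and has this Hessian is a statement about normal geodesics. The Hamiltonian geodesic
flow started along the conormals of `Σ` gives a normal exponential map, which is a local
diffeomorphism. Its time component `t` solves the eikonal equation by the Gauss lemma
(`HypData.exists_normalFlow`, `HypData.exists_eikonal`). Normal geodesics show that the distance is
at most `|t|`, and `|dt| = 1` shows that it is at least `|t|` (`iInf_edistOf_le`,
`le_iInf_edistOf`). Thus the squared distance is locally `t²`, whose Hessian on `t = 0` is `2 dt ⊗
dt`. The smoothness of the flow in time and initial point is derived from the implicit function
theorem in a space of curves (`exists_smooth_flow`).

A Jacobi field for `g_i` satisfies `L X = (2n/i) X`. So nondegeneracy for large `i` follows once the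
positive `s` for which `L X = s X` has a nonzero solution are bounded away from `0`
(`exists_spectral_gap`). This requires neither Sobolev spaces nor elliptic regularity. The form
`A(X, X) = ∫ ⟨L X, X⟩` satisfies an energy inequality (`IsRiem.exists_energy`), and a Poincaré
inequality on a fine grid (`exists_poincare`) makes it negative definite on the fields whose
finitely many cube averages vanish (`HypCover.exists_grid`). Eigenfields for different `s` are
orthogonal, so there are at most as many positive `s` as there are averages
(`finite_setOf_pos_eigenvalue`).

Since `jacobiOperator` is computed at each point in the charts preferred there, the integration
arguments also need the invariance of curvature, Laplacian and second fundamental form under local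
isometries. -/

instance smulCommClass_real : SMulCommClass ℝ ℝ ℝ := Algebra.to_smulCommClass

instance normedAddCommGroupDual : NormedAddCommGroup (Euc m →L[ℝ] ℝ) := inferInstance

instance normedSpaceDual : NormedSpace ℝ (Euc m →L[ℝ] ℝ) := inferInstance

instance normedAddCommGroupBilin : NormedAddCommGroup (Euc m →L[ℝ] Euc m →L[ℝ] ℝ) := inferInstance

instance normedAddCommGroupHom {k : ℕ} : NormedAddCommGroup (Euc m →L[ℝ] Euc k) := inferInstance

instance normedSpaceHom {k : ℕ} : NormedSpace ℝ (Euc m →L[ℝ] Euc k) := inferInstance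

instance normedAddCommGroupHom₂ {k : ℕ} : NormedAddCommGroup (Euc m →L[ℝ] Euc m →L[ℝ] Euc k) :=
  inferInstance

instance normedSpaceHom₂ {k : ℕ} : NormedSpace ℝ (Euc m →L[ℝ] Euc m →L[ℝ] Euc k) := inferInstance

instance normedSpaceBilin : NormedSpace ℝ (Euc m →L[ℝ] Euc m →L[ℝ] ℝ) := inferInstance

/-- `G` is a smooth Riemannian metric on the open set `U`. -/
structure IsRiem (G : BilinField m) (U : Set (Euc m)) : Prop where
  isOpen : IsOpen U
  smooth : ∀ x ∈ U, ContDiffAt ℝ ∞ G x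
  symm : ∀ x ∈ U, ∀ v w, G x v w = G x w v
  pos : ∀ x ∈ U, ∀ v, v ≠ 0 → 0 < G x v v

/-- A definite form has no kernel, and the space and its dual have the same dimension. -/
lemma isInvertible_of_pos {B : Euc m →L[ℝ] Euc m →L[ℝ] ℝ} (h : ∀ v, v ≠ 0 → 0 < B v v) :
    B.IsInvertible := by
  have hinj : Function.Injective (B : Euc m →ₗ[ℝ] Euc m →L[ℝ] ℝ) := by
    rw [← LinearMap.ker_eq_bot, LinearMap.ker_eq_bot']
    intro v hv
    by_contra hne
    have := h v hne
    have h2 : B v v = 0 := by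
      have : B v = 0 := hv
      rw [this]; rfl
    linarith
  have hdim : Module.finrank ℝ (Euc m) = Module.finrank ℝ (Euc m →L[ℝ] ℝ) := by
    rw [← (LinearMap.toContinuousLinearMap (𝕜 := ℝ) (E := Euc m) (F' := ℝ)).finrank_eq]
    exact (Subspace.dual_finrank_eq (K := ℝ) (V := Euc m)).symm
  refine ⟨(LinearEquiv.toContinuousLinearEquiv
    (LinearMap.linearEquivOfInjective (B : Euc m →ₗ[ℝ] Euc m →L[ℝ] ℝ) hinj hdim)), ?_⟩
  ext v w
  rfl

namespace IsRiem

variable {G : BilinField m} {U : Set (Euc m)} {x : Euc m}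

lemma mono (hG : IsRiem G U) {W : Set (Euc m)} (hW : IsOpen W) (h : W ⊆ U) : IsRiem G W :=
  ⟨hW, fun x hx => hG.smooth x (h hx), fun x hx => hG.symm x (h hx), fun x hx => hG.pos x (h hx)⟩

lemma isInvertible (hG : IsRiem G U) (hx : x ∈ U) : (G x).IsInvertible :=
  isInvertible_of_pos (hG.pos x hx)

lemma inverse_smooth (hG : IsRiem G U) (hx : x ∈ U) :
    ContDiffAt ℝ ∞ (fun y => (G y).inverse) x :=
  (hG.isInvertible hx).contDiffAt_map_inverse.comp x (hG.smooth x hx)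

lemma differentiableAt (hG : IsRiem G U) (hx : x ∈ U) : DifferentiableAt ℝ G x :=
  (hG.smooth x hx).differentiableAt (by simp)

lemma mem_nhds (hG : IsRiem G U) (hx : x ∈ U) : U ∈ 𝓝 x := hG.isOpen.mem_nhds hx

lemma inverse_apply (hG : IsRiem G U) (hx : x ∈ U) (ℓ : Euc m →L[ℝ] ℝ) (w : Euc m) :
    G x ((G x).inverse ℓ) w = ℓ w := by
  rw [(hG.isInvertible hx).self_apply_inverse]

lemma inverse_self (hG : IsRiem G U) (hx : x ∈ U) (w : Euc m) :
    (G x).inverse (G x w) = w :=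
  (hG.isInvertible hx).inverse_apply_self w

lemma ext_of_inner (hG : IsRiem G U) (hx : x ∈ U) {v w : Euc m}
    (h : ∀ z, G x v z = G x w z) : v = w :=
  (hG.isInvertible hx).injective (ContinuousLinearMap.ext h)

lemma fderiv_symm (hG : IsRiem G U) (hx : x ∈ U) (u v w : Euc m) :
    fderiv ℝ G x u v w = fderiv ℝ G x u w v := by
  have h1 : ∀ v w : Euc m, HasFDerivAt (fun y => G y v w)
      (((ContinuousLinearMap.apply ℝ ℝ w).comp
        ((ContinuousLinearMap.apply ℝ (Euc m →L[ℝ] ℝ) v))).comp (fderiv ℝ G x)) x := by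
    intro v w
    exact HasFDerivAt.comp (g := ((ContinuousLinearMap.apply ℝ ℝ w).comp
        (ContinuousLinearMap.apply ℝ (Euc m →L[ℝ] ℝ) v))) x
        (ContinuousLinearMap.hasFDerivAt _) (hG.differentiableAt hx).hasFDerivAt
  have h2 := (h1 w v).congr_of_eventuallyEq (f₁ := fun y => G y v w)
    (by filter_upwards [hG.mem_nhds hx] with y hy using hG.symm y hy v w)
  have := (h1 v w).unique h2
  simpa using congrArg (fun L => L u) this

lemma christoffel_inner (hG : IsRiem G U) (hx : x ∈ U) (u v w : Euc m) :
    2 * G x (christoffel G x u v) w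
      = fderiv ℝ G x u v w + fderiv ℝ G x v u w - fderiv ℝ G x w u v := by
  unfold christoffel
  rw [hG.inverse_apply hx]
  simp

lemma christoffel_symm (hG : IsRiem G U) (hx : x ∈ U) (u v : Euc m) :
    christoffel G x u v = christoffel G x v u := by
  refine hG.ext_of_inner hx fun w => ?_
  have h1 := hG.christoffel_inner hx u v w
  have h2 := hG.christoffel_inner hx v u w
  have := hG.fderiv_symm hx w u v
  linarith

/-- The Levi-Civita connection is compatible with the metric. -/
lemma christoffel_compat (hG : IsRiem G U) (hx : x ∈ U) (u v w : Euc m) :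
    fderiv ℝ G x u v w = G x (christoffel G x u v) w + G x v (christoffel G x u w) := by
  have h1 := hG.christoffel_inner hx u v w
  have h2 := hG.christoffel_inner hx u w v
  have h3 := hG.fderiv_symm hx u v w
  have h4 := hG.fderiv_symm hx v w u
  have h5 := hG.fderiv_symm hx w u v
  rw [hG.symm x hx v]
  have h6 := hG.fderiv_symm hx u w v
  have h7 := hG.fderiv_symm hx v u w
  linarith

end IsRiem

/-- The Christoffel symbols as a field of continuous bilinear maps. -/
def chris (G : BilinField m) (x : Euc m) : Euc m →L[ℝ] Euc m →L[ℝ] Euc m :=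
  (ContinuousLinearMap.compL ℝ (Euc m) (Euc m →L[ℝ] ℝ) (Euc m) (G x).inverse).comp
    ((1 / 2 : ℝ) • (fderiv ℝ G x + (fderiv ℝ G x).flip
      - ((ContinuousLinearMap.flipₗᵢ ℝ (Euc m) (Euc m) ℝ :
          (Euc m →L[ℝ] Euc m →L[ℝ] ℝ) →L[ℝ] (Euc m →L[ℝ] Euc m →L[ℝ] ℝ))).comp
          (fderiv ℝ G x).flip))

/-- The bundled form `chris` makes the bilinearity of `Γ` available and lets `Γ` be differentiated
as a single map into a normed space. -/
lemma chris_apply (G : BilinField m) (x u v : Euc m) :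
    chris G x u v = christoffel G x u v := by
  simp [chris, christoffel]

lemma IsRiem.chris_smooth {G : BilinField m} {U : Set (Euc m)} {x : Euc m}
    (hG : IsRiem G U) (hx : x ∈ U) : ContDiffAt ℝ ∞ (chris G) x := by
  have h1 := hG.inverse_smooth hx
  have h2 : ContDiffAt ℝ ∞ (fderiv ℝ G) x := (hG.smooth x hx).fderiv_right (by simp)
  have h3 : ContDiffAt ℝ ∞ (fun x => (fderiv ℝ G x).flip) x :=
    (ContinuousLinearMap.flipₗᵢ ℝ (Euc m) (Euc m) (Euc m →L[ℝ] ℝ)).contDiff.contDiffAt.comp x h2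
  unfold chris
  refine ContDiffAt.clm_comp ?_ ?_
  · exact (ContinuousLinearMap.contDiff _).contDiffAt.comp x h1
  · refine ContDiffAt.const_smul _ ?_
    refine (h2.add h3).sub ?_
    exact contDiffAt_const.clm_comp h3

end MinimalHypersurface

end

/-! ### Covariant derivatives along a map, and curvature as their commutator -/

noncomputable section

namespace MinimalHypersurface

set_option synthInstance.maxHeartbeats 200000

section Calculus

variable {E' E H : Type*} [NormedAddCommGroup E'] [NormedSpace ℝ E'] [NormedAddCommGroup E]
  [NormedSpace ℝ E] [NormedAddCommGroup H] [NormedSpace ℝ H]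

/-- The product rule behind all later derivatives of `G(F)(X, Y)` and of `Γ(F)(dF, X)`. -/
lemma fderiv_bilin_apply {E₁ E₂ : Type*} [NormedAddCommGroup E₁] [NormedSpace ℝ E₁]
    [NormedAddCommGroup E₂] [NormedSpace ℝ E₂] {B : E → E₁ →L[ℝ] E₂ →L[ℝ] H} {F : E' → E}
    {X : E' → E₁} {Y : E' → E₂} {x : E'}
    (hB : DifferentiableAt ℝ B (F x)) (hF : DifferentiableAt ℝ F x)
    (hX : DifferentiableAt ℝ X x) (hY : DifferentiableAt ℝ Y x) (u : E') :
    fderiv ℝ (fun y => B (F y) (X y) (Y y)) x u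
      = fderiv ℝ B (F x) (fderiv ℝ F x u) (X x) (Y x) + B (F x) (fderiv ℝ X x u) (Y x)
        + B (F x) (X x) (fderiv ℝ Y x u) := by
  have h1 : HasFDerivAt (fun y => B (F y)) ((fderiv ℝ B (F x)).comp (fderiv ℝ F x)) x :=
    HasFDerivAt.comp (g := B) x hB.hasFDerivAt hF.hasFDerivAt
  have h2 := (h1.clm_apply hX.hasFDerivAt).clm_apply hY.hasFDerivAt
  rw [h2.fderiv]
  simp
  abel

lemma fderiv_fderiv_apply {F : E' → E} {x : E'} (hF : ContDiffAt ℝ ∞ F x) (u v : E') :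
    fderiv ℝ (fun y => fderiv ℝ F y v) x u = fderiv ℝ (fderiv ℝ F) x u v := by
  have h : DifferentiableAt ℝ (fderiv ℝ F) x :=
    ((hF.fderiv_right (m := ∞) (by simp)).differentiableAt (by simp))
  rw [fderiv_clm_apply h (differentiableAt_const v)]
  simp

lemma fderiv_fderiv_symm {F : E' → E} {x : E'} (hF : ContDiffAt ℝ ∞ F x) (u v : E') :
    fderiv ℝ (fderiv ℝ F) x u v = fderiv ℝ (fderiv ℝ F) x v u := by
  have : IsSymmSndFDerivAt ℝ F x := hF.isSymmSndFDerivAt (by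
    rw [minSmoothness_of_isRCLikeNormedField]; exact WithTop.coe_le_coe.2 le_top)
  exact this.eq u v

lemma smooth_fderiv {F : E' → E} {x : E'} (hF : ContDiffAt ℝ ∞ F x) :
    ContDiffAt ℝ ∞ (fderiv ℝ F) x := hF.fderiv_right (by simp)

lemma smooth_fderiv_apply {F : E' → E} {x : E'} (hF : ContDiffAt ℝ ∞ F x) (v : E') :
    ContDiffAt ℝ ∞ (fun y => fderiv ℝ F y v) x := (smooth_fderiv hF).clm_apply contDiffAt_const

lemma smooth_differentiableAt {F : E' → E} {x : E'} (hF : ContDiffAt ℝ ∞ F x) :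
    DifferentiableAt ℝ F x := hF.differentiableAt (by simp)

lemma smooth_flip {E₁ E₂ : Type*} [NormedAddCommGroup E₁] [NormedSpace ℝ E₁]
    [NormedAddCommGroup E₂] [NormedSpace ℝ E₂] {B : E → E₁ →L[ℝ] E₂ →L[ℝ] H} {x : E}
    (hB : ContDiffAt ℝ ∞ B x) : ContDiffAt ℝ ∞ (fun y => (B y).flip) x := by
  have h : ContDiff ℝ ∞ (fun L : E₁ →L[ℝ] E₂ →L[ℝ] H => L.flip) :=
    IsBoundedLinearMap.contDiff ⟨⟨fun _ _ => rfl, fun _ _ => rfl⟩, 1, one_pos, fun L => by simp⟩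
  exact ContDiffAt.comp (g := fun L : E₁ →L[ℝ] E₂ →L[ℝ] H => L.flip) x h.contDiffAt hB

lemma smooth_bilinearComp {B : E' → E →L[ℝ] E →L[ℝ] ℝ} {A : E' → H →L[ℝ] E} {x : E'}
    (hB : ContDiffAt ℝ ∞ B x) (hA : ContDiffAt ℝ ∞ A x) :
    ContDiffAt ℝ ∞ (fun y => (B y).bilinearComp (A y) (A y)) x := by
  have h1 : ContDiffAt ℝ ∞ (fun y => ((B y).comp (A y)).flip) x :=
    smooth_flip (hB.clm_comp hA)
  exact smooth_flip (h1.clm_comp hA)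

end Calculus

variable {m n : ℕ}

section Along

variable {G : BilinField m} {U : Set (Euc m)} {F : Euc n → Euc m} {x : Euc n}

lemma inducedMetric_apply (G : BilinField m) (F : Euc n → Euc m) (x u v : Euc n) :
    inducedMetric G F x u v = G (F x) (fderiv ℝ F x u) (fderiv ℝ F x v) := rfl

lemma covDeriv_smooth {X : Euc n → Euc m} (hG : IsRiem G U) (hx : F x ∈ U)
    (hF : ContDiffAt ℝ ∞ F x) (hX : ContDiffAt ℝ ∞ X x) (v : Euc n) :
    ContDiffAt ℝ ∞ (fun y => covDeriv G F X y v) x := by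
  unfold covDeriv
  simp only [← chris_apply]
  exact (smooth_fderiv_apply hX v).add
    ((((hG.chris_smooth hx).comp x hF).clm_apply (smooth_fderiv_apply hF v)).clm_apply hX)

/-- Compatibility of the covariant derivative along `F` with the metric. -/
lemma fderiv_inner_along {X Y : Euc n → Euc m} (hG : IsRiem G U) (hx : F x ∈ U)
    (hF : DifferentiableAt ℝ F x) (hX : DifferentiableAt ℝ X x) (hY : DifferentiableAt ℝ Y x)
    (u : Euc n) :
    fderiv ℝ (fun y => G (F y) (X y) (Y y)) x u
      = G (F x) (covDeriv G F X x u) (Y x) + G (F x) (X x) (covDeriv G F Y x u) := by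
  rw [fderiv_bilin_apply (hG.differentiableAt hx) hF hX hY, hG.christoffel_compat hx]
  simp only [covDeriv, map_add, add_apply]
  ring

/-- The connection is torsion-free: both the second derivative of `F` and the Christoffel symbols
are symmetric. -/
lemma covDeriv_fderiv_symm (hG : IsRiem G U) (hx : F x ∈ U) (hF : ContDiffAt ℝ ∞ F x)
    (u v : Euc n) :
    covDeriv G F (fun y => fderiv ℝ F y v) x u = covDeriv G F (fun y => fderiv ℝ F y u) x v := by
  unfold covDeriv
  rw [fderiv_fderiv_apply hF, fderiv_fderiv_apply hF, fderiv_fderiv_symm hF,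
    hG.christoffel_symm hx]

/-- The covariant derivative along `F` of the coordinate fields has the Christoffel symbols of the
induced metric as tangential part. -/
lemma inner_covDeriv_fderiv {V : Set (Euc n)} (hG : IsRiem G U) (hγ : IsRiem (inducedMetric G F) V)
    (hxV : x ∈ V) (hx : F x ∈ U) (hF : ContDiffAt ℝ ∞ F x) (u v w : Euc n) :
    G (F x) (covDeriv G F (fun y => fderiv ℝ F y v) x u) (fderiv ℝ F x w)
      = inducedMetric G F x (christoffel (inducedMetric G F) x u v) w := by
  have key : ∀ u v w, fderiv ℝ (inducedMetric G F) x u v w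
      = G (F x) (covDeriv G F (fun y => fderiv ℝ F y v) x u) (fderiv ℝ F x w)
        + G (F x) (fderiv ℝ F x v) (covDeriv G F (fun y => fderiv ℝ F y w) x u) := by
    intro u v w
    have h1 : fderiv ℝ (inducedMetric G F) x u v w
        = fderiv ℝ (fun y => inducedMetric G F y v w) x u := by
      have := fderiv_bilin_apply (F := fun y => y) (hγ.differentiableAt hxV) differentiableAt_id
        (differentiableAt_const v) (differentiableAt_const w) u
      rw [this]; simp
    rw [h1]
    exact fderiv_inner_along hG hx (smooth_differentiableAt hF)
      (smooth_differentiableAt (smooth_fderiv_apply hF v))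
      (smooth_differentiableAt (smooth_fderiv_apply hF w)) u
  -- Koszul's formula for the induced metric: each derivative is expanded by `key`, and by the
  -- symmetry of `∇ dF` all terms cancel except twice the wanted one.
  have h := hγ.christoffel_inner hxV u v w
  rw [key, key, key] at h
  have s1 := covDeriv_fderiv_symm hG hx hF u v
  have s2 := covDeriv_fderiv_symm hG hx hF u w
  have s3 := covDeriv_fderiv_symm hG hx hF v w
  rw [← s1, ← s2, ← s3] at h
  have e1 := hG.symm _ hx (fderiv ℝ F x v) (covDeriv G F (fun y => fderiv ℝ F y w) x u)
  linarith

lemma IsRiem.fderiv_christoffel {y : Euc m} (hG : IsRiem G U) (hy : y ∈ U) (a b : Euc m) :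
    fderiv ℝ (fun y => christoffel G y a b) y = ((fderiv ℝ (chris G) y).flip a).flip b := by
  ext1 u
  simp only [← chris_apply]
  have := fderiv_bilin_apply (F := fun y => y) (smooth_differentiableAt (hG.chris_smooth hy))
    differentiableAt_id (differentiableAt_const a) (differentiableAt_const b) u
  rw [this]; simp

lemma IsRiem.curvature_eq {y : Euc m} (hG : IsRiem G U) (hy : y ∈ U) (u v w : Euc m) :
    curvature G y u v w = fderiv ℝ (chris G) y u v w - fderiv ℝ (chris G) y v u w
      + chris G y u (chris G y v w) - chris G y v (chris G y u w) := by
  unfold curvature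
  rw [hG.fderiv_christoffel hy, hG.fderiv_christoffel hy]
  simp only [← chris_apply, ContinuousLinearMap.flip_apply]

/-- The curvature as commutator of covariant derivatives of a field along a map. -/
lemma covDeriv_commutator {X : Euc n → Euc m} {V : Set (Euc n)} (hxV : x ∈ V)
    (hG : IsRiem G U) (hFU : MapsTo F V U)
    (hF : ∀ y ∈ V, ContDiffAt ℝ ∞ F y) (hX : ∀ y ∈ V, ContDiffAt ℝ ∞ X y) (u v : Euc n) :
    covDeriv G F (fun y => covDeriv G F X y v) x u - covDeriv G F (fun y => covDeriv G F X y u) x v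
      = curvature G (F x) (fderiv ℝ F x u) (fderiv ℝ F x v) (X x) := by
  have hx := hFU hxV
  have hFx := hF x hxV
  have hXx := hX x hxV
  have hd : ∀ u v, fderiv ℝ (fun y => covDeriv G F X y v) x u
      = fderiv ℝ (fderiv ℝ X) x u v
        + (fderiv ℝ (chris G) (F x) (fderiv ℝ F x u) (fderiv ℝ F x v) (X x)
          + chris G (F x) (fderiv ℝ (fderiv ℝ F) x u v) (X x)
          + chris G (F x) (fderiv ℝ F x v) (fderiv ℝ X x u)) := by
    intro u v
    unfold covDeriv
    simp only [← chris_apply]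
    have hsm : ContDiffAt ℝ ∞ (fun y => chris G (F y) (fderiv ℝ F y v) (X y)) x :=
      (((hG.chris_smooth hx).comp x hFx).clm_apply (smooth_fderiv_apply hFx v)).clm_apply hXx
    rw [fderiv_fun_add (smooth_differentiableAt (smooth_fderiv_apply hXx v))
      (smooth_differentiableAt hsm)]
    rw [add_apply, fderiv_fderiv_apply hXx,
      fderiv_bilin_apply (smooth_differentiableAt (hG.chris_smooth hx))
        (smooth_differentiableAt hFx) (smooth_differentiableAt (smooth_fderiv_apply hFx v))
        (smooth_differentiableAt hXx), fderiv_fderiv_apply hFx]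
  simp only [covDeriv] at hd ⊢
  -- The second derivatives of `X` and `F` are symmetric and drop out of the commutator; the terms
  -- in `dΓ` and `ΓΓ` that remain form the curvature.
  rw [hd u v, hd v u, fderiv_fderiv_symm hFx v u, fderiv_fderiv_symm hXx v u]
  rw [hG.curvature_eq hx]
  simp only [← chris_apply, map_add]
  abel

end Along

end MinimalHypersurface

end

/-! ### Hypersurfaces with a unit normal: the Jacobi operator as a scalar operator -/

noncomputable section

namespace MinimalHypersurface

set_option synthInstance.maxHeartbeats 200000

variable {n : ℕ}

/-- `F` is a smooth immersed hypersurface on `V` for the metric `G` on `U`, with smooth unit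
normal `N`. -/
structure HypData (G : BilinField (n + 1)) (U : Set (Euc (n + 1))) (F : Euc n → Euc (n + 1))
    (V : Set (Euc n)) (N : Euc n → Euc (n + 1)) : Prop where
  riem : IsRiem G U
  isOpen : IsOpen V
  maps : MapsTo F V U
  smooth : ∀ y ∈ V, ContDiffAt ℝ ∞ F y
  inj : ∀ y ∈ V, Function.Injective (fderiv ℝ F y)
  smoothN : ∀ y ∈ V, ContDiffAt ℝ ∞ N y
  unit : ∀ y ∈ V, IsUnitNormal G F y (N y)

/-- The Laplacian of a function. -/
def lap (γ : BilinField n) (f : Euc n → ℝ) (x : Euc n) : ℝ :=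
  traceWith (γ x) fun u v => fderiv ℝ (fderiv ℝ f) x u v - fderiv ℝ f x (christoffel γ x u v)

/-- The scalar second fundamental form. -/
def sff (G : BilinField (n + 1)) (F N : Euc n → Euc (n + 1)) (x u v : Euc n) : ℝ :=
  G (F x) (N x) (covDeriv G F (fun y => fderiv ℝ F y v) x u)

/-- The potential `Ric(N, N) + |A|²` of the Jacobi operator. -/
def pot (G : BilinField (n + 1)) (F N : Euc n → Euc (n + 1)) (x : Euc n) : ℝ :=
  ricci G (F x) (N x) (N x) + ∑ a, ∑ b, sff G F N x (stdVec a) (stdVec b) *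
    sff G F N x (raisedVec (inducedMetric G F x) a) (raisedVec (inducedMetric G F x) b)

lemma traceWith_smul {m : ℕ} {W : Type*} [AddCommGroup W] [Module ℝ W]
    (B : Euc m →L[ℝ] Euc m →L[ℝ] ℝ) (T : Euc m → Euc m → ℝ) (w : W) :
    traceWith B (fun u v => T u v • w) = traceWith B T • w := by
  simp [traceWith, Finset.sum_smul]

/-- The curvature is linear in its last two arguments. This makes the arbitrary sign of `unitNormal`
harmless. -/
lemma ricci_neg {m : ℕ} (G : BilinField m) (x v w : Euc m) :
    ricci G x (-v) (-w) = ricci G x v w := by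
  have h : ∀ u, curvature G x u (-v) (-w) = curvature G x u v w := by
    intro u
    have e1 : (fun y => christoffel G y (-v) (-w)) = fun y => christoffel G y v w := by
      funext y; simp [← chris_apply]
    have e2 : (fun y => christoffel G y u (-w)) = fun y => -christoffel G y u w := by
      funext y; simp [← chris_apply]
    have e3 : christoffel G x (-v) (-w) = christoffel G x v w := by simp [← chris_apply]
    have e4 : christoffel G x u (-w) = -christoffel G x u w := by simp [← chris_apply]
    unfold curvature
    rw [e1, e2, e3, e4, fderiv_fun_neg]
    simp [← chris_apply]
  simp [ricci, h]

lemma covDeriv_congr {m : ℕ} {G : BilinField m} {F : Euc n → Euc m} {X Y : Euc n → Euc m}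
    {x : Euc n} (h : X =ᶠ[𝓝 x] Y) (u : Euc n) : covDeriv G F X x u = covDeriv G F Y x u := by
  unfold covDeriv
  rw [h.fderiv_eq, h.eq_of_nhds]

lemma normalDeriv_congr {m : ℕ} {G : BilinField m} {F : Euc n → Euc m} {X Y : Euc n → Euc m}
    {x : Euc n} (h : X =ᶠ[𝓝 x] Y) (u : Euc n) :
    normalDeriv G F X x u = normalDeriv G F Y x u := by
  unfold normalDeriv
  rw [covDeriv_congr h]

lemma covDeriv_smul {m : ℕ} {G : BilinField m} {F : Euc n → Euc m} {X : Euc n → Euc m}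
    {f : Euc n → ℝ} {x : Euc n} (hf : DifferentiableAt ℝ f x) (hX : DifferentiableAt ℝ X x)
    (u : Euc n) :
    covDeriv G F (fun y => f y • X y) x u = fderiv ℝ f x u • X x + f x • covDeriv G F X x u := by
  unfold covDeriv
  rw [fderiv_fun_smul hf hX]
  simp only [← chris_apply, map_smul, add_apply, smul_apply,
    ContinuousLinearMap.smulRight_apply, smul_add]
  abel

lemma isRiem_inducedMetric {m : ℕ} {G : BilinField m} {U : Set (Euc m)} {F : Euc n → Euc m}
    {V : Set (Euc n)} (hG : IsRiem G U) (hV : IsOpen V) (hF : MapsTo F V U)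
    (hs : ∀ y ∈ V, ContDiffAt ℝ ∞ F y) (hi : ∀ y ∈ V, Function.Injective (fderiv ℝ F y)) :
    IsRiem (inducedMetric G F) V where
  isOpen := hV
  smooth y hy := smooth_bilinearComp ((hG.smooth _ (hF hy)).comp y (hs y hy))
    (smooth_fderiv (hs y hy))
  symm _ hy _ _ := hG.symm _ (hF hy) _ _
  pos y hy _ hv := hG.pos _ (hF hy) _ fun h => hv (hi y hy (h.trans (map_zero _).symm))

namespace HypData

variable {G : BilinField (n + 1)} {U : Set (Euc (n + 1))} {F : Euc n → Euc (n + 1)}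
  {V : Set (Euc n)} {N : Euc n → Euc (n + 1)} {x : Euc n}

lemma isRiem (h : HypData G U F V N) : IsRiem (inducedMetric G F) V :=
  isRiem_inducedMetric h.riem h.isOpen h.maps h.smooth h.inj

lemma mem_nhds (h : HypData G U F V N) (hx : x ∈ V) : V ∈ 𝓝 x := h.isOpen.mem_nhds hx

/-- The normal is independent of the `n`-dimensional image of `dF`, and the dimensions add up to `n
+ 1`. -/
lemma exists_decomp (h : HypData G U F V N) (hx : x ∈ V) (z : Euc (n + 1)) :
    ∃ (s : ℝ) (u : Euc n), z = s • N x + fderiv ℝ F x u := by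
  let L : (ℝ × Euc n) →ₗ[ℝ] Euc (n + 1) :=
    (LinearMap.toSpanSingleton ℝ (Euc (n + 1)) (N x)).coprod (fderiv ℝ F x : Euc n →ₗ[ℝ] _)
  have hL : ∀ p, L p = p.1 • N x + fderiv ℝ F x p.2 := fun p => by simp [L]
  have hinj : Function.Injective L := by
    rw [← LinearMap.ker_eq_bot, LinearMap.ker_eq_bot']
    intro p hp
    rw [hL] at hp
    have h1 := congrArg (fun w => G (F x) (N x) w) hp
    simp only [map_add, map_smul, (h.unit x hx).1, (h.unit x hx).2, map_zero, smul_eq_mul,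
      mul_one, add_zero] at h1
    rw [h1, zero_smul, zero_add] at hp
    exact Prod.ext h1 (h.inj x hx (hp.trans (map_zero _).symm))
  have hsurj : Function.Surjective L :=
    (LinearMap.injective_iff_surjective_of_finrank_eq_finrank (by simp [add_comm])).1 hinj
  obtain ⟨p, rfl⟩ := hsurj z
  exact ⟨p.1, p.2, hL p⟩

/-- In codimension one, a normal vector is a multiple of the unit normal. -/
lemma eq_smul_of_normal (h : HypData G U F V N) (hx : x ∈ V) {z : Euc (n + 1)}
    (hz : ∀ u, G (F x) z (fderiv ℝ F x u) = 0) : z = G (F x) (N x) z • N x := by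
  obtain ⟨s, u, rfl⟩ := h.exists_decomp hx z
  have h1 := hz u
  simp only [map_add, map_smul, add_apply, smul_apply, (h.unit x hx).2, smul_zero, zero_add] at h1
  have h2 : fderiv ℝ F x u = 0 := by
    by_contra hne
    exact (h.riem.pos _ (h.maps hx) _ hne).ne' h1
  simp [h2, (h.unit x hx).1]

lemma normalPart_eq (h : HypData G U F V N) (hx : x ∈ V) (w : Euc (n + 1)) :
    normalPart G F x w = G (F x) (N x) w • N x := by
  have h1 : ∀ u, G (F x) (normalPart G F x w) (fderiv ℝ F x u) = 0 := by
    intro u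
    have := h.isRiem.inverse_apply hx ((G (F x) w).comp (fderiv ℝ F x)) u
    rw [inducedMetric_apply] at this
    simp [normalPart, this]
  rw [h.eq_smul_of_normal hx h1]
  simp [normalPart, (h.unit x hx).2]

/-- Differentiate `G(N, N) = 1`. Hence `N` is parallel for the normal connection, which acts on
fields `f N` by differentiating `f` alone. -/
lemma inner_normal_covDeriv (h : HypData G U F V N) (hx : x ∈ V) (u : Euc n) :
    G (F x) (N x) (covDeriv G F N x u) = 0 := by
  have h1 := fderiv_inner_along h.riem (h.maps hx) (smooth_differentiableAt (h.smooth x hx))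
    (smooth_differentiableAt (h.smoothN x hx)) (smooth_differentiableAt (h.smoothN x hx)) u
  have h2 : (fun y => G (F y) (N y) (N y)) =ᶠ[𝓝 x] fun _ => (1 : ℝ) := by
    filter_upwards [h.mem_nhds hx] with y hy using (h.unit y hy).1
  rw [h2.fderiv_eq, h.riem.symm _ (h.maps hx) (covDeriv G F N x u)] at h1
  simp at h1
  linarith

lemma normalDeriv_smul (h : HypData G U F V N) (hx : x ∈ V) {X : Euc n → Euc (n + 1)}
    {f : Euc n → ℝ} (hX : X =ᶠ[𝓝 x] fun y => f y • N y) (hf : DifferentiableAt ℝ f x)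
    (u : Euc n) : normalDeriv G F X x u = fderiv ℝ f x u • N x := by
  unfold normalDeriv
  rw [covDeriv_congr hX, covDeriv_smul hf (smooth_differentiableAt (h.smoothN x hx)),
    h.normalPart_eq hx]
  simp [h.inner_normal_covDeriv hx, (h.unit x hx).1]

lemma normalLaplacian_eq (h : HypData G U F V N) (hx : x ∈ V) {X : Euc n → Euc (n + 1)}
    {f : Euc n → ℝ} (hX : ∀ y ∈ V, X y = f y • N y) (hf : ∀ y ∈ V, ContDiffAt ℝ ∞ f y) :
    normalLaplacian G F X x = lap (inducedMetric G F) f x • N x := by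
  have hX' : ∀ y ∈ V, X =ᶠ[𝓝 y] fun y => f y • N y := fun y hy => by
    filter_upwards [h.mem_nhds hy] with z hz using hX z hz
  unfold normalLaplacian lap
  rw [← traceWith_smul]
  congr 1
  funext u v
  rw [h.normalDeriv_smul hx (hX' x hx) (smooth_differentiableAt (hf x hx)), sub_smul]
  congr 1
  have h1 : (fun y => normalDeriv G F X y v) =ᶠ[𝓝 x] fun y => fderiv ℝ f y v • N y := by
    filter_upwards [h.mem_nhds hx] with y hy
    exact h.normalDeriv_smul hy (hX' y hy) (smooth_differentiableAt (hf y hy)) v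
  rw [h.normalDeriv_smul hx h1 (smooth_differentiableAt (smooth_fderiv_apply (hf x hx) v)),
    fderiv_fderiv_apply (hf x hx)]

lemma secondForm_eq (h : HypData G U F V N) (hx : x ∈ V) (u v : Euc n) :
    secondForm G F x u v = sff G F N x u v • N x := by
  unfold secondForm normalDeriv
  rw [h.normalPart_eq hx, sff]

lemma normSqSecondForm_eq (h : HypData G U F V N) (hx : x ∈ V) :
    normSqSecondForm G F x = ∑ a, ∑ b, sff G F N x (stdVec a) (stdVec b) *
    sff G F N x (raisedVec (inducedMetric G F x) a) (raisedVec (inducedMetric G F x) b) := by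
  unfold normSqSecondForm
  simp [h.secondForm_eq hx, (h.unit x hx).1, mul_comm]

lemma eq_or_eq_neg (h : HypData G U F V N) (hx : x ∈ V) {z : Euc (n + 1)}
    (hz : IsUnitNormal G F x z) : z = N x ∨ z = -N x := by
  have h1 := h.eq_smul_of_normal hx hz.2
  have h2 := hz.1
  rw [h1] at h2
  simp only [map_smul, smul_apply, (h.unit x hx).1, smul_eq_mul, mul_one] at h2
  rcases mul_self_eq_one_iff.1 h2 with h3 | h3
  · left; rw [h1, h3, one_smul]
  · right; rw [h1, h3, neg_one_smul]

lemma ricci_unitNormal (h : HypData G U F V N) (hx : x ∈ V) :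
    ricci G (F x) (unitNormal G F x) (unitNormal G F x) = ricci G (F x) (N x) (N x) := by
  have h1 : IsUnitNormal G F x (unitNormal G F x) := Classical.epsilon_spec ⟨N x, h.unit x hx⟩
  rcases h.eq_or_eq_neg hx h1 with h2 | h2
  · rw [h2]
  · rw [h2, ricci_neg]

/-- The Jacobi operator in terms of scalar functions. -/
lemma jacobiInChart_eq (h : HypData G U F V N) (hx : x ∈ V) {X : Euc n → Euc (n + 1)}
    {f : Euc n → ℝ} (hX : ∀ y ∈ V, X y = f y • N y) (hf : ∀ y ∈ V, ContDiffAt ℝ ∞ f y) :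
    jacobiInChart G F X x = (lap (inducedMetric G F) f x + pot G F N x * f x) • N x := by
  unfold jacobiInChart pot
  rw [h.normalLaplacian_eq hx hX hf, h.ricci_unitNormal hx, h.normSqSecondForm_eq hx, hX x hx,
    smul_smul, ← add_smul]

lemma sff_eq (h : HypData G U F V N) (hx : x ∈ V) (u v : Euc n) :
    sff G F N x u v = G (F x) (N x) (fderiv ℝ (fderiv ℝ F) x u v
      + chris G (F x) (fderiv ℝ F x u) (fderiv ℝ F x v)) := by
  rw [sff, covDeriv, fderiv_fderiv_apply (h.smooth x hx), chris_apply]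

lemma raisedVec_smooth {m : ℕ} {γ : BilinField m} {V : Set (Euc m)} (h : IsRiem γ V)
    {x : Euc m} (hx : x ∈ V) (a : Fin m) : ContDiffAt ℝ ∞ (fun y => raisedVec (γ y) a) x :=
  (h.inverse_smooth hx).clm_apply contDiffAt_const

/-- Continuity is all that the spectral argument asks of the potential: it is then bounded on the
compact supports of the cut-offs. -/
lemma continuousOn_pot (h : HypData G U F V N) : ContinuousOn (pot G F N) V := by
  intro x hx
  have hFx := h.maps hx
  have cF : ContinuousAt F x := (h.smooth x hx).continuousAt
  have cN : ContinuousAt N x := (h.smoothN x hx).continuousAt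
  have cG : ContinuousAt (fun y => G (F y)) x :=
    ContinuousAt.comp (g := G) (h.riem.smooth _ hFx).continuousAt cF
  have cC : ContinuousAt (fun y => chris G (F y)) x :=
    ContinuousAt.comp (g := chris G) (h.riem.chris_smooth hFx).continuousAt cF
  have cC' : ContinuousAt (fun y => fderiv ℝ (chris G) (F y)) x :=
    ContinuousAt.comp (g := fderiv ℝ (chris G))
      (smooth_fderiv (h.riem.chris_smooth hFx)).continuousAt cF
  have cD : ContinuousAt (fderiv ℝ F) x := (smooth_fderiv (h.smooth x hx)).continuousAt
  have cD2 : ContinuousAt (fderiv ℝ (fderiv ℝ F)) x :=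
    (smooth_fderiv (smooth_fderiv (h.smooth x hx))).continuousAt
  have cs : ∀ u v : Euc n → Euc n, ContinuousAt u x → ContinuousAt v x →
      ContinuousAt (fun y => sff G F N y (u y) (v y)) x := by
    intro u v hu hv
    have : ContinuousAt (fun y => G (F y) (N y) (fderiv ℝ (fderiv ℝ F) y (u y) (v y)
      + chris G (F y) (fderiv ℝ F y (u y)) (fderiv ℝ F y (v y)))) x :=
      (cG.clm_apply cN).clm_apply (((cD2.clm_apply hu).clm_apply hv).add
        ((cC.clm_apply (cD.clm_apply hu)).clm_apply (cD.clm_apply hv)))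
    refine this.congr ?_
    filter_upwards [h.mem_nhds hx] with y hy using (h.sff_eq hy _ _).symm
  have cr : ∀ a : Fin n, ContinuousAt (fun y => raisedVec (inducedMetric G F y) a) x :=
    fun a => (raisedVec_smooth h.isRiem hx a).continuousAt
  have hR : ContinuousAt (fun y => ricci G (F y) (N y) (N y)) x := by
    have : ContinuousAt (fun y => ∑ a, (fderiv ℝ (chris G) (F y) (stdVec a) (N y) (N y)
        - fderiv ℝ (chris G) (F y) (N y) (stdVec a) (N y)
        + chris G (F y) (stdVec a) (chris G (F y) (N y) (N y))
        - chris G (F y) (N y) (chris G (F y) (stdVec a) (N y))) a) x := by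
      refine tendsto_finsetSum _ fun a _ => ?_
      have cp : Continuous fun z : Euc (n + 1) => z a := by fun_prop
      refine ContinuousAt.comp (g := fun z : Euc (n + 1) => z a) cp.continuousAt ?_
      have ca : ContinuousAt (fun _ : Euc n => (stdVec a : Euc (n + 1))) x := continuousAt_const
      exact (((((cC'.clm_apply ca).clm_apply cN).clm_apply cN).sub
        (((cC'.clm_apply cN).clm_apply ca).clm_apply cN)).add
        ((cC.clm_apply ca).clm_apply ((cC.clm_apply cN).clm_apply cN))).sub
        ((cC.clm_apply cN).clm_apply ((cC.clm_apply ca).clm_apply cN))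
    refine this.congr ?_
    filter_upwards [h.mem_nhds hx] with y hy
    simp only [ricci, h.riem.curvature_eq (h.maps hy)]
  refine (ContinuousAt.add hR ?_).continuousWithinAt
  refine tendsto_finsetSum _ fun a _ => tendsto_finsetSum _ fun b _ => ?_
  exact (cs _ _ continuousAt_const continuousAt_const).mul (cs _ _ (cr a) (cr b))

end HypData

end MinimalHypersurface

end

/-! ### Invariance of curvature and Laplacian under local isometries -/

noncomputable section

namespace MinimalHypersurface

set_option synthInstance.maxHeartbeats 200000

section Trace

variable {m : ℕ}

lemma sum_apply_stdVec (S : Euc m →ₗ[ℝ] Euc m) :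
    ∑ a, (S (stdVec a)) a = LinearMap.trace ℝ (Euc m) S := by
  rw [LinearMap.trace_eq_matrix_trace ℝ (EuclideanSpace.basisFun (Fin m) ℝ).toBasis,
    Matrix.trace]
  refine Finset.sum_congr rfl fun a _ => ?_
  simp [LinearMap.toMatrix_apply, stdVec]

/-- Since `B (raisedVec B a) w = w a`, the metric trace of `T` is the trace of the endomorphism that
represents `T`, a quantity independent of the basis. -/
lemma traceWith_eq_trace {B : Euc m →L[ℝ] Euc m →L[ℝ] ℝ} (hs : ∀ v w, B v w = B w v)
    (hp : ∀ v, v ≠ 0 → 0 < B v v) (T : Euc m →ₗ[ℝ] Euc m →ₗ[ℝ] ℝ) (S : Euc m →ₗ[ℝ] Euc m)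
    (hS : ∀ u v, T u v = B (S u) v) :
    traceWith B (fun u v => T u v) = LinearMap.trace ℝ (Euc m) S := by
  rw [← sum_apply_stdVec, traceWith]
  refine Finset.sum_congr rfl fun a _ => ?_
  rw [hS, hs, raisedVec, (isInvertible_of_pos hp).self_apply_inverse]
  rfl

lemma exists_bilin_repr {B : Euc m →L[ℝ] Euc m →L[ℝ] ℝ} 
    (hp : ∀ v, v ≠ 0 → 0 < B v v) (T : Euc m →ₗ[ℝ] Euc m →ₗ[ℝ] ℝ) :
    ∃ S : Euc m →ₗ[ℝ] Euc m, ∀ u v, T u v = B (S u) v := by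
  refine ⟨(B.inverse : (Euc m →L[ℝ] ℝ) →ₗ[ℝ] Euc m) ∘ₗ
    (LinearMap.toContinuousLinearMap (𝕜 := ℝ) (E := Euc m) (F' := ℝ)).toLinearMap ∘ₗ T, ?_⟩
  intro u v
  simp [(isInvertible_of_pos hp).self_apply_inverse]

/-- The trace with respect to a metric is invariant under linear isomorphisms. -/
lemma traceWith_comp {B B' : Euc m →L[ℝ] Euc m →L[ℝ] ℝ} (hs : ∀ v w, B v w = B w v)
    (hp : ∀ v, v ≠ 0 → 0 < B v v) (A : Euc m ≃ₗ[ℝ] Euc m) (hB : ∀ v w, B' v w = B (A v) (A w))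
    (T : Euc m →ₗ[ℝ] Euc m →ₗ[ℝ] ℝ) :
    traceWith B' (fun u v => T (A u) (A v)) = traceWith B (fun u v => T u v) := by
  obtain ⟨S, hS⟩ := exists_bilin_repr hp T
  rw [traceWith_eq_trace hs hp T S hS]
  have hs' : ∀ v w, B' v w = B' w v := fun v w => by rw [hB, hB, hs]
  have hp' : ∀ v, v ≠ 0 → 0 < B' v v := fun v hv => by
    rw [hB]; exact hp _ (by simpa using hv)
  have h := traceWith_eq_trace hs' hp' (T.compl₁₂ A.toLinearMap A.toLinearMap)
    (A.symm.conj S) (fun u v => by simp [hB, hS, LinearEquiv.conj_apply])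
  rw [LinearMap.trace_conj'] at h
  exact h

/-- The squared norm of a bilinear form is invariant under linear isomorphisms. -/
lemma traceWith_traceWith_comp {B B' : Euc m →L[ℝ] Euc m →L[ℝ] ℝ} (hs : ∀ v w, B v w = B w v)
    (hp : ∀ v, v ≠ 0 → 0 < B v v) (A : Euc m ≃ₗ[ℝ] Euc m) (hB : ∀ v w, B' v w = B (A v) (A w))
    (S : Euc m →ₗ[ℝ] Euc m →ₗ[ℝ] ℝ) :
    traceWith B' (fun u w => traceWith B' fun a b => S (A u) (A a) * S (A w) (A b))
      = traceWith B (fun u w => traceWith B fun a b => S u a * S w b) := by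
  have h1 : ∀ u w, traceWith B' (fun a b => S u (A a) * S w (A b))
      = traceWith B (fun a b => S u a * S w b) := fun u w =>
    traceWith_comp hs hp A hB (LinearMap.mk₂ ℝ (fun a b => S u a * S w b)
      (fun a b c => by simp only [map_add]; ring)
      (fun c a b => by simp only [map_smul, smul_eq_mul]; ring)
      (fun a b c => by simp only [map_add]; ring)
      (fun c a b => by simp only [map_smul, smul_eq_mul]; ring))
  simp only [h1]
  refine traceWith_comp hs hp A hB (LinearMap.mk₂ ℝ
    (fun u w => traceWith B fun a b => S u a * S w b) ?_ ?_ ?_ ?_)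
  · intro a b c
    simp only [traceWith, ← Finset.sum_add_distrib]
    exact Finset.sum_congr rfl fun i _ => by simp only [map_add, LinearMap.add_apply]; ring
  · intro c a b
    simp only [traceWith, smul_eq_mul, Finset.mul_sum]
    exact Finset.sum_congr rfl fun i _ => by
      simp only [map_smul, LinearMap.smul_apply, smul_eq_mul]; ring
  · intro a b c
    simp only [traceWith, ← Finset.sum_add_distrib]
    exact Finset.sum_congr rfl fun i _ => by simp only [map_add, LinearMap.add_apply]; ring
  · intro c a b
    simp only [traceWith, smul_eq_mul, Finset.mul_sum]
    exact Finset.sum_congr rfl fun i _ => by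
      simp only [map_smul, LinearMap.smul_apply, smul_eq_mul]; ring

end Trace

section Transform

variable {m n : ℕ}

lemma injective_of_metric {G G' : Euc m →L[ℝ] Euc m →L[ℝ] ℝ} {A : Euc m →L[ℝ] Euc m}
    (hp : ∀ v, v ≠ 0 → 0 < G' v v) (h : ∀ u v, G' u v = G (A u) (A v)) :
    Function.Injective A := by
  rw [injective_iff_map_eq_zero]
  intro v hv
  by_contra hne
  have := hp v hne
  rw [h, hv] at this
  simp at this

lemma surjective_of_injective {A : Euc m →L[ℝ] Euc m} (h : Function.Injective A) :
    Function.Surjective A :=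
  LinearMap.surjective_of_injective (f := (A : Euc m →ₗ[ℝ] Euc m)) h

variable {G G' : BilinField m} {U U' : Set (Euc m)} {Φ : Euc m → Euc m} {x : Euc m}

/-- `Φ` is a local isometry from `(U', G')` to `(U, G)`. -/
structure IsLocalIsometry (G' : BilinField m) (U' : Set (Euc m)) (G : BilinField m)
    (U : Set (Euc m)) (Φ : Euc m → Euc m) : Prop where
  source : IsRiem G' U'
  target : IsRiem G U
  maps : MapsTo Φ U' U
  smooth : ∀ x ∈ U', ContDiffAt ℝ ∞ Φ x
  metric : ∀ x ∈ U', ∀ u v, G' x u v = G (Φ x) (fderiv ℝ Φ x u) (fderiv ℝ Φ x v)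

namespace IsLocalIsometry

lemma injective (h : IsLocalIsometry G' U' G U Φ) (hx : x ∈ U') :
    Function.Injective (fderiv ℝ Φ x) :=
  injective_of_metric (h.source.pos x hx) (h.metric x hx)

lemma surjective (h : IsLocalIsometry G' U' G U Φ) (hx : x ∈ U') :
    Function.Surjective (fderiv ℝ Φ x) := surjective_of_injective (h.injective hx)

lemma isInvertible (h : IsLocalIsometry G' U' G U Φ) (hx : x ∈ U') :
    (fderiv ℝ Φ x).IsInvertible :=
  ⟨(LinearEquiv.ofBijective (fderiv ℝ Φ x : Euc m →ₗ[ℝ] Euc m)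
    ⟨h.injective hx, h.surjective hx⟩).toContinuousLinearEquiv, by ext v; rfl⟩

lemma exists_equiv (h : IsLocalIsometry G' U' G U Φ) (hx : x ∈ U') :
    ∃ A : Euc m ≃ₗ[ℝ] Euc m, ∀ u, A u = fderiv ℝ Φ x u :=
  ⟨LinearEquiv.ofBijective (fderiv ℝ Φ x : Euc m →ₗ[ℝ] Euc m)
    ⟨h.injective hx, h.surjective hx⟩, fun _ => rfl⟩

lemma eqOn (h : IsLocalIsometry G' U' G U Φ) (hx : x ∈ U') :
    G' x = inducedMetric G Φ x := by
  ext u v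
  exact h.metric x hx u v

/-- A local isometry is an immersion of codimension zero with induced metric `G'`. So
`inner_covDeriv_fderiv`, which gives tangential parts, determines the whole vector. -/
lemma map_christoffel (h : IsLocalIsometry G' U' G U Φ) (hx : x ∈ U') (u v : Euc m) :
    covDeriv G Φ (fun y => fderiv ℝ Φ y v) x u = fderiv ℝ Φ x (christoffel G' x u v) := by
  have hr := isRiem_inducedMetric h.target h.source.isOpen h.maps h.smooth
    fun y hy => h.injective hy
  have he : G' =ᶠ[𝓝 x] inducedMetric G Φ := by
    filter_upwards [h.source.mem_nhds hx] with y hy using h.eqOn hy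
  have hc : christoffel G' x u v = christoffel (inducedMetric G Φ) x u v := by
    unfold christoffel; rw [he.fderiv_eq, he.eq_of_nhds]
  refine h.target.ext_of_inner (h.maps hx) fun z => ?_
  obtain ⟨w, rfl⟩ := h.surjective hx z
  rw [inner_covDeriv_fderiv h.target hr hx (h.maps hx) (h.smooth x hx), hc,
    inducedMetric_apply]

/-- The chain rule produces a term with the second derivative of `Φ`; by `map_christoffel` it is
exactly the defect of the Christoffel symbols from being a tensor. -/
lemma map_covDeriv (h : IsLocalIsometry G' U' G U Φ) {F : Euc n → Euc m} {X : Euc n → Euc m}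
    {y : Euc n} (hy : F y ∈ U') (hF : DifferentiableAt ℝ F y) (hX : DifferentiableAt ℝ X y)
    (u : Euc n) :
    covDeriv G (fun z => Φ (F z)) (fun z => fderiv ℝ Φ (F z) (X z)) y u
      = fderiv ℝ Φ (F y) (covDeriv G' F X y u) := by
  have hΦ := h.smooth _ hy
  have h1 := h.map_christoffel hy (fderiv ℝ F y u) (X y)
  rw [covDeriv, fderiv_fderiv_apply hΦ] at h1
  have hd : HasFDerivAt (fun z => fderiv ℝ Φ (F z))
      ((fderiv ℝ (fderiv ℝ Φ) (F y)).comp (fderiv ℝ F y)) y :=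
    HasFDerivAt.comp (g := fderiv ℝ Φ) y
      (smooth_differentiableAt (smooth_fderiv hΦ)).hasFDerivAt hF.hasFDerivAt
  have hd2 : HasFDerivAt (fun z => Φ (F z)) ((fderiv ℝ Φ (F y)).comp (fderiv ℝ F y)) y :=
    HasFDerivAt.comp (g := Φ) y (smooth_differentiableAt hΦ).hasFDerivAt hF.hasFDerivAt
  unfold covDeriv
  rw [(hd.clm_apply hX.hasFDerivAt).fderiv, hd2.fderiv]
  simp only [map_add, add_apply, ContinuousLinearMap.comp_apply,
    ContinuousLinearMap.flip_apply] at h1 ⊢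
  rw [← h1]
  abel

/-- Both curvatures are commutators of covariant derivatives and `dΦ` intertwines these, so third
derivatives of `Φ` never appear. -/
lemma map_curvature (h : IsLocalIsometry G' U' G U Φ) (hx : x ∈ U') (u v w : Euc m) :
    curvature G (Φ x) (fderiv ℝ Φ x u) (fderiv ℝ Φ x v) (fderiv ℝ Φ x w)
      = fderiv ℝ Φ x (curvature G' x u v w) := by
  have hid : ∀ y ∈ U', ContDiffAt ℝ ∞ (fun z : Euc m => z) y := fun y _ => contDiffAt_id
  have hw : ∀ y ∈ U', ContDiffAt ℝ ∞ (fun _ : Euc m => w) y := fun y _ => contDiffAt_const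
  have h1 := covDeriv_commutator (X := fun y => fderiv ℝ Φ y w) hx h.target h.maps h.smooth
    (fun y hy => smooth_fderiv_apply (h.smooth y hy) w) u v
  have h2 := covDeriv_commutator hx h.source (F := fun z => z) (mapsTo_id _) hid hw u v
  simp only [fderiv_fun_id, ContinuousLinearMap.id_apply] at h2
  rw [← h1, ← h2, map_sub]
  have key : ∀ a b, covDeriv G Φ (fun y => covDeriv G Φ (fun y => fderiv ℝ Φ y w) y b) x a
      = fderiv ℝ Φ x (covDeriv G' (fun z => z)
        (fun y => covDeriv G' (fun z => z) (fun _ => w) y b) x a) := by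
    intro a b
    have he : (fun y => covDeriv G Φ (fun y => fderiv ℝ Φ y w) y b) =ᶠ[𝓝 x]
        fun y => fderiv ℝ Φ y (covDeriv G' (fun z => z) (fun _ => w) y b) := by
      filter_upwards [h.source.mem_nhds hx] with y hy
      exact h.map_covDeriv (F := fun z => z) hy differentiableAt_id (differentiableAt_const w) b
    rw [covDeriv_congr he]
    exact h.map_covDeriv (F := fun z => z) hx differentiableAt_id
      (smooth_differentiableAt (covDeriv_smooth h.source hx (hid x hx) (hw x hx) b)) a
  rw [key, key]

lemma map_ricci (h : IsLocalIsometry G' U' G U Φ) (hx : x ∈ U') (v w : Euc m) :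
    ricci G (Φ x) (fderiv ℝ Φ x v) (fderiv ℝ Φ x w) = ricci G' x v w := by
  let S : Euc m →ₗ[ℝ] Euc m :=
    { toFun := fun u => curvature G (Φ x) u (fderiv ℝ Φ x v) (fderiv ℝ Φ x w)
      map_add' := fun a b => by
        rw [h.target.curvature_eq (h.maps hx), h.target.curvature_eq (h.maps hx),
          h.target.curvature_eq (h.maps hx)]
        simp only [map_add, add_apply]
        abel
      map_smul' := fun c a => by
        rw [h.target.curvature_eq (h.maps hx), h.target.curvature_eq (h.maps hx)]
        simp only [map_smul, smul_apply, RingHom.id_apply, smul_sub, smul_add] }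
  obtain ⟨A, hA⟩ := h.exists_equiv hx
  have h1 : ricci G (Φ x) (fderiv ℝ Φ x v) (fderiv ℝ Φ x w) = LinearMap.trace ℝ (Euc m) S :=
    sum_apply_stdVec S
  have h2 : ricci G' x v w = LinearMap.trace ℝ (Euc m) (A.symm.conj S) := by
    rw [← sum_apply_stdVec, ricci]
    refine Finset.sum_congr rfl fun a _ => ?_
    have hS : curvature G' x (stdVec a) v w = A.symm.conj S (stdVec a) := by
      apply A.injective
      rw [hA (curvature _ _ _ _ _), ← h.map_curvature hx]
      simp [LinearEquiv.conj_apply, S, hA (stdVec a)]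
    rw [hS]
  rw [h1, h2, LinearMap.trace_conj']

/-- The Laplacian is invariant under local isometries. -/
lemma lap_comp (h : IsLocalIsometry G' U' G U Φ) (hx : x ∈ U') {f : Euc m → ℝ}
    (hf : ContDiffAt ℝ ∞ f (Φ x)) : lap G' (fun y => f (Φ y)) x = lap G f (Φ x) := by
  have hΦ := h.smooth x hx
  let T : Euc m →ₗ[ℝ] Euc m →ₗ[ℝ] ℝ := LinearMap.mk₂ ℝ
    (fun u v => fderiv ℝ (fderiv ℝ f) (Φ x) u v - fderiv ℝ f (Φ x) (christoffel G (Φ x) u v))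
    (fun a b c => by simp only [← chris_apply, map_add, add_apply]; ring)
    (fun c a b => by simp only [← chris_apply, map_smul, smul_apply, smul_eq_mul]; ring)
    (fun a b c => by simp only [← chris_apply, map_add]; ring)
    (fun c a b => by simp only [← chris_apply, map_smul, smul_eq_mul]; ring)
  obtain ⟨A, hA⟩ := h.exists_equiv hx
  have key := traceWith_comp (h.target.symm _ (h.maps hx)) (h.target.pos _ (h.maps hx)) A
    (fun v w => by rw [hA, hA]; exact h.metric x hx v w) T
  unfold lap
  refine Eq.trans ?_ key
  congr 1
  funext u v
  have hdf : ∀ y, DifferentiableAt ℝ Φ y → DifferentiableAt ℝ f (Φ y) →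
      fderiv ℝ (fun y => f (Φ y)) y = (fderiv ℝ f (Φ y)).comp (fderiv ℝ Φ y) := by
    intro y h1 h2
    exact (HasFDerivAt.comp (g := f) y h2.hasFDerivAt h1.hasFDerivAt).fderiv
  have hd1 := hdf x (smooth_differentiableAt hΦ) (smooth_differentiableAt hf)
  have hcomp : ContDiffAt ℝ ∞ (fun y => f (Φ y)) x := hf.comp x hΦ
  have hev : (fun y => fderiv ℝ (fun y => f (Φ y)) y v)
      =ᶠ[𝓝 x] fun y => fderiv ℝ f (Φ y) (fderiv ℝ Φ y v) := by
    have e1 : ∀ᶠ z in 𝓝 (Φ x), DifferentiableAt ℝ f z :=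
      ((hf.of_le (m := 1) (by simp)).eventually (by simp)).mono
        fun z hz => hz.differentiableAt (by simp)
    filter_upwards [h.source.mem_nhds hx, hΦ.continuousAt.eventually e1] with y hy hy1
    rw [hdf y (smooth_differentiableAt (h.smooth y hy)) hy1]; rfl
  have hd : HasFDerivAt (fun z => fderiv ℝ f (Φ z))
      ((fderiv ℝ (fderiv ℝ f) (Φ x)).comp (fderiv ℝ Φ x)) x :=
    HasFDerivAt.comp (g := fderiv ℝ f) x
      (smooth_differentiableAt (smooth_fderiv hf)).hasFDerivAt
      (smooth_differentiableAt hΦ).hasFDerivAt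
  have hd3 := (hd.clm_apply
    (smooth_differentiableAt (smooth_fderiv_apply hΦ v)).hasFDerivAt).fderiv
  -- The Hessian of `f ∘ Φ` contains `df(D²Φ)`; this equation trades `D²Φ(u, v)` for the difference
  -- of the two Christoffel terms.
  have hmc := h.map_christoffel hx u v
  rw [covDeriv] at hmc
  rw [← fderiv_fderiv_apply hcomp, hev.fderiv_eq, hd1]
  simp only [T, hA, LinearMap.mk₂_apply, hd3,
    ContinuousLinearMap.comp_apply, add_apply,
    ContinuousLinearMap.flip_apply, ← hmc, map_add]
  ring

end IsLocalIsometry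

end Transform

/-! ### The Jacobi operator under a change of charts -/

section ChangeOfCharts

variable {n : ℕ} {G G' : BilinField (n + 1)} {U U' : Set (Euc (n + 1))}
  {Φ : Euc (n + 1) → Euc (n + 1)} {F F' : Euc n → Euc (n + 1)} {V V' : Set (Euc n)}
  {N : Euc n → Euc (n + 1)} {ψ : Euc n → Euc n}

/-- A change of charts for an immersed hypersurface. -/
structure IsChartChange (F' : Euc n → Euc (n + 1)) (V' : Set (Euc n)) (F : Euc n → Euc (n + 1))
    (V : Set (Euc n)) (ψ : Euc n → Euc n) (Φ : Euc (n + 1) → Euc (n + 1)) : Prop where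
  isOpen : IsOpen V'
  smooth : ∀ y ∈ V', ContDiffAt ℝ ∞ F' y
  inj : ∀ y ∈ V', Function.Injective (fderiv ℝ F' y)
  maps : MapsTo ψ V' V
  smooth_ψ : ∀ y ∈ V', ContDiffAt ℝ ∞ ψ y
  comm : ∀ y ∈ V', Φ (F' y) = F (ψ y)

/-- The pull-back of the unit normal by a change of charts. -/
def pullNormal (Φ : Euc (n + 1) → Euc (n + 1)) (F' N : Euc n → Euc (n + 1)) (ψ : Euc n → Euc n)
    (y : Euc n) : Euc (n + 1) :=
  (fderiv ℝ Φ (F' y)).inverse (N (ψ y))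

variable {y : Euc n}

lemma IsChartChange.fderiv_comm (hc : IsChartChange F' V' F V ψ Φ) (h : HypData G U F V N)
    (hΦ : IsLocalIsometry G' U' G U Φ) (hU : MapsTo F' V' U') (hy : y ∈ V') (u : Euc n) :
    fderiv ℝ Φ (F' y) (fderiv ℝ F' y u) = fderiv ℝ F (ψ y) (fderiv ℝ ψ y u) := by
  have h1 : HasFDerivAt (fun z => Φ (F' z)) ((fderiv ℝ Φ (F' y)).comp (fderiv ℝ F' y)) y :=
    HasFDerivAt.comp (g := Φ) y (smooth_differentiableAt (hΦ.smooth _ (hU hy))).hasFDerivAt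
      (smooth_differentiableAt (hc.smooth y hy)).hasFDerivAt
  have h2 : HasFDerivAt (fun z => F (ψ z)) ((fderiv ℝ F (ψ y)).comp (fderiv ℝ ψ y)) y :=
    HasFDerivAt.comp (g := F) y (smooth_differentiableAt (h.smooth _ (hc.maps hy))).hasFDerivAt
      (smooth_differentiableAt (hc.smooth_ψ y hy)).hasFDerivAt
  have h3 := h2.congr_of_eventuallyEq (f₁ := fun z => Φ (F' z))
    (by filter_upwards [hc.isOpen.mem_nhds hy] with z hz using hc.comm z hz)
  exact congrArg (fun L => L u) (h1.unique h3)

lemma map_pullNormal (hΦ : IsLocalIsometry G' U' G U Φ) (hU : MapsTo F' V' U') (hy : y ∈ V') :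
    fderiv ℝ Φ (F' y) (pullNormal Φ F' N ψ y) = N (ψ y) :=
  (hΦ.isInvertible (hU hy)).self_apply_inverse _

lemma HypData.pullback (h : HypData G U F V N) (hc : IsChartChange F' V' F V ψ Φ)
    (hΦ : IsLocalIsometry G' U' G U Φ) (hU : MapsTo F' V' U') :
    HypData G' U' F' V' (pullNormal Φ F' N ψ) where
  riem := hΦ.source
  isOpen := hc.isOpen
  maps := hU
  smooth := hc.smooth
  inj := hc.inj
  smoothN y hy := by
    have h1 : ContDiffAt ℝ ∞ (fun z => fderiv ℝ Φ (F' z)) y :=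
      ContDiffAt.comp (g := fderiv ℝ Φ) y (smooth_fderiv (hΦ.smooth _ (hU hy))) (hc.smooth y hy)
    have h2 : ContDiffAt ℝ ∞ (fun z => (fderiv ℝ Φ (F' z)).inverse) y :=
      ContDiffAt.comp (g := ContinuousLinearMap.inverse) y
        (hΦ.isInvertible (hU hy)).contDiffAt_map_inverse h1
    exact h2.clm_apply ((h.smoothN _ (hc.maps hy)).comp y (hc.smooth_ψ y hy))
  unit y hy := by
    refine ⟨?_, fun u => ?_⟩
    · rw [hΦ.metric _ (hU hy), map_pullNormal hΦ hU hy, hc.comm y hy]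
      exact (h.unit _ (hc.maps hy)).1
    · rw [hΦ.metric _ (hU hy), map_pullNormal hΦ hU hy, hc.comm y hy,
        hc.fderiv_comm h hΦ hU hy]
      exact (h.unit _ (hc.maps hy)).2 _

lemma HypData.isLocalIsometry_induced (h : HypData G U F V N) (hc : IsChartChange F' V' F V ψ Φ)
    (hΦ : IsLocalIsometry G' U' G U Φ) (hU : MapsTo F' V' U') :
    IsLocalIsometry (inducedMetric G' F') V' (inducedMetric G F) V ψ where
  source := (h.pullback hc hΦ hU).isRiem
  target := h.isRiem
  maps := hc.maps
  smooth := hc.smooth_ψ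
  metric y hy u v := by
    rw [inducedMetric_apply, inducedMetric_apply, hΦ.metric _ (hU hy), hc.comm y hy,
      hc.fderiv_comm h hΦ hU hy, hc.fderiv_comm h hΦ hU hy]

/-- The map `Φ` intertwines covariant derivatives. Replacing `Φ ∘ F'` by `F ∘ ψ` adds the term
`dF(D²ψ)`, which is tangent and hence invisible to `N`. -/
lemma HypData.sff_pullback (h : HypData G U F V N) (hc : IsChartChange F' V' F V ψ Φ)
    (hΦ : IsLocalIsometry G' U' G U Φ) (hU : MapsTo F' V' U') (hy : y ∈ V') (u v : Euc n) :
    sff G' F' (pullNormal Φ F' N ψ) y u v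
      = sff G F N (ψ y) (fderiv ℝ ψ y u) (fderiv ℝ ψ y v) := by
  have hψy := hc.maps hy
  have hFs := h.smooth _ hψy
  rw [sff, hΦ.metric _ (hU hy), map_pullNormal hΦ hU hy, ← hΦ.map_covDeriv (hU hy)
    (smooth_differentiableAt (hc.smooth y hy))
    (smooth_differentiableAt (smooth_fderiv_apply (hc.smooth y hy) v)), h.sff_eq hψy]
  have e1 : (fun z => Φ (F' z)) =ᶠ[𝓝 y] fun z => F (ψ z) := by
    filter_upwards [hc.isOpen.mem_nhds hy] with z hz using hc.comm z hz
  have e2 : (fun z => fderiv ℝ Φ (F' z) (fderiv ℝ F' z v))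
      =ᶠ[𝓝 y] fun z => fderiv ℝ F (ψ z) (fderiv ℝ ψ z v) := by
    filter_upwards [hc.isOpen.mem_nhds hy] with z hz using hc.fderiv_comm h hΦ hU hz v
  have hd : HasFDerivAt (fun z => fderiv ℝ F (ψ z))
      ((fderiv ℝ (fderiv ℝ F) (ψ y)).comp (fderiv ℝ ψ y)) y :=
    HasFDerivAt.comp (g := fderiv ℝ F) y
      (smooth_differentiableAt (smooth_fderiv hFs)).hasFDerivAt
      (smooth_differentiableAt (hc.smooth_ψ y hy)).hasFDerivAt
  have hd2 := (hd.clm_apply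
    (smooth_differentiableAt (smooth_fderiv_apply (hc.smooth_ψ y hy) v)).hasFDerivAt).fderiv
  have hd3 : HasFDerivAt (fun z => F (ψ z)) ((fderiv ℝ F (ψ y)).comp (fderiv ℝ ψ y)) y :=
    HasFDerivAt.comp (g := F) y (smooth_differentiableAt hFs).hasFDerivAt
      (smooth_differentiableAt (hc.smooth_ψ y hy)).hasFDerivAt
  rw [covDeriv_congr e2, covDeriv, e1.fderiv_eq, e1.eq_of_nhds, hd2, hd3.fderiv, chris_apply]
  simp only [map_add, add_apply, ContinuousLinearMap.comp_apply,
    ContinuousLinearMap.flip_apply, (h.unit _ hψy).2, zero_add]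

lemma HypData.pot_pullback (h : HypData G U F V N) (hc : IsChartChange F' V' F V ψ Φ)
    (hΦ : IsLocalIsometry G' U' G U Φ) (hU : MapsTo F' V' U') (hy : y ∈ V') :
    pot G' F' (pullNormal Φ F' N ψ) y = pot G F N (ψ y) := by
  have hψy := hc.maps hy
  have hi := h.isLocalIsometry_induced hc hΦ hU
  unfold pot
  rw [← hΦ.map_ricci (hU hy), map_pullNormal hΦ hU hy, hc.comm y hy]
  congr 1
  obtain ⟨A, hA⟩ := hi.exists_equiv hy
  simp only [h.sff_pullback hc hΦ hU hy, ← hA]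
  let S : Euc n →ₗ[ℝ] Euc n →ₗ[ℝ] ℝ := LinearMap.mk₂ ℝ (sff G F N (ψ y))
    (fun a b c => by simp only [h.sff_eq hψy, map_add, add_apply]; ring)
    (fun c a b => by
      simp only [h.sff_eq hψy, map_smul, map_add, smul_apply, smul_eq_mul]; ring)
    (fun a b c => by simp only [h.sff_eq hψy, map_add]; ring)
    (fun c a b => by simp only [h.sff_eq hψy, map_smul, map_add, smul_eq_mul]; ring)
  have hm : ∀ v w, inducedMetric G' F' y v w = inducedMetric G F (ψ y) (A v) (A w) :=
    fun v w => by rw [hA, hA]; exact hi.metric y hy v w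
  -- The double sum in `pot` is by definition an iterated metric trace.
  exact traceWith_traceWith_comp (hi.target.symm _ hψy) (hi.target.pos _ hψy) A hm S

/-- The Jacobi operator in another chart. -/
lemma HypData.jacobiInChart_pullback (h : HypData G U F V N)
    (hc : IsChartChange F' V' F V ψ Φ) (hΦ : IsLocalIsometry G' U' G U Φ) (hU : MapsTo F' V' U')
    (hy : y ∈ V') {X' : Euc n → Euc (n + 1)} {f : Euc n → ℝ}
    (hX : ∀ z ∈ V', fderiv ℝ Φ (F' z) (X' z) = f (ψ z) • N (ψ z))
    (hf : ∀ z ∈ V, ContDiffAt ℝ ∞ f z) :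
    fderiv ℝ Φ (F' y) (jacobiInChart G' F' X' y)
      = (lap (inducedMetric G F) f (ψ y) + pot G F N (ψ y) * f (ψ y)) • N (ψ y) := by
  have h' := h.pullback hc hΦ hU
  have hX' : ∀ z ∈ V', X' z = f (ψ z) • pullNormal Φ F' N ψ z := fun z hz => by
    apply hΦ.injective (hU hz)
    rw [hX z hz, map_smul, map_pullNormal hΦ hU hz]
  rw [h'.jacobiInChart_eq hy hX' fun z hz => (hf _ (hc.maps hz)).comp z (hc.smooth_ψ z hz),
    map_smul, map_pullNormal hΦ hU hy, h.pot_pullback hc hΦ hU hy,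
    (h.isLocalIsometry_induced hc hΦ hU).lap_comp hy (hf _ (hc.maps hy))]

end ChangeOfCharts

end MinimalHypersurface

end

/-! ### Conformal changes of the metric -/

noncomputable section

namespace MinimalHypersurface

set_option synthInstance.maxHeartbeats 200000

section Conformal

variable {m n : ℕ}

lemma sum_apply_stdVec_mul (ν : Euc m →L[ℝ] ℝ) (w : Euc m) : ∑ a, ν (stdVec a) * w a = ν w := by
  conv_rhs => rw [← (EuclideanSpace.basisFun (Fin m) ℝ).sum_repr w]
  rw [map_sum]
  refine Finset.sum_congr rfl fun a _ => ?_
  simp [stdVec, mul_comm]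

/-- `G'` is the conformal metric `exp (2 f) G`. -/
structure IsConformal (G' G : BilinField m) (U : Set (Euc m)) (f : Euc m → ℝ) : Prop where
  riem : IsRiem G U
  smooth : ∀ y ∈ U, ContDiffAt ℝ ∞ f y
  metric : ∀ y ∈ U, ∀ v w, G' y v w = Real.exp (2 * f y) * G y v w

namespace IsConformal

variable {G' G : BilinField m} {U : Set (Euc m)} {f : Euc m → ℝ} {y : Euc m}

lemma eqOn (h : IsConformal G' G U f) (hy : y ∈ U) : G' y = Real.exp (2 * f y) • G y := by
  ext v w; simp [h.metric y hy]

lemma eventuallyEq (h : IsConformal G' G U f) (hy : y ∈ U) :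
    G' =ᶠ[𝓝 y] fun z => Real.exp (2 * f z) • G z := by
  filter_upwards [h.riem.mem_nhds hy] with z hz using h.eqOn hz

lemma isRiem (h : IsConformal G' G U f) : IsRiem G' U where
  isOpen := h.riem.isOpen
  smooth y hy := by
    refine ContDiffAt.congr_of_eventuallyEq ?_ (h.eventuallyEq hy)
    exact (Real.contDiff_exp.contDiffAt.comp y (contDiffAt_const.mul (h.smooth y hy))).smul
      (h.riem.smooth y hy)
  symm y hy v w := by rw [h.metric y hy, h.metric y hy, h.riem.symm y hy]
  pos y hy v hv := by
    rw [h.metric y hy]; exact mul_pos (Real.exp_pos _) (h.riem.pos y hy v hv)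

lemma fderiv_apply (h : IsConformal G' G U f) (hy : y ∈ U) (u v w : Euc m) :
    fderiv ℝ G' y u v w = Real.exp (2 * f y) * (fderiv ℝ G y u v w
      + 2 * fderiv ℝ f y u * G y v w) := by
  have h1 : HasFDerivAt (fun z => Real.exp (2 * f z))
      (Real.exp (2 * f y) • ((2 : ℝ) • fderiv ℝ f y)) y :=
    ((smooth_differentiableAt (h.smooth y hy)).hasFDerivAt.const_mul 2).exp
  have h2 := h1.fun_smul (h.riem.differentiableAt hy).hasFDerivAt
  rw [(h.eventuallyEq hy).fderiv_eq, h2.fderiv]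
  simp
  ring

/-- Both sides are paired with `w` in `G'`, where Koszul's formulas for `G` and `G'` can be
compared. -/
lemma christoffel_eq (h : IsConformal G' G U f) (hy : y ∈ U) (u v : Euc m) :
    christoffel G' y u v = christoffel G y u v + fderiv ℝ f y u • v + fderiv ℝ f y v • u
      - G y u v • (G y).inverse (fderiv ℝ f y) := by
  refine h.isRiem.ext_of_inner hy fun w => ?_
  have h1 := h.isRiem.christoffel_inner hy u v w
  have h2 := h.riem.christoffel_inner hy u v w
  have h3 := h.riem.inverse_apply hy (fderiv ℝ f y) w
  simp only [h.fderiv_apply hy] at h1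
  rw [h.metric y hy _ w] at h1 ⊢
  rw [h.metric y hy _ w]
  simp only [map_add, map_sub, map_smul, add_apply, sub_apply, smul_apply, smul_eq_mul, h3]
  have h4 := h.riem.symm y hy v u
  linear_combination h1 / 2 - Real.exp (2 * f y) / 2 * h2

/-- At a critical point of `f` every term with an undifferentiated `df` vanishes, so the correction
involves only the Hessian. -/
lemma fderiv_christoffel_eq (h : IsConformal G' G U f) (hy : y ∈ U) (hf : fderiv ℝ f y = 0)
    (a u v : Euc m) :
    fderiv ℝ (chris G') y a u v = fderiv ℝ (chris G) y a u v + fderiv ℝ (fderiv ℝ f) y a u • v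
      + fderiv ℝ (fderiv ℝ f) y a v • u - G y u v • (G y).inverse (fderiv ℝ (fderiv ℝ f) y a) := by
  have e1 := congrArg (fun L => L a) (h.isRiem.fderiv_christoffel hy u v)
  have e2 := congrArg (fun L => L a) (h.riem.fderiv_christoffel hy u v)
  simp only [ContinuousLinearMap.flip_apply] at e1 e2
  rw [← e1, ← e2]
  have hev : (fun z => christoffel G' z u v) =ᶠ[𝓝 y] fun z => christoffel G z u v
      + fderiv ℝ f z u • v + fderiv ℝ f z v • u - G z u v • (G z).inverse (fderiv ℝ f z) := by
    filter_upwards [h.riem.mem_nhds hy] with z hz using h.christoffel_eq hz u v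
  have hc : DifferentiableAt ℝ (fun z => christoffel G z u v) y := by
    simp only [← chris_apply]
    exact smooth_differentiableAt
      (((h.riem.chris_smooth hy).clm_apply contDiffAt_const).clm_apply contDiffAt_const)
  have hdf : HasFDerivAt (fderiv ℝ f) (fderiv ℝ (fderiv ℝ f) y) y :=
    (smooth_differentiableAt (smooth_fderiv (h.smooth y hy))).hasFDerivAt
  have hfu : ∀ u v : Euc m, HasFDerivAt (fun z => fderiv ℝ f z u • v)
      (((fderiv ℝ (fderiv ℝ f) y).flip u).smulRight v) y := by
    intro u v
    have := (hdf.clm_apply (hasFDerivAt_const u y)).smul_const v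
    refine this.congr_fderiv ?_
    ext1 a; simp
  have hG : DifferentiableAt ℝ (fun z => G z u v) y := smooth_differentiableAt
    (((h.riem.smooth y hy).clm_apply contDiffAt_const).clm_apply contDiffAt_const)
  have hi := (smooth_differentiableAt (h.riem.inverse_smooth hy)).hasFDerivAt.clm_apply hdf
  have hlast := hG.hasFDerivAt.smul hi
  have htot := ((hc.hasFDerivAt.add (hfu u v)).add (hfu v u)).sub hlast
  rw [hev.fderiv_eq]
  refine (congrArg (fun L => L a) htot.fderiv).trans ?_
  simp [hf]

end IsConformal

variable {G' G : BilinField (n + 1)} {U : Set (Euc (n + 1))} {f : Euc (n + 1) → ℝ}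
  {F N : Euc n → Euc (n + 1)} {V : Set (Euc n)} {x : Euc n}

/-- A conformal change of the metric whose factor is trivial to first order along `F`. -/
structure IsFlatConformal (G' G : BilinField (n + 1)) (U : Set (Euc (n + 1)))
    (f : Euc (n + 1) → ℝ) (F : Euc n → Euc (n + 1)) (V : Set (Euc n)) : Prop
    extends IsConformal G' G U f where
  zero : ∀ y ∈ V, f (F y) = 0
  fderiv_zero : ∀ y ∈ V, fderiv ℝ f (F y) = 0

namespace IsFlatConformal

lemma eq_metric (h : IsFlatConformal G' G U f F V) (hx : x ∈ V) (hU : F x ∈ U) :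
    G' (F x) = G (F x) := by
  rw [h.eqOn hU, h.zero x hx]; simp

lemma hypData (h : IsFlatConformal G' G U f F V) (hF : HypData G U F V N) :
    HypData G' U F V N where
  riem := h.isRiem
  isOpen := hF.isOpen
  maps := hF.maps
  smooth := hF.smooth
  inj := hF.inj
  smoothN := hF.smoothN
  unit y hy := by
    unfold IsUnitNormal
    rw [h.eq_metric hy (hF.maps hy)]
    exact hF.unit y hy

/-- This equality, with that of the metrics, shows that along `F` everything of first order in the
metric agrees; in the Jacobi operator only the Ricci term sees the conformal factor. -/
lemma chris_eq (h : IsFlatConformal G' G U f F V) (hx : x ∈ V) (hU : F x ∈ U) (u v) :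
    christoffel G' (F x) u v = christoffel G (F x) u v := by
  rw [h.christoffel_eq hU, h.fderiv_zero x hx]; simp

lemma inducedMetric_eq (h : IsFlatConformal G' G U f F V) (hx : x ∈ V) (hU : F x ∈ U) :
    inducedMetric G' F x = inducedMetric G F x := by
  unfold inducedMetric; rw [h.eq_metric hx hU]

lemma normalDeriv_eq (h : IsFlatConformal G' G U f F V) (hx : x ∈ V) (hU : F x ∈ U)
    (X : Euc n → Euc (n + 1)) (u : Euc n) :
    normalDeriv G' F X x u = normalDeriv G F X x u := by
  unfold normalDeriv covDeriv normalPart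
  rw [h.chris_eq hx hU, h.inducedMetric_eq hx hU, h.eq_metric hx hU]

lemma secondForm_eq (h : IsFlatConformal G' G U f F V) (hx : x ∈ V) (hU : F x ∈ U)
    (u v : Euc n) : secondForm G' F x u v = secondForm G F x u v := h.normalDeriv_eq hx hU _ _

lemma meanCurvature_eq (h : IsFlatConformal G' G U f F V) (hx : x ∈ V) (hU : F x ∈ U) :
    meanCurvature G' F x = meanCurvature G F x := by
  unfold meanCurvature
  rw [h.inducedMetric_eq hx hU]
  congr 1
  funext u v
  exact h.secondForm_eq hx hU u v

lemma normSqSecondForm_eq (h : IsFlatConformal G' G U f F V) (hx : x ∈ V) (hU : F x ∈ U) :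
    normSqSecondForm G' F x = normSqSecondForm G F x := by
  unfold normSqSecondForm
  simp only [h.inducedMetric_eq hx hU, h.secondForm_eq hx hU, h.eq_metric hx hU]

/-- The outer derivatives are taken along `F` only, so agreement of the normal connections and
induced metrics on the open set `V` is enough. -/
lemma normalLaplacian_eq (h : IsFlatConformal G' G U f F V) (hV : IsOpen V) (hU : MapsTo F V U)
    (hx : x ∈ V) (X : Euc n → Euc (n + 1)) :
    normalLaplacian G' F X x = normalLaplacian G F X x := by
  have hi : inducedMetric G' F =ᶠ[𝓝 x] inducedMetric G F := by
    filter_upwards [hV.mem_nhds hx] with y hy using h.inducedMetric_eq hy (hU hy)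
  unfold normalLaplacian
  rw [h.inducedMetric_eq hx (hU hx)]
  congr 1
  funext u v
  have e : (fun y => normalDeriv G' F X y v) =ᶠ[𝓝 x] fun y => normalDeriv G F X y v := by
    filter_upwards [hV.mem_nhds hx] with y hy using h.normalDeriv_eq hy (hU hy) X v
  have e2 : christoffel (inducedMetric G' F) x u v = christoffel (inducedMetric G F) x u v := by
    unfold christoffel; rw [hi.fderiv_eq, hi.eq_of_nhds]
  rw [normalDeriv_congr e, e2, h.normalDeriv_eq hx (hU hx), h.normalDeriv_eq hx (hU hx)]

/-- With `ν = G(N, ·)`, a Hessian `c ν ⊗ ν` changes the endomorphism `u ↦ R(u, N)N` by `c ν(u) N - c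
u`, whose trace is `c - (n + 1) c`. -/
lemma ricci_eq (h : IsFlatConformal G' G U f F V) (hF : HypData G U F V N) (hx : x ∈ V) {c : ℝ}
    (hH : ∀ u v, fderiv ℝ (fderiv ℝ f) (F x) u v = c * G (F x) (N x) u * G (F x) (N x) v) :
    ricci G' (F x) (N x) (N x) = ricci G (F x) (N x) (N x) - n * c := by
  have hU := hF.maps hx
  have hN := (hF.unit x hx).1
  have hc : ∀ u v, chris G' (F x) u v = chris G (F x) u v := fun u v => by
    rw [chris_apply, chris_apply, h.chris_eq hx hU]
  have hi : ∀ u, (G (F x)).inverse (fderiv ℝ (fderiv ℝ f) (F x) u)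
      = (c * G (F x) (N x) u) • N x := by
    intro u
    have : fderiv ℝ (fderiv ℝ f) (F x) u = (c * G (F x) (N x) u) • G (F x) (N x) := by
      ext v; simp [hH]
    rw [this, map_smul, hF.riem.inverse_self hU]
  have hcurv : ∀ u, curvature G' (F x) u (N x) (N x) = curvature G (F x) u (N x) (N x)
      + ((c * G (F x) (N x) u) • N x - c • u) := by
    intro u
    rw [h.isRiem.curvature_eq hU, hF.riem.curvature_eq hU,
      h.fderiv_christoffel_eq hU (h.fderiv_zero x hx),
      h.fderiv_christoffel_eq hU (h.fderiv_zero x hx)]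
    simp only [hc, hi, hH, hN, hF.riem.symm _ hU u (N x)]
    module
  unfold ricci
  simp only [hcurv]
  have h1 := sum_apply_stdVec_mul (G (F x) (N x)) (N x)
  rw [hN] at h1
  simp only [PiLp.add_apply, PiLp.sub_apply, PiLp.smul_apply, smul_eq_mul, Finset.sum_add_distrib,
    Finset.sum_sub_distrib, mul_assoc, ← Finset.mul_sum, h1]
  have h2 : ∑ i : Fin (n + 1), (stdVec i : Euc (n + 1)) i = n + 1 := by
    simp [stdVec]
  rw [h2]
  ring

/-- The Jacobi operator under a conformal change with Hessian `c ν ⊗ ν` of the factor. -/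
lemma jacobiInChart_eq (h : IsFlatConformal G' G U f F V) (hF : HypData G U F V N) (hx : x ∈ V)
    {c : ℝ}
    (hH : ∀ u v, fderiv ℝ (fderiv ℝ f) (F x) u v = c * G (F x) (N x) u * G (F x) (N x) v)
    (X : Euc n → Euc (n + 1)) :
    jacobiInChart G' F X x = jacobiInChart G F X x - (n * c) • X x := by
  unfold jacobiInChart
  rw [h.normalLaplacian_eq hF.isOpen hF.maps hx, h.normSqSecondForm_eq hx (hF.maps hx),
    (h.hypData hF).ricci_unitNormal hx, hF.ricci_unitNormal hx, h.ricci_eq hF hx hH]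
  module

end IsFlatConformal

end Conformal

end MinimalHypersurface

end

/-! ### Composition operators on continuous functions, and the implicit function theorem -/

noncomputable section

namespace MinimalHypersurface

section Nemytskii

universe u

variable {K : Type*} [TopologicalSpace K] [CompactSpace K]
  {E F : Type u} [NormedAddCommGroup E] [NormedSpace ℝ E] [NormedAddCommGroup F] [NormedSpace ℝ F]

/-- Pointwise application as a continuous bilinear map on spaces of continuous functions. -/
def pointwiseApply (K : Type*) [TopologicalSpace K] [CompactSpace K] (E F : Type u)
    [NormedAddCommGroup E] [NormedSpace ℝ E] [NormedAddCommGroup F] [NormedSpace ℝ F] :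
    C(K, E →L[ℝ] F) →L[ℝ] C(K, E) →L[ℝ] C(K, F) :=
  LinearMap.mkContinuous₂
    (LinearMap.mk₂ ℝ (fun (A : C(K, E →L[ℝ] F)) (h : C(K, E)) =>
        (⟨fun s => A s (h s), A.continuous.clm_apply h.continuous⟩ : C(K, F)))
      (fun _ _ _ => by ext; simp) (fun _ _ _ => by ext; simp) (fun _ _ _ => by ext; simp)
      (fun _ _ _ => by ext; simp)) 1 (fun A h => by
      rw [one_mul, ContinuousMap.norm_le _ (by positivity)]
      intro s
      exact ((A s).le_opNorm (h s)).trans (by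
        gcongr
        · exact A.norm_coe_le_norm s
        · exact h.norm_coe_le_norm s))

/-- Composition with a continuous map. -/
def nemytskii (K : Type*) [TopologicalSpace K] {f : E → F} (hf : Continuous f) (u : C(K, E)) :
    C(K, F) := ⟨fun s => f (u s), hf.comp u.continuous⟩

/-- The range of `u` is compact, so `fderiv f` is uniformly continuous near it; the mean value
inequality then bounds the remainder by `ε ‖h‖` simultaneously at all points of `K`. -/
lemma hasFDerivAt_nemytskii {f : E → F} (hf : ContDiff ℝ 1 f) (u : C(K, E)) :
    HasFDerivAt (nemytskii K hf.continuous)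
      (pointwiseApply K E F (nemytskii K (hf.continuous_fderiv (by simp)) u)) u := by
  rw [hasFDerivAt_iff_isLittleO_nhds_zero, Asymptotics.isLittleO_iff]
  intro ε hε
  have hc : IsCompact (range u) := isCompact_range u.continuous
  have hU := hc.uniformContinuousAt_of_continuousAt (fderiv ℝ f)
    (fun a _ => (hf.continuous_fderiv (by simp)).continuousAt) (Metric.dist_mem_uniformity hε)
  obtain ⟨δ, hδ, hball⟩ := Metric.mem_uniformity_dist.1 hU
  filter_upwards [Metric.ball_mem_nhds (0 : C(K, E)) hδ] with h hh
  rw [mem_ball_zero_iff] at hh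
  rw [ContinuousMap.norm_le _ (by positivity)]
  intro s
  have hs : ‖h s‖ ≤ ‖h‖ := h.norm_coe_le_norm s
  have key : ‖f (u s + h s) - f (u s) - fderiv ℝ f (u s) (u s + h s - u s)‖
      ≤ ε * ‖u s + h s - u s‖ := by
    refine Convex.norm_image_sub_le_of_norm_hasFDerivWithin_le' (s := Metric.ball (u s) δ)
      (fun z _ => (hf.differentiable (by simp) z).hasFDerivAt.hasFDerivWithinAt) ?_
      (convex_ball _ _) (Metric.mem_ball_self hδ) ?_
    · intro z hz
      have h1 : (u s, z) ∈ {x : E × E | x.1 ∈ range u →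
          (fderiv ℝ f x.1, fderiv ℝ f x.2) ∈ {p | dist p.1 p.2 < ε}} :=
        hball (by rwa [dist_comm])
      have h2 : dist (fderiv ℝ f (u s)) (fderiv ℝ f z) < ε := h1 ⟨s, rfl⟩
      rw [dist_comm, dist_eq_norm] at h2
      exact h2.le
    · simpa using hs.trans_lt hh
  simp only [add_sub_cancel_left] at key
  exact key.trans (by gcongr)

/-- Induction on the order: the derivative is the composition operator of `fderiv f` followed by a
continuous linear map. The target space varies in the induction, since `fderiv f` takes values in
linear maps. -/
lemma contDiff_nemytskii_nat (k : ℕ) : ∀ {F : Type u} [NormedAddCommGroup F] [NormedSpace ℝ F]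
    {f : E → F} (hf : ContDiff ℝ ∞ f), ContDiff ℝ k (nemytskii K hf.continuous) := by
  induction k with
  | zero =>
    intro F _ _ f hf
    have h1 : ContDiff ℝ 1 f := hf.of_le (by simp)
    exact contDiff_zero.2 (continuous_iff_continuousAt.2
      fun u => (hasFDerivAt_nemytskii h1 u).continuousAt)
  | succ k ih =>
    intro F _ _ f hf
    have h1 : ContDiff ℝ 1 f := hf.of_le (by simp)
    have h2 : ContDiff ℝ ∞ (fderiv ℝ f) := hf.fderiv_right (by simp)
    exact contDiff_succ_iff_hasFDerivAt.2
      ⟨_, (pointwiseApply K E F).contDiff.comp (ih h2), hasFDerivAt_nemytskii h1⟩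

lemma contDiff_nemytskii {f : E → F} (hf : ContDiff ℝ ∞ f) :
    ContDiff ℝ ∞ (nemytskii K hf.continuous) :=
  contDiff_infty.2 fun k => contDiff_nemytskii_nat k hf

end Nemytskii

section ImplicitFunction

variable {E₁ E₂ F : Type*} [NormedAddCommGroup E₁] [NormedSpace ℝ E₁] [CompleteSpace E₁]
  [NormedAddCommGroup E₂] [NormedSpace ℝ E₂] [CompleteSpace E₂]
  [NormedAddCommGroup F] [NormedSpace ℝ F] [CompleteSpace F]

/-- The implicit function of a smooth equation is smooth on a neighbourhood of the base point. -/
lemma exists_smooth_implicitFunction {P : E₁ × E₂ → F} (hP : ContDiff ℝ ∞ P) {p : E₁ × E₂}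
    (hp : P p = 0) (hi : (fderiv ℝ P p ∘L .inr ℝ E₁ E₂).IsInvertible) :
    ∃ ψ : E₁ → E₂, ψ p.1 = p.2 ∧ (∀ᶠ x in 𝓝 p.1, ContDiffAt ℝ ∞ ψ x ∧ P (x, ψ x) = 0) ∧
      ∀ᶠ v in 𝓝 p, P v = 0 → ψ v.1 = v.2 := by
  have hn : (∞ : WithTop ℕ∞) ≠ 0 := by simp
  refine ⟨hP.contDiffAt.implicitFunction hn hi, ?_, ?_, ?_⟩
  · exact ContDiffAt.implicitFunction_apply_self _ _ _
  swap
  · filter_upwards [ContDiffAt.eventually_apply_eq_iff_implicitFunction hP.contDiffAt hn hi]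
      with v hv h0
    exact hv.1 (h0.trans hp.symm)
  set ψ := hP.contDiffAt.implicitFunction hn hi with hψ
  have h0 : ψ p.1 = p.2 := ContDiffAt.implicitFunction_apply_self _ _ _
  have h1 : ContDiffAt ℝ ∞ ψ p.1 := ContDiffAt.contDiffAt_implicitFunction _ _ _
  have h2 : ∀ᶠ x in 𝓝 p.1, P (x, ψ x) = 0 := by
    filter_upwards [ContDiffAt.eventually_apply_implicitFunction hP.contDiffAt hn hi] with x hx
    exact hx.trans hp
  have h3 : ∀ᶠ x in 𝓝 p.1, ContinuousAt ψ x := by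
    filter_upwards [(h1.of_le (m := 1) (by simp)).eventually (by simp)] with x hx
    exact hx.continuousAt
  have h4 : ∀ᶠ x in 𝓝 p.1, (fderiv ℝ P (x, ψ x) ∘L .inr ℝ E₁ E₂).IsInvertible := by
    have hc : ContinuousAt (fun x => fderiv ℝ P (x, ψ x) ∘L .inr ℝ E₁ E₂) p.1 := by
      have h5 : Continuous (fun q => fderiv ℝ P q ∘L .inr ℝ E₁ E₂) :=
        (hP.continuous_fderiv (by simp)).clm_comp continuous_const
      exact ContinuousAt.comp (g := fun q => fderiv ℝ P q ∘L .inr ℝ E₁ E₂) h5.continuousAt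
        (continuousAt_id.prodMk h1.continuousAt)
    obtain ⟨e, he⟩ := hi
    have h6 : range ((↑) : (E₂ ≃L[ℝ] F) → E₂ →L[ℝ] F) ∈
        𝓝 (fderiv ℝ P (p.1, ψ p.1) ∘L .inr ℝ E₁ E₂) := by
      rw [h0, ← he]; exact ContinuousLinearEquiv.nhds e
    exact hc h6
  filter_upwards [h2, h4, h2.eventually_nhds, h3] with x hx2 hx4 hx2' hx3
  refine ⟨?_, hx2⟩
  -- Smoothness at the base point gives no common neighbourhood for all orders. So the theorem is
  -- applied again at `(x, ψ x)`, and local uniqueness identifies the new implicit function with `ψ`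
  -- near `x`.
  have h7 := ContDiffAt.contDiffAt_implicitFunction (hP.contDiffAt (x := (x, ψ x))) hn hx4
  refine h7.congr_of_eventuallyEq ?_
  have h8 := ContDiffAt.eventually_apply_eq_iff_implicitFunction
    (hP.contDiffAt (x := (x, ψ x))) hn hx4
  have h9 : ContinuousAt (fun y => (y, ψ y)) x := continuousAt_id.prodMk hx3
  filter_upwards [h9.eventually h8, hx2'] with y hy hy2
  exact (hy.1 (hy2.trans hx2.symm)).symm

end ImplicitFunction

/-! ### Smooth local flows -/

section Flow

universe u

variable {E : Type u} [NormedAddCommGroup E] [NormedSpace ℝ E] [CompleteSpace E]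

/-- The interval of rescaled times. -/
abbrev TimeInterval : Type := Icc (-1 : ℝ) 1

/-- The primitive, vanishing at `0`, of a continuous function on `[-1, 1]`. -/
def primitive (E : Type u) [NormedAddCommGroup E] [NormedSpace ℝ E] [CompleteSpace E] :
    C(TimeInterval, E) →L[ℝ] C(TimeInterval, E) :=
  LinearMap.mkContinuous
    { toFun := fun w => ⟨fun s => ∫ r in (0 : ℝ)..s, IccExtend (by norm_num) w r,
        (intervalIntegral.continuous_primitive
          (fun a b => (w.continuous.Icc_extend').intervalIntegrable a b) 0).comp
          continuous_subtype_val⟩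
      map_add' := fun v w => by
        ext s
        exact intervalIntegral.integral_add
          ((v.continuous.Icc_extend').intervalIntegrable _ _)
          ((w.continuous.Icc_extend').intervalIntegrable _ _)
      map_smul' := fun c w => by
        ext s
        exact intervalIntegral.integral_smul c _ }
    1 (fun w => by
      rw [one_mul, ContinuousMap.norm_le _ (norm_nonneg _)]
      intro s
      have h1 := intervalIntegral.norm_integral_le_of_norm_le_const (a := (0 : ℝ)) (b := s)
        (f := IccExtend (by norm_num : (-1 : ℝ) ≤ 1) w) (C := ‖w‖)
        (fun r _ => w.norm_coe_le_norm _)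
      refine h1.trans ?_
      have h2 : |(s : ℝ) - 0| ≤ 1 := by rw [sub_zero]; exact abs_le.2 s.2
      exact mul_le_of_le_one_right (norm_nonneg _) h2)

lemma primitive_apply (w : C(TimeInterval, E)) (s : TimeInterval) :
    primitive E w s = ∫ r in (0 : ℝ)..s, IccExtend (by norm_num : (-1 : ℝ) ≤ 1) w r := rfl

lemma primitive_comp_mul (w : C(TimeInterval, E)) {σ : ℝ} (hσ : |σ| ≤ 1) {w' : C(TimeInterval, E)}
    (hw : ∀ (s : TimeInterval) (h : σ * s ∈ Icc (-1 : ℝ) 1), w' s = w ⟨σ * s, h⟩)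
    (s : TimeInterval) (h : σ * s ∈ Icc (-1 : ℝ) 1) :
    σ • primitive E w' s = primitive E w ⟨σ * s, h⟩ := by
  rw [primitive_apply, primitive_apply]
  have h1 := intervalIntegral.smul_integral_comp_mul_left (a := 0) (b := (s : ℝ))
    (IccExtend (by norm_num : (-1 : ℝ) ≤ 1) w) σ
  rw [mul_zero] at h1
  rw [← h1]
  congr 1
  refine intervalIntegral.integral_congr fun r hr => ?_
  have hs := s.2
  have hr1 : r ∈ Icc (-1 : ℝ) 1 := by
    rw [uIcc, mem_Icc] at hr
    exact ⟨le_trans (le_min (by norm_num) hs.1) hr.1, hr.2.trans (max_le (by norm_num) hs.2)⟩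
  have hr2 : σ * r ∈ Icc (-1 : ℝ) 1 := by
    refine abs_le.1 ?_
    rw [abs_mul]
    exact mul_le_one₀ hσ (abs_nonneg _) (abs_le.2 hr1)
  rw [IccExtend_of_mem _ _ hr1, IccExtend_of_mem _ _ hr2]
  exact hw ⟨r, hr1⟩ hr2

/-- Smooth local flow of a smooth vector field. -/
theorem exists_smooth_flow {f : E → E} (hf : ContDiff ℝ ∞ f) (z₀ : E) :
    ∃ (Φ : ℝ × E → E) (τ : ℝ), 0 < τ ∧ (∀ t z, |t| < τ → ‖z - z₀‖ < τ → ContDiffAt ℝ ∞ Φ (t, z)) ∧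
      (∀ z, ‖z - z₀‖ < τ → Φ (0, z) = z) ∧
      ∀ t z, |t| < τ → ‖z - z₀‖ < τ → HasDerivAt (fun s => Φ (s, z)) (f (Φ (t, z))) t := by
  let cst : E →L[ℝ] C(TimeInterval, E) := LinearMap.mkContinuous
    { toFun := fun z => ContinuousMap.const _ z
      map_add' := fun _ _ => rfl
      map_smul' := fun _ _ => rfl } 1 (fun z => by
        rw [one_mul, ContinuousMap.norm_le _ (norm_nonneg _)]
        intro s; exact le_rfl)
  have hcst : ∀ z s, cst z s = z := fun z s => rfl
  -- The unknown is the whole curve in rescaled time, and `P = 0` is the integral equation `u(s) = z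
  -- + t ∫₀ˢ f(u)`. Time enters as a parameter, so one application of the implicit function theorem
  -- gives smoothness in `(t, z)` jointly.
  let P : (ℝ × E) × C(TimeInterval, E) → C(TimeInterval, E) := fun p =>
    p.2 - cst p.1.2 - p.1.1 • primitive E (nemytskii _ hf.continuous p.2)
  have hP : ContDiff ℝ ∞ P := by
    refine (contDiff_snd.sub (cst.contDiff.comp (contDiff_snd.comp contDiff_fst))).sub ?_
    exact (contDiff_fst.comp contDiff_fst).smul
      ((primitive E).contDiff.comp ((contDiff_nemytskii hf).comp contDiff_snd))
  let p₀ : (ℝ × E) × C(TimeInterval, E) := ((0, z₀), cst z₀)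
  have hp₀ : P p₀ = 0 := by simp [P, p₀]
  -- At `t = 0` the integral disappears and the partial derivative in the curve is the identity.
  have hinv : (fderiv ℝ P p₀ ∘L .inr ℝ (ℝ × E) C(TimeInterval, E)).IsInvertible := by
    have h1 : HasFDerivAt (fun u : C(TimeInterval, E) => P ((0, z₀), u))
        (fderiv ℝ P p₀ ∘L .inr ℝ (ℝ × E) C(TimeInterval, E)) (cst z₀) :=
      HasFDerivAt.comp (g := P) (cst z₀) (smooth_differentiableAt hP.contDiffAt).hasFDerivAt
        (hasFDerivAt_prodMk_right _ _)
    have h2 : HasFDerivAt (fun u : C(TimeInterval, E) => P ((0, z₀), u))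
        (ContinuousLinearMap.id ℝ C(TimeInterval, E)) (cst z₀) := by
      have : (fun u : C(TimeInterval, E) => P ((0, z₀), u)) = fun u => u - cst z₀ := by
        funext u; simp [P]
      rw [this]
      exact (hasFDerivAt_id _).sub_const _
    rw [h1.unique h2]
    exact ⟨ContinuousLinearEquiv.refl ℝ _, rfl⟩
  obtain ⟨ψ, hψ0, hψ, huniq⟩ := exists_smooth_implicitFunction hP hp₀ hinv
  obtain ⟨δ, hδ, hδu⟩ := Metric.eventually_nhds_iff.1 huniq
  have hψc : ContinuousAt ψ (0, z₀) := hψ.self_of_nhds.1.continuousAt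
  have hnear : ∀ᶠ x in 𝓝 ((0 : ℝ), z₀), dist (ψ x) (cst z₀) < δ := by
    have := Metric.continuousAt_iff'.1 hψc δ hδ
    rwa [show ψ (0, z₀) = cst z₀ from hψ0] at this
  obtain ⟨τ₀, hτ₀, hbox⟩ := Metric.eventually_nhds_iff.1 (hψ.and hnear)
  have hbox' : ∀ t z, |t| < min τ₀ δ → ‖z - z₀‖ < min τ₀ δ →
      (ContDiffAt ℝ ∞ ψ (t, z) ∧ P ((t, z), ψ (t, z)) = 0) ∧ dist (ψ (t, z)) (cst z₀) < δ := by
    intro t z ht hz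
    refine hbox ?_
    rw [Prod.dist_eq, max_lt_iff, dist_zero_right, dist_eq_norm]
    exact ⟨ht.trans_le (min_le_left _ _), hz.trans_le (min_le_left _ _)⟩
  have hsol : ∀ t z, |t| < min τ₀ δ → ‖z - z₀‖ < min τ₀ δ → ∀ s,
      ψ (t, z) s = z + t • primitive E (nemytskii _ hf.continuous (ψ (t, z))) s := by
    intro t z ht hz s
    have h1 := congrArg (fun w : C(TimeInterval, E) => w s) (hbox' t z ht hz).1.2
    simp only [P, ContinuousMap.sub_apply, ContinuousMap.smul_apply, ContinuousMap.zero_apply,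
      hcst] at h1
    rw [sub_eq_zero, sub_eq_iff_eq_add] at h1
    rw [h1, add_comm]
  have hone : (1 : ℝ) ∈ Icc (-1 : ℝ) 1 := by norm_num
  -- The curve `s ↦ ψ (t, z) (σ s)` solves the equation for the time `σ t` and is no farther from
  -- the constant curve, so uniqueness applies. Thus the values at rescaled time `1` recover the
  -- whole trajectory.
  have hscale : ∀ t z, |t| < min τ₀ δ → ‖z - z₀‖ < min τ₀ δ → ∀ s : TimeInterval,
      ψ (s * t, z) ⟨1, hone⟩ = ψ (t, z) s := by
    intro t z ht hz σ
    have hσ : |(σ : ℝ)| ≤ 1 := abs_le.2 σ.2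
    have hmem : ∀ s : TimeInterval, (σ : ℝ) * s ∈ Icc (-1 : ℝ) 1 := fun s => by
      refine abs_le.1 ?_
      rw [abs_mul]
      exact mul_le_one₀ hσ (abs_nonneg _) (abs_le.2 s.2)
    let w : C(TimeInterval, E) := ⟨fun s => ψ (t, z) ⟨σ * s, hmem s⟩, by fun_prop⟩
    have hσt : |(σ : ℝ) * t| < min τ₀ δ := by
      rw [abs_mul]
      exact lt_of_le_of_lt (mul_le_of_le_one_left (abs_nonneg _) hσ) ht
    have hPw : P ((σ * t, z), w) = 0 := by
      ext s
      have h1 := hsol t z ht hz ⟨σ * s, hmem s⟩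
      have h2 := primitive_comp_mul (nemytskii _ hf.continuous (ψ (t, z))) hσ
        (w' := nemytskii _ hf.continuous w) (fun s h => rfl) s (hmem s)
      simp only [P, ContinuousMap.sub_apply, ContinuousMap.smul_apply, ContinuousMap.zero_apply,
        hcst]
      rw [mul_comm, mul_smul, h2, show w s = ψ (t, z) ⟨σ * s, hmem s⟩ from rfl, h1]
      abel
    have hd : dist w (cst z₀) < δ := by
      refine lt_of_le_of_lt ?_ (hbox' t z ht hz).2
      rw [ContinuousMap.dist_le dist_nonneg]
      intro s
      exact ContinuousMap.dist_apply_le_dist (f := ψ (t, z)) (g := cst z₀) ⟨σ * s, hmem s⟩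
    have h3 := @hδu ((σ * t, z), w) (by
      rw [Prod.dist_eq, max_lt_iff, Prod.dist_eq, max_lt_iff, dist_zero_right, dist_eq_norm z]
      exact ⟨⟨hσt.trans_le (min_le_right _ _), hz.trans_le (min_le_right _ _)⟩, hd⟩) hPw
    rw [show ψ (σ * t, z) = w from h3]
    simp [w]
  refine ⟨fun p => ψ p ⟨1, hone⟩, min τ₀ δ, lt_min hτ₀ hδ, ?_, ?_, ?_⟩
  · intro t z ht hz
    exact (ContinuousMap.evalCLM ℝ (⟨1, hone⟩ : TimeInterval)).contDiff.contDiffAt.comp (t, z)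
      (hbox' t z ht hz).1.1
  · intro z hz
    have := hsol 0 z (by simpa using lt_min hτ₀ hδ) hz ⟨1, hone⟩
    simpa using this
  · intro t z ht hz
    -- With one fixed `t₁ > |t|`, all flow values at times near `t` are read off from a single
    -- curve, and the fundamental theorem of calculus gives the derivative.
    obtain ⟨t₁, ht1, ht2⟩ := exists_between ht
    have ht1pos : 0 < t₁ := (abs_nonneg t).trans_lt ht1
    have ht₁ : |t₁| < min τ₀ δ := by rwa [abs_of_pos ht1pos]
    set w := nemytskii _ hf.continuous (ψ (t₁, z)) with hw
    have hmem : ∀ s, |s| < t₁ → s / t₁ ∈ Icc (-1 : ℝ) 1 := fun s hs => by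
      refine abs_le.1 ?_
      rw [abs_div, abs_of_pos ht1pos, div_le_one ht1pos]
      exact hs.le
    have hval : ∀ s (hs : |s| < t₁), ψ (s, z) ⟨1, hone⟩ = ψ (t₁, z) ⟨s / t₁, hmem s hs⟩ := by
      intro s hs
      rw [← hscale t₁ z ht₁ hz ⟨s / t₁, hmem s hs⟩]
      simp only
      rw [div_mul_cancel₀ _ ht1pos.ne']
    have hcont : Continuous (IccExtend (by norm_num : (-1 : ℝ) ≤ 1) w) :=
      w.continuous.Icc_extend'
    have hev : (fun s => ψ (s, z) ⟨1, hone⟩) =ᶠ[𝓝 t] fun s => z + t₁ •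
        ∫ r in (0 : ℝ)..(s / t₁), IccExtend (by norm_num : (-1 : ℝ) ≤ 1) w r := by
      have : ∀ᶠ s in 𝓝 t, |s| < t₁ := continuous_abs.continuousAt.eventually_lt_const ht1
      filter_upwards [this] with s hs
      rw [hval s hs, hsol t₁ z ht₁ hz]
      rfl
    have hd := (hcont.integral_hasStrictDerivAt 0 (t / t₁)).hasDerivAt
    have hd2 := ((hd.scomp t ((hasDerivAt_id t).div_const t₁)).const_smul t₁).const_add z
    refine (hd2.congr_of_eventuallyEq hev).congr_deriv ?_
    rw [smul_smul, mul_one_div_cancel ht1pos.ne', one_smul, IccExtend_of_mem _ _ (hmem t ht1)]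
    simp only [hw, nemytskii, ContinuousMap.coe_mk]
    rw [hval t ht1]

/-- Smooth local flow of a vector field which is smooth on an open set. -/
theorem exists_smooth_flow_of_isOpen [FiniteDimensional ℝ E] {f : E → E} {O : Set E}
    (hO : IsOpen O) (hf : ∀ z ∈ O, ContDiffAt ℝ ∞ f z) {z₀ : E} (hz₀ : z₀ ∈ O) :
    ∃ (Φ : ℝ × E → E) (τ : ℝ), 0 < τ ∧ (∀ t z, |t| < τ → ‖z - z₀‖ < τ → ContDiffAt ℝ ∞ Φ (t, z)) ∧
      (∀ z, ‖z - z₀‖ < τ → Φ (0, z) = z) ∧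
      (∀ t z, |t| < τ → ‖z - z₀‖ < τ → Φ (t, z) ∈ O) ∧
      ∀ t z, |t| < τ → ‖z - z₀‖ < τ → HasDerivAt (fun s => Φ (s, z)) (f (Φ (t, z))) t := by
  obtain ⟨ε, hε, hball⟩ := Metric.isOpen_iff.1 hO z₀ hz₀
  -- A cut-off makes the field smooth everywhere; for short times the flow stays in the ball where
  -- the cut-off is `1`, and so follows the original field.
  let χ : ContDiffBump z₀ := ⟨ε / 4, ε / 2, by positivity, by linarith⟩
  have hg : ContDiff ℝ ∞ (fun z => χ z • f z) := by
    rw [contDiff_iff_contDiffAt]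
    intro z
    by_cases hz : z ∈ O
    · exact χ.contDiffAt.smul (hf z hz)
    · have h1 : z ∉ tsupport χ := by
        rw [χ.tsupport_eq]
        intro h
        exact hz (hball (Metric.closedBall_subset_ball (by change ε / 2 < ε; linarith) h))
      have h2 : (fun z => χ z • f z) =ᶠ[𝓝 z] fun _ => 0 := by
        filter_upwards [(isClosed_tsupport χ).isOpen_compl.mem_nhds h1] with y hy
        rw [image_eq_zero_of_notMem_tsupport hy, zero_smul]
      exact contDiffAt_const.congr_of_eventuallyEq h2
  obtain ⟨Φ, τ, hτ, h1, h2, h3⟩ := exists_smooth_flow hg z₀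
  have hc : ContinuousAt Φ (0, z₀) := (h1 0 z₀ (by simpa) (by simpa)).continuousAt
  have h4 : ∀ᶠ p in 𝓝 ((0 : ℝ), z₀), Φ p ∈ Metric.ball z₀ (ε / 4) := by
    refine hc.eventually_mem ?_
    rw [h2 z₀ (by simpa)]
    exact Metric.ball_mem_nhds _ (by positivity)
  obtain ⟨τ', hτ', h5⟩ := Metric.eventually_nhds_iff.1 h4
  have h6 : ∀ t z, |t| < min τ τ' → ‖z - z₀‖ < min τ τ' → Φ (t, z) ∈ Metric.ball z₀ (ε / 4) := by
    intro t z ht hz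
    refine h5 ?_
    rw [Prod.dist_eq, max_lt_iff, dist_zero_right, dist_eq_norm]
    exact ⟨ht.trans_le (min_le_right _ _), hz.trans_le (min_le_right _ _)⟩
  refine ⟨Φ, min τ τ', lt_min hτ hτ', fun t z ht hz => h1 t z (ht.trans_le (min_le_left _ _))
    (hz.trans_le (min_le_left _ _)), fun z hz => h2 z (hz.trans_le (min_le_left _ _)),
    fun t z ht hz => ?_, fun t z ht hz => ?_⟩
  · exact hball (Metric.ball_subset_ball (by linarith) (h6 t z ht hz))
  · have h7 := h3 t z (ht.trans_le (min_le_left _ _)) (hz.trans_le (min_le_left _ _))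
    rwa [χ.one_of_mem_closedBall (Metric.ball_subset_closedBall (h6 t z ht hz)), one_smul] at h7

end Flow

end MinimalHypersurface

end

/-! ### Normal geodesics and the signed distance in a chart -/

noncomputable section

namespace MinimalHypersurface

set_option synthInstance.maxHeartbeats 200000

section Hamiltonian

variable {m : ℕ} {G : BilinField m} {U : Set (Euc m)}

/-- The cotangent space in a chart. -/
abbrev Phase (m : ℕ) : Type := Euc m × (Euc m →L[ℝ] ℝ)

/-- The Hamiltonian vector field of the geodesic flow. -/
def geodesicField (G : BilinField m) (z : Phase m) : Phase m :=
  ((G z.1).inverse z.2,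
    -(1 / 2 : ℝ) • z.2.comp ((fderiv ℝ (fun y => (G y).inverse) z.1).flip z.2))

/-- The squared norm of a covector. -/
def coNormSq (G : BilinField m) (z : Phase m) : ℝ := z.2 ((G z.1).inverse z.2)

lemma IsRiem.inverse_symm (hG : IsRiem G U) {x : Euc m} (hx : x ∈ U) (ξ η : Euc m →L[ℝ] ℝ) :
    η ((G x).inverse ξ) = ξ ((G x).inverse η) := by
  rw [← hG.inverse_apply hx η, ← hG.inverse_apply hx ξ, hG.symm x hx]

lemma geodesicField_smooth (hG : IsRiem G U) {z : Phase m} (hz : z.1 ∈ U) :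
    ContDiffAt ℝ ∞ (geodesicField G) z := by
  have h1 : ContDiffAt ℝ ∞ (fun z : Phase m => (G z.1).inverse) z :=
    ContDiffAt.comp (g := fun y => (G y).inverse) z (hG.inverse_smooth hz) contDiffAt_fst
  have h2 : ContDiffAt ℝ ∞ (fun z : Phase m => fderiv ℝ (fun y => (G y).inverse) z.1) z :=
    ContDiffAt.comp (g := fderiv ℝ (fun y => (G y).inverse)) z
      (smooth_fderiv (hG.inverse_smooth hz)) contDiffAt_fst
  refine (h1.clm_apply contDiffAt_snd).prodMk ?_
  exact (contDiffAt_snd.clm_comp ((smooth_flip h2).clm_apply contDiffAt_snd)).const_smul _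

lemma coNormSq_smooth (hG : IsRiem G U) {z : Phase m} (hz : z.1 ∈ U) :
    ContDiffAt ℝ ∞ (coNormSq G) z := by
  have h1 : ContDiffAt ℝ ∞ (fun z : Phase m => (G z.1).inverse) z :=
    ContDiffAt.comp (g := fun y => (G y).inverse) z (hG.inverse_smooth hz) contDiffAt_fst
  exact contDiffAt_snd.clm_apply (h1.clm_apply contDiffAt_snd)

/-- Hamilton's equations. -/
lemma fderiv_coNormSq (hG : IsRiem G U) {z : Phase m} (hz : z.1 ∈ U) (w : Phase m) :
    fderiv ℝ (coNormSq G) z w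
      = 2 * (w.2 (geodesicField G z).1 - (geodesicField G z).2 w.1) := by
  have h1 : HasFDerivAt (fun z : Phase m => (G z.1).inverse)
      ((fderiv ℝ (fun y => (G y).inverse) z.1).comp (.fst ℝ _ _)) z :=
    HasFDerivAt.comp (g := fun y => (G y).inverse) z
      (smooth_differentiableAt (hG.inverse_smooth hz)).hasFDerivAt hasFDerivAt_fst
  have h2 := (hasFDerivAt_snd (p := z)).clm_apply (h1.clm_apply (hasFDerivAt_snd (p := z)))
  have h3 : fderiv ℝ (coNormSq G) z = _ := h2.fderiv
  rw [h3]
  have h4 := hG.inverse_symm hz z.2 w.2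
  simp only [geodesicField, add_apply, ContinuousLinearMap.comp_apply,
    ContinuousLinearMap.flip_apply, ContinuousLinearMap.coe_snd', ContinuousLinearMap.coe_fst',
    map_add, smul_apply, smul_eq_mul]
  rw [← h4]
  ring

end Hamiltonian

lemma eq_of_fderiv_eq_zero {f : ℝ → ℝ} {τ : ℝ} (hf : ∀ s, |s| < τ → HasDerivAt f 0 s) {s : ℝ}
    (hs : |s| < τ) : f s = f 0 := by
  have h0 : |(0 : ℝ)| < τ := by rw [abs_zero]; exact (abs_nonneg s).trans_lt hs
  have hmem : ∀ r, r ∈ Metric.ball (0 : ℝ) τ ↔ |r| < τ := fun r => by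
    rw [mem_ball_zero_iff, Real.norm_eq_abs]
  refine (convex_ball (0 : ℝ) τ).is_const_of_fderivWithin_eq_zero (𝕜 := ℝ) (f := f)
    (fun r hr => (hf r ((hmem r).1 hr)).differentiableAt.differentiableWithinAt) (fun r hr => ?_)
    ((hmem s).2 hs) ((hmem 0).2 h0)
  rw [fderivWithin_of_isOpen Metric.isOpen_ball hr]
  have := (hf r ((hmem r).1 hr)).hasFDerivAt.fderiv
  rw [this]; ext; simp

section Normal

variable {n : ℕ} {G : BilinField (n + 1)} {U : Set (Euc (n + 1))} {F : Euc n → Euc (n + 1)}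
  {V : Set (Euc n)} {N : Euc n → Euc (n + 1)}

/-- The normal exponential map of a hypersurface, with the momentum of the normal geodesics. -/
structure IsNormalFlow (G : BilinField (n + 1)) (U : Set (Euc (n + 1)))
    (F : Euc n → Euc (n + 1)) (V : Set (Euc n)) (X : ℝ × Euc n → Euc (n + 1))
    (Ξ : ℝ × Euc n → Euc (n + 1) →L[ℝ] ℝ) (τ : ℝ) : Prop where
  pos : 0 < τ
  isOpen : IsOpen V
  smooth : ∀ p : ℝ × Euc n, |p.1| < τ → p.2 ∈ V → ContDiffAt ℝ ∞ X p
  mem : ∀ p : ℝ × Euc n, |p.1| < τ → p.2 ∈ V → X p ∈ U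
  deriv_time : ∀ p : ℝ × Euc n, |p.1| < τ → p.2 ∈ V →
    fderiv ℝ X p (1, 0) = (G (X p)).inverse (Ξ p)
  unit : ∀ p : ℝ × Euc n, |p.1| < τ → p.2 ∈ V → Ξ p ((G (X p)).inverse (Ξ p)) = 1
  orth : ∀ p : ℝ × Euc n, |p.1| < τ → p.2 ∈ V → ∀ η, Ξ p (fderiv ℝ X p (0, η)) = 0
  init : ∀ y ∈ V, X (0, y) = F y

lemma isOpen_box {V : Set (Euc n)} (hV : IsOpen V) (τ : ℝ) :
    IsOpen {p : ℝ × Euc n | |p.1| < τ ∧ p.2 ∈ V} :=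
  (isOpen_lt (continuous_abs.comp continuous_fst) continuous_const).inter
    (hV.preimage continuous_snd)

/-- The geodesic flow on covectors is started at `(F y, G(N, ·))`. The norm of the momentum is
conserved by Hamilton's equations, and the orthogonality of the momentum to the variations `∂_η X`
is the Gauss lemma: it holds at time `0` and its time derivative vanishes. -/
lemma HypData.exists_normalFlow (h : HypData G U F V N) {y₀ : Euc n} (hy₀ : y₀ ∈ V) :
    ∃ (X : ℝ × Euc n → Euc (n + 1)) (Ξ : ℝ × Euc n → Euc (n + 1) →L[ℝ] ℝ) (τ : ℝ)
      (V₁ : Set (Euc n)), y₀ ∈ V₁ ∧ V₁ ⊆ V ∧ IsNormalFlow G U F V₁ X Ξ τ ∧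
        ∀ y ∈ V₁, fderiv ℝ X (0, y) (1, 0) = N y := by
  have hG := h.riem
  let ζ : Euc n → Phase (n + 1) := fun y => (F y, G (F y) (N y))
  have hζ : ∀ y ∈ V, ContDiffAt ℝ ∞ ζ y := fun y hy =>
    (h.smooth y hy).prodMk ((ContDiffAt.comp (g := G) y (hG.smooth _ (h.maps hy))
      (h.smooth y hy)).clm_apply (h.smoothN y hy))
  have hO : IsOpen {z : Phase (n + 1) | z.1 ∈ U} := hG.isOpen.preimage continuous_fst
  obtain ⟨Φ, τ, hτ, hΦs, hΦ0, hΦO, hΦd⟩ := exists_smooth_flow_of_isOpen hO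
    (fun z hz => geodesicField_smooth hG hz) (z₀ := ζ y₀) (h.maps hy₀)
  let V₁ : Set (Euc n) := {y | y ∈ V ∧ ‖ζ y - ζ y₀‖ < τ}
  have hV₁ : IsOpen V₁ := by
    have hc : ContinuousOn (fun y => ‖ζ y - ζ y₀‖) V := fun y hy =>
      (((hζ y hy).continuousAt.sub continuousAt_const).norm).continuousWithinAt
    exact hc.isOpen_inter_preimage h.isOpen isOpen_Iio
  let Z : ℝ × Euc n → Phase (n + 1) := fun p => Φ (p.1, ζ p.2)
  have hZ : ∀ p : ℝ × Euc n, |p.1| < τ → p.2 ∈ V₁ → ContDiffAt ℝ ∞ Z p := fun p hp1 hp2 =>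
    ContDiffAt.comp (g := Φ) p (hΦs _ _ hp1 hp2.2)
      (contDiffAt_fst.prodMk (ContDiffAt.comp (g := ζ) p (hζ _ hp2.1) contDiffAt_snd))
  have hB := isOpen_box hV₁ τ
  have hZU : ∀ p : ℝ × Euc n, |p.1| < τ → p.2 ∈ V₁ → (Z p).1 ∈ U := fun p hp1 hp2 =>
    hΦO _ _ hp1 hp2.2
  have hline : ∀ (s : ℝ) (y : Euc n), HasDerivAt (fun r : ℝ => (r, y)) ((1 : ℝ), (0 : Euc n)) s :=
    fun s y => (hasDerivAt_id s).prodMk (hasDerivAt_const s y)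
  have hZt : ∀ p : ℝ × Euc n, |p.1| < τ → p.2 ∈ V₁ →
      fderiv ℝ Z p (1, 0) = geodesicField G (Z p) := by
    intro p hp1 hp2
    have h1 : HasDerivAt (fun r => Z (r, p.2)) (fderiv ℝ Z p (1, 0)) p.1 :=
      HasFDerivAt.comp_hasDerivAt (l := Z) p.1
        (smooth_differentiableAt (hZ p hp1 hp2)).hasFDerivAt (hline p.1 p.2)
    exact h1.unique (hΦd _ _ hp1 hp2.2)
  have hZ0 : ∀ y ∈ V₁, Z (0, y) = ζ y := fun y hy => hΦ0 _ hy.2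
  have hH : ∀ p : ℝ × Euc n, |p.1| < τ → p.2 ∈ V₁ → coNormSq G (Z p) = 1 := by
    intro p hp1 hp2
    have h1 : ∀ s, |s| < τ → HasDerivAt (fun r => coNormSq G (Z (r, p.2))) 0 s := by
      intro s hs
      have h2 : HasDerivAt (fun r => Z (r, p.2)) (geodesicField G (Z (s, p.2))) s := by
        rw [← hZt (s, p.2) hs hp2]
        exact HasFDerivAt.comp_hasDerivAt (l := Z) s
          (smooth_differentiableAt (hZ (s, p.2) hs hp2)).hasFDerivAt (hline s p.2)
      have h3 := HasFDerivAt.comp_hasDerivAt (l := coNormSq G) s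
        (smooth_differentiableAt (coNormSq_smooth hG (hZU (s, p.2) hs hp2))).hasFDerivAt h2
      rw [fderiv_coNormSq hG (hZU (s, p.2) hs hp2), sub_self, mul_zero] at h3
      exact h3
    have h4 := eq_of_fderiv_eq_zero h1 hp1
    rw [show Z p = Z (p.1, p.2) from rfl, h4, hZ0 _ hp2]
    simp only [coNormSq, ζ]
    rw [hG.inverse_self (h.maps hp2.1)]
    exact (h.unit _ hp2.1).1
  have hX : ∀ p : ℝ × Euc n, |p.1| < τ → p.2 ∈ V₁ → ContDiffAt ℝ ∞ (fun p => (Z p).1) p :=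
    fun p h1 h2 => (hZ p h1 h2).fst
  have hΞ : ∀ p : ℝ × Euc n, |p.1| < τ → p.2 ∈ V₁ → ContDiffAt ℝ ∞ (fun p => (Z p).2) p :=
    fun p h1 h2 => (hZ p h1 h2).snd
  have hXf : ∀ p : ℝ × Euc n, |p.1| < τ → p.2 ∈ V₁ → ∀ v,
      fderiv ℝ (fun p => (Z p).1) p v = (fderiv ℝ Z p v).1 := fun p h1 h2 v => by
    rw [(smooth_differentiableAt (hZ p h1 h2)).hasFDerivAt.fst.fderiv]; rfl
  have hΞf : ∀ p : ℝ × Euc n, |p.1| < τ → p.2 ∈ V₁ → ∀ v,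
      fderiv ℝ (fun p => (Z p).2) p v = (fderiv ℝ Z p v).2 := fun p h1 h2 v => by
    rw [(smooth_differentiableAt (hZ p h1 h2)).hasFDerivAt.snd.fderiv]; rfl
  have horth : ∀ p : ℝ × Euc n, |p.1| < τ → p.2 ∈ V₁ → ∀ η,
      (Z p).2 (fderiv ℝ (fun p => (Z p).1) p (0, η)) = 0 := by
    intro p hp1 hp2 η
    have hder : ∀ s, |s| < τ → HasDerivAt
        (fun r => (Z (r, p.2)).2 (fderiv ℝ (fun p => (Z p).1) (r, p.2) (0, η))) 0 s := by
      intro s hs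
      set q : ℝ × Euc n := (s, p.2) with hq
      have hq1 : |q.1| < τ := hs
      have hq2 : q.2 ∈ V₁ := hp2
      have hnhds : {p : ℝ × Euc n | |p.1| < τ ∧ p.2 ∈ V₁} ∈ 𝓝 q := hB.mem_nhds ⟨hq1, hq2⟩
      have e1 := (smooth_differentiableAt (hΞ q hq1 hq2)).hasFDerivAt.clm_apply
        (smooth_differentiableAt (smooth_fderiv_apply (hX q hq1 hq2) (0, η))).hasFDerivAt
      have e2 := e1.comp_hasDerivAt s (hline s p.2)
      refine e2.congr_deriv ?_
      have e3 : (fun p => fderiv ℝ (fun p => (Z p).1) p (1, 0)) =ᶠ[𝓝 q]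
          fun p => (geodesicField G (Z p)).1 := by
        filter_upwards [hnhds] with r hr
        rw [hXf r hr.1 hr.2, hZt r hr.1 hr.2]
      have e4 : fderiv ℝ (fun p => fderiv ℝ (fun p => (Z p).1) p (0, η)) q (1, 0)
          = fderiv ℝ (fun p => (geodesicField G (Z p)).1) q (0, η) := by
        rw [fderiv_fderiv_apply (hX q hq1 hq2), fderiv_fderiv_symm (hX q hq1 hq2),
          ← fderiv_fderiv_apply (hX q hq1 hq2), e3.fderiv_eq]
      have hgs : ContDiffAt ℝ ∞ (fun p => (geodesicField G (Z p)).1) q :=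
        (ContDiffAt.comp (g := geodesicField G) q (geodesicField_smooth hG (hZU q hq1 hq2))
          (hZ q hq1 hq2)).fst
      -- The constancy of the squared norm is used twice. The product rule gives `∂_η Ξ(Ẋ) + Ξ(∂_η
      -- Ẋ) = 0`, and Hamilton's equations give `∂_η Ξ(Ẋ) = Ξ̇(∂_η X)`; so `Ξ̇(∂_η X) + Ξ(∂_t ∂_η X)
      -- = 0`.
      have e5 : (fun p => (Z p).2 ((geodesicField G (Z p)).1)) =ᶠ[𝓝 q] fun _ => (1 : ℝ) := by
        filter_upwards [hnhds] with r hr using hH r hr.1 hr.2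
      have e6 := ((smooth_differentiableAt (hΞ q hq1 hq2)).hasFDerivAt.clm_apply
        (smooth_differentiableAt hgs).hasFDerivAt).fderiv
      rw [e5.fderiv_eq] at e6
      have e7 := congrArg (fun L => L (0, η)) e6
      have e8 : (fun p => coNormSq G (Z p)) =ᶠ[𝓝 q] fun _ => (1 : ℝ) := by
        filter_upwards [hnhds] with r hr using hH r hr.1 hr.2
      have e9 : HasFDerivAt (fun p => coNormSq G (Z p))
          ((fderiv ℝ (coNormSq G) (Z q)).comp (fderiv ℝ Z q)) q :=
        HasFDerivAt.comp (g := coNormSq G) q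
          (smooth_differentiableAt (coNormSq_smooth hG (hZU q hq1 hq2))).hasFDerivAt
          (smooth_differentiableAt (hZ q hq1 hq2)).hasFDerivAt
      have e10 := congrArg (fun L => L (0, η)) (e9.fderiv.symm.trans e8.fderiv_eq)
      simp only [ContinuousLinearMap.comp_apply, fderiv_coNormSq hG (hZU q hq1 hq2),
        fderiv_const_apply, zero_apply] at e10
      simp only [add_apply, ContinuousLinearMap.comp_apply, ContinuousLinearMap.flip_apply,
        fderiv_const_apply, zero_apply, hΞf q hq1 hq2] at e7
      simp only [add_apply, ContinuousLinearMap.comp_apply, ContinuousLinearMap.flip_apply, e4,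
        hΞf q hq1 hq2, hZt q hq1 hq2, hXf q hq1 hq2]
      linarith
    have h4 := eq_of_fderiv_eq_zero hder hp1
    rw [show p = (p.1, p.2) from rfl, h4, hZ0 _ hp2]
    have h5 : fderiv ℝ (fun p => (Z p).1) (0, p.2) (0, η) = fderiv ℝ F p.2 η := by
      have f1 : HasFDerivAt (fun y : Euc n => (Z (0, y)).1)
          ((fderiv ℝ (fun p => (Z p).1) (0, p.2)).comp (.inr ℝ ℝ (Euc n))) p.2 :=
        HasFDerivAt.comp (g := fun p => (Z p).1) p.2
          (smooth_differentiableAt (hX (0, p.2) (by simpa using hτ) hp2)).hasFDerivAt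
          (hasFDerivAt_prodMk_right _ _)
      have f2 : (fun y : Euc n => (Z (0, y)).1) =ᶠ[𝓝 p.2] F := by
        filter_upwards [hV₁.mem_nhds hp2] with y hy
        rw [hZ0 y hy]
      have f3 := f1.fderiv.symm.trans f2.fderiv_eq
      rw [← f3]; rfl
    rw [h5]
    exact (h.unit _ hp2.1).2 η
  refine ⟨fun p => (Z p).1, fun p => (Z p).2, τ, V₁, ⟨hy₀, by simpa using hτ⟩, fun y hy => hy.1,
    ⟨hτ, hV₁, hX, hZU, ?_, hH, horth, fun y hy => by rw [hZ0 y hy]⟩, ?_⟩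
  · intro p h1 h2
    rw [hXf p h1 h2, hZt p h1 h2]; rfl
  · intro y hy
    have h0 : |((0 : ℝ), y).1| < τ := by simpa using hτ
    rw [hXf _ h0 hy, hZt _ h0 hy, hZ0 y hy]
    exact hG.inverse_self (h.maps hy.1) _

/-- `t` is a signed distance function from `F`: it solves the eikonal equation, vanishes on `F`,
and its level sets are joined to `F` by curves of length `|t|`. -/
structure IsEikonal (G : BilinField (n + 1)) (U : Set (Euc (n + 1))) (F : Euc n → Euc (n + 1))
    (V V₀ : Set (Euc n)) (W : Set (Euc (n + 1))) (t : Euc (n + 1) → ℝ) : Prop where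
  isOpen : IsOpen W
  subset : W ⊆ U
  isOpen₀ : IsOpen V₀
  subset₀ : V₀ ⊆ V
  maps : MapsTo F V₀ W
  smooth : ∀ x ∈ W, ContDiffAt ℝ ∞ t x
  zero : ∀ y ∈ V₀, t (F y) = 0
  eikonal : ∀ x ∈ W, fderiv ℝ t x ((G x).inverse (fderiv ℝ t x)) = 1
  curve : ∀ x ∈ W, ∃ c : ℝ → Euc (n + 1), c 0 ∈ F '' V ∧ c 1 = x ∧ ∀ s ∈ Icc (0 : ℝ) 1,
    c s ∈ U ∧ ContDiffAt ℝ ∞ c s ∧ G (c s) (deriv c s) (deriv c s) = t x ^ 2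

/-- The differential of the normal exponential map at `(0, y₀)` is `(σ, η) ↦ σ N + dF η`, hence
invertible. The function `t` is the time component of the local inverse; its differential is the
momentum `Ξ`, which has norm `1`. -/
theorem HypData.exists_eikonal (h : HypData G U F V N) {y₀ : Euc n} (hy₀ : y₀ ∈ V) :
    ∃ (V₀ : Set (Euc n)) (W : Set (Euc (n + 1))) (t : Euc (n + 1) → ℝ), y₀ ∈ V₀ ∧
      IsEikonal G U F V V₀ W t := by
  obtain ⟨X, Ξ, τ, V₁, hy₁, hV₁, hf, hN⟩ := h.exists_normalFlow hy₀
  have hG := h.riem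
  set p₀ : ℝ × Euc n := (0, y₀) with hp₀
  have h0 : |p₀.1| < τ := by simpa [hp₀] using hf.pos
  have hX0 := hf.smooth p₀ h0 hy₁
  have hD0 : ∀ y ∈ V₁, ∀ η, fderiv ℝ X (0, y) (0, η) = fderiv ℝ F y η := by
    intro y hy η
    have f1 : HasFDerivAt (fun y : Euc n => X (0, y))
        ((fderiv ℝ X (0, y)).comp (.inr ℝ ℝ (Euc n))) y :=
      HasFDerivAt.comp (g := X) y
        (smooth_differentiableAt (hf.smooth (0, y) (by simpa using hf.pos) hy)).hasFDerivAt
        (hasFDerivAt_prodMk_right _ _)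
    have f2 : (fun y : Euc n => X (0, y)) =ᶠ[𝓝 y] F := by
      filter_upwards [hf.isOpen.mem_nhds hy] with z hz using hf.init z hz
    have f3 := f1.fderiv.symm.trans f2.fderiv_eq
    rw [← f3]; rfl
  have hDX : ∀ σ η, fderiv ℝ X p₀ (σ, η) = σ • N y₀ + fderiv ℝ F y₀ η := by
    intro σ η
    have e : ((σ, η) : ℝ × Euc n) = σ • (1, 0) + (0, η) := by simp
    rw [e, map_add, map_smul, hN y₀ hy₁, hD0 y₀ hy₁]
  have hinj : Function.Injective (fderiv ℝ X p₀) := by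
    rw [injective_iff_map_eq_zero]
    rintro ⟨σ, η⟩ hz
    rw [hDX] at hz
    have h1 := congrArg (fun w => G (F y₀) (N y₀) w) hz
    simp only [map_add, map_smul, (h.unit y₀ hy₀).1, (h.unit y₀ hy₀).2, map_zero, smul_eq_mul,
      mul_one, add_zero] at h1
    rw [h1, zero_smul, zero_add] at hz
    exact Prod.ext h1 (h.inj y₀ hy₀ (hz.trans (map_zero _).symm))
  let e₀ : (ℝ × Euc n) ≃L[ℝ] Euc (n + 1) := (LinearMap.linearEquivOfInjective
    (fderiv ℝ X p₀ : (ℝ × Euc n) →ₗ[ℝ] Euc (n + 1)) hinj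
    (by simp [add_comm])).toContinuousLinearEquiv
  have he₀ : (e₀ : (ℝ × Euc n) →L[ℝ] Euc (n + 1)) = fderiv ℝ X p₀ :=
    ContinuousLinearMap.ext fun _ => rfl
  have hXd : HasFDerivAt X (e₀ : (ℝ × Euc n) →L[ℝ] Euc (n + 1)) p₀ := by
    rw [he₀]; exact (smooth_differentiableAt hX0).hasFDerivAt
  let e := hX0.toOpenPartialHomeomorph X hXd (by simp)
  have heX : ∀ p, e p = X p := fun p => rfl
  have hp₀e : p₀ ∈ e.source := hX0.mem_toOpenPartialHomeomorph_source hXd (by simp)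
  have hinv : ∀ᶠ p in 𝓝 p₀, ∃ A : (ℝ × Euc n) ≃L[ℝ] Euc (n + 1),
      (A : (ℝ × Euc n) →L[ℝ] Euc (n + 1)) = fderiv ℝ X p := by
    have hc : ContinuousAt (fderiv ℝ X) p₀ := (smooth_fderiv hX0).continuousAt
    have h6 : range ((↑) : ((ℝ × Euc n) ≃L[ℝ] Euc (n + 1)) → (ℝ × Euc n) →L[ℝ] Euc (n + 1)) ∈
        𝓝 (fderiv ℝ X p₀) := by
      rw [← he₀]; exact ContinuousLinearEquiv.nhds e₀
    exact hc h6
  obtain ⟨B₁, hB₁, hB₁o, hp₀B⟩ := eventually_nhds_iff.1 hinv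
  -- Smoothness of the inverse is needed on the whole target, so the source is shrunk to points
  -- where the differential of `X` is still invertible.
  set B : Set (ℝ × Euc n) := {p | |p.1| < τ ∧ p.2 ∈ V₁} ∩ B₁ with hB
  have hBo : IsOpen B := (isOpen_box hf.isOpen τ).inter hB₁o
  let e' := e.restrOpen B hBo
  have hsrc : e'.source = e.source ∩ B := rfl
  have he'X : ∀ p, e' p = X p := fun p => rfl
  have hleft : ∀ p ∈ e'.source, e'.symm (X p) = p := fun p hp => e'.left_inv hp
  have htgt : ∀ x ∈ e'.target, e'.symm x ∈ e'.source ∧ X (e'.symm x) = x := fun x hx =>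
    ⟨e'.map_target hx, e'.right_inv hx⟩
  have hsymm : ∀ x ∈ e'.target, ContDiffAt ℝ ∞ e'.symm x := by
    intro x hx
    obtain ⟨h1, h2⟩ := htgt x hx
    rw [hsrc] at h1
    obtain ⟨A, hA⟩ := hB₁ _ h1.2.2
    refine e'.contDiffAt_symm (f₀' := A) hx ?_ (hf.smooth _ h1.2.1.1 h1.2.1.2)
    change HasFDerivAt X _ _
    rw [hA]
    exact (smooth_differentiableAt (hf.smooth _ h1.2.1.1 h1.2.1.2)).hasFDerivAt
  refine ⟨{y | y ∈ V₁ ∧ ((0 : ℝ), y) ∈ e'.source}, e'.target, fun x => (e'.symm x).1,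
    ⟨hy₁, hp₀e, ⟨h0, hy₁⟩, hp₀B⟩, ?_⟩
  refine ⟨e'.open_target, ?_, ?_, fun y hy => hV₁ hy.1, ?_, fun x hx => (hsymm x hx).fst, ?_, ?_, ?_⟩
  · intro x hx
    obtain ⟨h1, h2⟩ := htgt x hx
    rw [hsrc] at h1
    rw [← h2]
    exact hf.mem _ h1.2.1.1 h1.2.1.2
  · exact hf.isOpen.inter (e'.open_source.preimage (by fun_prop : Continuous fun y : Euc n => ((0 : ℝ), y)))
  · intro y hy
    rw [← hf.init y hy.1]
    exact e'.map_source hy.2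
  · intro y hy
    rw [← hf.init y hy.1, hleft _ hy.2]
  · intro x hx
    obtain ⟨h1, h2⟩ := htgt x hx
    have h1' := h1
    rw [hsrc] at h1'
    set p := e'.symm x with hp
    have hpτ := h1'.2.1.1
    have hpV := h1'.2.1.2
    have hXp := smooth_differentiableAt (hf.smooth p hpτ hpV)
    have f1 : HasFDerivAt (fun q => (e'.symm (X q)).1)
        ((fderiv ℝ (fun x => (e'.symm x).1) (X p)).comp (fderiv ℝ X p)) p :=
      HasFDerivAt.comp (g := fun x => (e'.symm x).1) p
        (smooth_differentiableAt (by rw [h2]; exact (hsymm x hx).fst)).hasFDerivAt hXp.hasFDerivAt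
    have f2 : (fun q => (e'.symm (X q)).1) =ᶠ[𝓝 p] Prod.fst := by
      filter_upwards [e'.open_source.mem_nhds h1] with q hq
      rw [hleft q hq]
    have f3 := (f1.congr_of_eventuallyEq f2.symm).unique hasFDerivAt_fst
    -- Unit speed and the Gauss lemma say that `Ξ ∘ dX` is the time component. By `f3` so is `dt ∘
    -- dX`, and `dX` is onto; hence `dt = Ξ`.
    have f4 : (Ξ p).comp (fderiv ℝ X p) = ContinuousLinearMap.fst ℝ ℝ (Euc n) := by
      refine ContinuousLinearMap.ext fun v => ?_
      obtain ⟨σ, η⟩ := v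
      have e1 : ((σ, η) : ℝ × Euc n) = σ • (1, 0) + (0, η) := by simp
      rw [ContinuousLinearMap.comp_apply, e1, map_add, map_add, map_smul, map_smul,
        hf.deriv_time p hpτ hpV, hf.unit p hpτ hpV, hf.orth p hpτ hpV]
      simp
    obtain ⟨A, hA⟩ := hB₁ _ h1'.2.2
    have f5 : fderiv ℝ (fun x => (e'.symm x).1) (X p) = Ξ p := by
      ext1 w
      have f6 := f3.trans f4.symm
      have f7 := congrArg (fun L => L (A.symm w)) f6
      simp only [ContinuousLinearMap.comp_apply, ← hA, ContinuousLinearEquiv.coe_coe,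
        ContinuousLinearEquiv.apply_symm_apply] at f7
      exact f7
    rw [h2] at f5
    rw [f5, ← h2]
    exact hf.unit p hpτ hpV
  · intro x hx
    obtain ⟨h1, h2⟩ := htgt x hx
    rw [hsrc] at h1
    set p := e'.symm x with hp
    have hpτ := h1.2.1.1
    have hpV := h1.2.1.2
    have hle : ∀ s ∈ Icc (0 : ℝ) 1, |((s * p.1, p.2) : ℝ × Euc n).1| < τ := by
      intro s hs
      simp only [abs_mul, abs_of_nonneg hs.1]
      exact lt_of_le_of_lt (mul_le_of_le_one_left (abs_nonneg _) hs.2) hpτ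
    -- The normal geodesic from `F` to `x`, reparametrised over `[0, 1]`, so that its squared speed
    -- is the constant `t²`.
    refine ⟨fun s => X (s * p.1, p.2), ⟨p.2, hV₁ hpV, ?_⟩, ?_, fun s hs => ⟨?_, ?_, ?_⟩⟩
    · simp only [zero_mul]; exact (hf.init _ hpV).symm
    · simp only [one_mul]; exact h2
    · exact hf.mem _ (hle s hs) hpV
    · exact ContDiffAt.comp (g := X) s (hf.smooth _ (hle s hs) hpV) (by fun_prop)
    · have hd : HasDerivAt (fun s : ℝ => ((s * p.1, p.2) : ℝ × Euc n)) (p.1 • (1, 0)) s := by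
        have := ((hasDerivAt_id s).mul_const p.1).prodMk (hasDerivAt_const s p.2)
        simpa using this
      have hd2 := HasFDerivAt.comp_hasDerivAt (l := X) s
        (smooth_differentiableAt (hf.smooth _ (hle s hs) hpV)).hasFDerivAt hd
      have hd3 : deriv (fun s => X (s * p.1, p.2)) s = _ := hd2.deriv
      rw [hd3, map_smul, hf.deriv_time _ (hle s hs) hpV]
      simp only [map_smul, smul_apply, smul_eq_mul]
      rw [hG.inverse_apply (hf.mem _ (hle s hs) hpV), hf.unit _ (hle s hs) hpV]
      ring

end Normal

end MinimalHypersurface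

end

/-! ### Metrics of a manifold in the preferred charts -/

noncomputable section

namespace MinimalHypersurface

set_option synthInstance.maxHeartbeats 200000
set_option linter.unusedSectionVars false

section Ambient

variable {m : ℕ} {M : Type*} [TopologicalSpace M] [ChartedSpace (Euc m) M] [IsManifold (𝓡 m) ∞ M]
  {x₀ x₁ : M}

/-- The differential of the preferred chart around `x₀`. -/
def chartD (x₀ x : M) : Euc m →L[ℝ] Euc m := mfderiv (𝓡 m) (𝓡 m) (extChartAt (𝓡 m) x₀) x

/-- The differential of the inverse of the preferred chart around `x₀`. -/
def symmD (x₀ : M) (y : Euc m) : Euc m →L[ℝ] Euc m :=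
  mfderiv (𝓡 m) (𝓡 m) (extChartAt (𝓡 m) x₀).symm y

lemma contMDiffAt_chart {x : M} (hx : x ∈ (extChartAt (𝓡 m) x₀).source) :
    ContMDiffAt (𝓡 m) (𝓡 m) ∞ (extChartAt (𝓡 m) x₀) x :=
  contMDiffAt_extChartAt' (by simpa using hx)

lemma isOpen_chart_target (x₀ : M) : IsOpen (extChartAt (𝓡 m) x₀).target :=
  isOpen_extChartAt_target x₀

lemma contMDiffAt_chart_symm {y : Euc m} (hy : y ∈ (extChartAt (𝓡 m) x₀).target) :
    ContMDiffAt (𝓡 m) (𝓡 m) ∞ (extChartAt (𝓡 m) x₀).symm y :=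
  (contMDiffOn_extChartAt_symm x₀).contMDiffAt ((isOpen_chart_target x₀).mem_nhds hy)

lemma mdiff_chart {x : M} (hx : x ∈ (extChartAt (𝓡 m) x₀).source) :
    MDifferentiableAt (𝓡 m) (𝓡 m) (extChartAt (𝓡 m) x₀) x :=
  (contMDiffAt_chart hx).mdifferentiableAt (by simp)

lemma mdiff_chart_symm {y : Euc m} (hy : y ∈ (extChartAt (𝓡 m) x₀).target) :
    MDifferentiableAt (𝓡 m) (𝓡 m) (extChartAt (𝓡 m) x₀).symm y :=
  (contMDiffAt_chart_symm hy).mdifferentiableAt (by simp)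

lemma symmD_chartD {x : M} (hx : x ∈ (extChartAt (𝓡 m) x₀).source) (v : Euc m) :
    symmD x₀ (extChartAt (𝓡 m) x₀ x) (chartD x₀ x v) = v := by
  have h := mfderivWithin_extChartAt_symm_comp_mfderiv_extChartAt' (I := 𝓡 m) hx
  simp only [ModelWithCorners.Boundaryless.range_eq_univ, mfderivWithin_univ] at h
  exact congrArg (fun A : Euc m →L[ℝ] Euc m => A v) h

lemma chartD_symmD {y : Euc m} (hy : y ∈ (extChartAt (𝓡 m) x₀).target) (v : Euc m) :
    chartD x₀ ((extChartAt (𝓡 m) x₀).symm y) (symmD x₀ y v) = v := by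
  have h := mfderiv_extChartAt_comp_mfderivWithin_extChartAt_symm (I := 𝓡 m) hy
  simp only [ModelWithCorners.Boundaryless.range_eq_univ, mfderivWithin_univ] at h
  exact congrArg (fun A : Euc m →L[ℝ] Euc m => A v) h

lemma chartD_injective {x : M} (hx : x ∈ (extChartAt (𝓡 m) x₀).source) :
    Function.Injective (chartD (m := m) x₀ x) := by
  intro v w h
  exact (symmD_chartD hx v).symm.trans ((congrArg _ h).trans (symmD_chartD hx w))

lemma coeff_apply (g : Metric m M) (x₀ : M) (y u v : Euc m) :
    coeff g x₀ y u v = g.inner ((extChartAt (𝓡 m) x₀).symm y) (symmD x₀ y u) (symmD x₀ y v) := rfl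

lemma coeff_chart (g : Metric m M) {x : M} (hx : x ∈ (extChartAt (𝓡 m) x₀).source)
    (v w : Euc m) :
    coeff g x₀ (extChartAt (𝓡 m) x₀ x) (chartD x₀ x v) (chartD x₀ x w) = g.inner x v w := by
  rw [coeff_apply, symmD_chartD hx, symmD_chartD hx, (extChartAt (𝓡 m) x₀).left_inv hx]

/-- A linear map on `Euc m` is a finite sum over a basis, with coefficients its values there; this
is applied once for each argument. -/
lemma smooth_of_apply₂ {E : Type*} [NormedAddCommGroup E] [NormedSpace ℝ E] {x : E}
    {G : E → Euc m →L[ℝ] Euc m →L[ℝ] ℝ} (h : ∀ u v, ContDiffAt ℝ ∞ (fun y => G y u v) x) :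
    ContDiffAt ℝ ∞ G x := by
  have key : ∀ (F : Type) [NormedAddCommGroup F] [NormedSpace ℝ F] (A : E → Euc m →L[ℝ] F),
      (∀ u, ContDiffAt ℝ ∞ (fun y => A y u) x) → ContDiffAt ℝ ∞ A x := by
    intro F _ _ A hA
    let b := (EuclideanSpace.basisFun (Fin m) ℝ).toBasis
    have : A = fun y => ∑ i, (EuclideanSpace.proj i : Euc m →L[ℝ] ℝ).smulRight (A y (b i)) := by
      funext y
      refine ContinuousLinearMap.ext fun v => ?_
      conv_lhs => rw [← b.sum_repr v]
      simp [b]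
    rw [this]
    refine ContDiffAt.sum fun i _ => ?_
    exact (ContinuousLinearMap.smulRightL ℝ (Euc m) F
      (EuclideanSpace.proj i : Euc m →L[ℝ] ℝ)).contDiff.contDiffAt.comp x (hA (b i))
  exact key _ G fun u => key _ _ fun v => h u v

lemma contMDiffAt_symm_vector {y : Euc m} (hy : y ∈ (extChartAt (𝓡 m) x₀).target) (u : Euc m) :
    ContMDiffAt (𝓡 m) (𝓡 m).tangent ∞ (fun y : Euc m =>
      (⟨(extChartAt (𝓡 m) x₀).symm y, symmD x₀ y u⟩ : TangentBundle (𝓡 m) M)) y := by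
  have ho := isOpen_chart_target x₀ (m := m)
  have h1 := (contMDiffOn_extChartAt_symm (I := 𝓡 m) (n := ∞) x₀).contMDiffOn_tangentMapWithin
    (m := ∞) (by simp) ho.uniqueMDiffOn
  have h2 : ContMDiffAt (𝓡 m) (𝓡 m).tangent ∞
      (fun y : Euc m => (⟨y, u⟩ : TangentBundle (𝓡 m) (Euc m))) y := by
    exact contMDiffAt_vectorSpace_iff_contDiffAt.2 contDiffAt_const
  have h3 := (h1.contMDiffAt (x := (⟨y, u⟩ : TangentBundle (𝓡 m) (Euc m)))
    ((ho.preimage (FiberBundle.continuous_proj _ _)).mem_nhds hy)).comp y h2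
  refine h3.congr_of_eventuallyEq ?_
  filter_upwards [ho.mem_nhds hy] with z hz
  simp only [Function.comp, tangentMapWithin, mfderivWithin_of_isOpen ho hz]
  rfl


set_option maxHeartbeats 1000000 in
lemma smooth_coeff_apply (g : Metric m M) {y : Euc m} (hy : y ∈ (extChartAt (𝓡 m) x₀).target)
    (u v : Euc m) : ContDiffAt ℝ ∞ (fun y => coeff g x₀ y u v) y := by
  have h1 : ContMDiffAt (𝓡 m) ((𝓡 m).prod 𝓘(ℝ, Euc m →L[ℝ] Euc m →L[ℝ] ℝ)) ∞ (fun y : Euc m =>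
      Bundle.TotalSpace.mk' (Euc m →L[ℝ] Euc m →L[ℝ] ℝ)
      (E := fun x : M => TangentSpace (𝓡 m) x →L[ℝ] TangentSpace (𝓡 m) x →L[ℝ] ℝ)
      ((extChartAt (𝓡 m) x₀).symm y) (g.inner ((extChartAt (𝓡 m) x₀).symm y))) y :=
    (g.contMDiff _).comp y (contMDiffAt_chart_symm hy)
  have h2 : ContMDiffAt (𝓡 m) ((𝓡 m).prod 𝓘(ℝ, ℝ)) ∞ (fun y : Euc m =>
      Bundle.TotalSpace.mk' ℝ (E := Bundle.Trivial M ℝ)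
      ((extChartAt (𝓡 m) x₀).symm y) (g.inner ((extChartAt (𝓡 m) x₀).symm y) (symmD x₀ y u) (symmD x₀ y v))) y := by
   apply ContMDiffAt.clm_bundle_apply₂ (F₁ := Euc m) (F₂ := Euc m) (F₃ := ℝ)
      (E₁ := fun x : M => TangentSpace (𝓡 m) x) (E₂ := fun x : M => TangentSpace (𝓡 m) x)
      (E₃ := Bundle.Trivial M ℝ)
   · exact h1
   · exact (contMDiffAt_symm_vector hy u)
   · exact (contMDiffAt_symm_vector hy v)
  simp only [Bundle.contMDiffAt_totalSpace] at h2
  exact h2.2.contDiffAt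

lemma isRiem_coeff (g : Metric m M) (x₀ : M) :
    IsRiem (coeff g x₀) (extChartAt (𝓡 m) x₀).target where
  isOpen := isOpen_chart_target x₀
  smooth y hy := by
    refine smooth_of_apply₂ fun u v => ?_
    exact smooth_coeff_apply g hy u v
  symm y _ u v := g.symm _ _ _
  pos y hy v hv := by
    have hne : symmD x₀ y v ≠ 0 := fun h => hv
      ((chartD_symmD hy v).symm.trans ((congrArg (chartD x₀ _) h).trans (map_zero _)))
    rw [coeff_apply]
    exact g.pos ((extChartAt (𝓡 m) x₀).symm y) _ hne

end Ambient

end MinimalHypersurface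
end

/-! ### Transition maps, and immersed hypersurfaces in charts -/

noncomputable section

namespace MinimalHypersurface

set_option synthInstance.maxHeartbeats 200000
set_option linter.unusedSectionVars false

section Ambient

variable {m : ℕ} {M : Type*} [TopologicalSpace M] [ChartedSpace (Euc m) M] [IsManifold (𝓡 m) ∞ M]
  {x₀ x₁ : M}

/-- The transition map between the preferred charts around `x₀` and `x₁`. -/
def transition (x₀ x₁ : M) (y : Euc m) : Euc m :=
  extChartAt (𝓡 m) x₁ ((extChartAt (𝓡 m) x₀).symm y)

/-- The domain of the transition map between the preferred charts around `x₀` and `x₁`. -/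
def transitionDom (x₀ x₁ : M) : Set (Euc m) :=
  (extChartAt (𝓡 m) x₀).target ∩ (extChartAt (𝓡 m) x₀).symm ⁻¹' (extChartAt (𝓡 m) x₁).source

lemma isOpen_transitionDom (x₀ x₁ : M) : IsOpen (transitionDom (m := m) x₀ x₁) :=
  (continuousOn_extChartAt_symm (I := 𝓡 m) x₀).isOpen_inter_preimage (isOpen_chart_target x₀)
    (isOpen_extChartAt_source x₁)

lemma transition_smooth {y : Euc m} (hy : y ∈ transitionDom x₀ x₁) :
    ContDiffAt ℝ ∞ (transition x₀ x₁) y :=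
  ContMDiffAt.contDiffAt (ContMDiffAt.comp y (contMDiffAt_chart hy.2) (contMDiffAt_chart_symm hy.1))

lemma fderiv_transition {y : Euc m} (hy : y ∈ transitionDom x₀ x₁) (u : Euc m) :
    fderiv ℝ (transition x₀ x₁) y u
      = chartD x₁ ((extChartAt (𝓡 m) x₀).symm y) (symmD x₀ y u) := by
  rw [← mfderiv_eq_fderiv]
  exact congrArg (fun A : Euc m →L[ℝ] Euc m => A u)
    (mfderiv_comp y (mdiff_chart (x₀ := x₁) hy.2) (mdiff_chart_symm hy.1))

lemma isLocalIsometry_transition (g : Metric m M) (x₀ x₁ : M) :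
    IsLocalIsometry (coeff g x₀) (transitionDom x₀ x₁) (coeff g x₁) (extChartAt (𝓡 m) x₁).target
      (transition x₀ x₁) where
  source := (isRiem_coeff g x₀).mono (isOpen_transitionDom x₀ x₁) inter_subset_left
  target := isRiem_coeff g x₁
  maps _ hy := (extChartAt (𝓡 m) x₁).map_source hy.2
  smooth _ hy := transition_smooth hy
  metric y hy u v := by
    rw [fderiv_transition hy, fderiv_transition hy]
    exact (coeff_chart g hy.2 _ _).symm

/-- In adapted charts the immersion is `y ↦ (y, 0)`, so a projection yields a local left inverse
`r`; differentiate `r ∘ f = id`. -/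
lemma mfderiv_injective_of_isImmersion {n k : ℕ} {S N : Type*} [TopologicalSpace S]
    [ChartedSpace (Euc n) S] [IsManifold (𝓡 n) ∞ S] [TopologicalSpace N] [ChartedSpace (Euc k) N]
    [IsManifold (𝓡 k) ∞ N] {f : S → N} (hf : IsImmersion (𝓡 n) (𝓡 k) ∞ f) (p : S) :
    Function.Injective (mfderiv (𝓡 n) (𝓡 k) f p) := by
  have h := hf.isImmersionAt p
  let r : N → S := fun q => h.domChart.symm (h.equiv.symm (h.codChart q)).1
  have hr' : ∀ y ∈ h.domChart.source, h.codChart (f y) = h.equiv (h.domChart y, 0) := by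
    intro y hy
    have hm : h.domChart y ∈ (h.domChart.extend (𝓡 n)).target := by
      simpa [OpenPartialHomeomorph.extend_target] using h.domChart.map_source hy
    have h1 := h.writtenInCharts hm
    simpa only [Function.comp, OpenPartialHomeomorph.extend_coe, modelWithCornersSelf_coe, id,
      OpenPartialHomeomorph.extend_coe_symm, modelWithCornersSelf_coe_symm,
      h.domChart.left_inv hy] using h1
  have hr : ∀ y ∈ h.domChart.source, r (f y) = y := by
    intro y hy
    simp [r, hr' y hy, h.domChart.left_inv hy]
  have hp := h.mem_domChart_source
  have e1 : MDifferentiableAt (𝓡 k) (𝓡 k) h.codChart (f p) :=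
    mdifferentiableAt_of_mem_maximalAtlas
      (IsManifold.maximalAtlas_subset_of_le (by simp) h.codChart_mem_maximalAtlas)
      h.mem_codChart_source
  have e2 : MDifferentiableAt (𝓡 n) (𝓡 n) h.domChart.symm (h.domChart p) :=
    mdifferentiableAt_symm_of_mem_maximalAtlas
      (IsManifold.maximalAtlas_subset_of_le (by simp) h.domChart_mem_maximalAtlas)
      (h.domChart.map_source hp)
  have e3 : MDifferentiableAt (𝓡 k) (𝓡 n) (fun z : Euc k => (h.equiv.symm z).1)
      (h.codChart (f p)) := by
    apply DifferentiableAt.mdifferentiableAt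
    exact (differentiable_fst.comp h.equiv.symm.differentiable).differentiableAt
  have hv : (h.equiv.symm (h.codChart (f p))).1 = h.domChart p := by
    simp [hr' p hp]
  have hrd : MDifferentiableAt (𝓡 k) (𝓡 n) r (f p) :=
    MDifferentiableAt.comp (f p) (g := h.domChart.symm) (hv ▸ e2) (e3.comp (f p) e1)
  have hfd : MDifferentiableAt (𝓡 n) (𝓡 k) f p := (hf.contMDiff p).mdifferentiableAt (by simp)
  have h2 := mfderiv_comp p hrd hfd
  have h3 : mfderiv (𝓡 n) (𝓡 n) (r ∘ f) p = mfderiv (𝓡 n) (𝓡 n) id p := by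
    apply Filter.EventuallyEq.mfderiv_eq
    filter_upwards [h.domChart.open_source.mem_nhds hp] with y hy using hr y hy
  intro u v huv
  have h4 : ∀ w : Euc n, mfderiv (𝓡 k) (𝓡 n) r (f p) (mfderiv (𝓡 n) (𝓡 k) f p w) = w := by
    intro w
    have := congrArg (fun A : Euc n →L[ℝ] Euc n => A w) (h2.symm.trans (h3.trans mfderiv_id))
    exact this
  exact (h4 u).symm.trans ((congrArg _ huv).trans (h4 v))

end Ambient

section Hypersurface

variable {n : ℕ} {M : Type*} [TopologicalSpace M] [ChartedSpace (Euc (n + 1)) M]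
  [IsManifold (𝓡 (n + 1)) ∞ M] {S : Type*} [TopologicalSpace S] [ChartedSpace (Euc n) S]
  [IsManifold (𝓡 n) ∞ S] {ι : S → M} {p q : S} {y : Euc n}

/-- The domain of `mapInChart ι p`. -/
def chartDom (ι : S → M) (p : S) : Set (Euc n) :=
  (extChartAt (𝓡 n) p).target ∩
    (extChartAt (𝓡 n) p).symm ⁻¹' (ι ⁻¹' (extChartAt (𝓡 (n + 1)) (ι p)).source)

lemma isOpen_chartDom (hι : Continuous ι) (p : S) : IsOpen (chartDom (n := n) ι p) :=
  (continuousOn_extChartAt_symm (I := 𝓡 n) p).isOpen_inter_preimage (isOpen_chart_target p)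
    ((isOpen_extChartAt_source (ι p)).preimage hι)

lemma mem_chartDom {q : S} (hq : q ∈ (extChartAt (𝓡 n) p).source)
    (hι : ι q ∈ (extChartAt (𝓡 (n + 1)) (ι p)).source) :
    extChartAt (𝓡 n) p q ∈ chartDom ι p :=
  ⟨(extChartAt (𝓡 n) p).map_source hq, by
    rwa [mem_preimage, (extChartAt (𝓡 n) p).left_inv hq]⟩

lemma mem_chartDom_self (ι : S → M) (p : S) : extChartAt (𝓡 n) p p ∈ chartDom ι p :=
  mem_chartDom (mem_extChartAt_source p) (mem_extChartAt_source (ι p))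

lemma mapInChart_smooth (hι : ContMDiff (𝓡 n) (𝓡 (n + 1)) ∞ ι) (hy : y ∈ chartDom ι p) :
    ContDiffAt ℝ ∞ (mapInChart ι p) y :=
  ContMDiffAt.contDiffAt (ContMDiffAt.comp y (contMDiffAt_chart hy.2)
    ((hι _).comp y (contMDiffAt_chart_symm hy.1)))

lemma mapInChart_mem (hy : y ∈ chartDom ι p) :
    mapInChart ι p y ∈ (extChartAt (𝓡 (n + 1)) (ι p)).target :=
  (extChartAt (𝓡 (n + 1)) (ι p)).map_source hy.2

lemma fderiv_mapInChart (hι : ContMDiff (𝓡 n) (𝓡 (n + 1)) ∞ ι) (hy : y ∈ chartDom ι p)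
    (u : Euc n) : fderiv ℝ (mapInChart ι p) y u
      = chartD (ι p) (ι ((extChartAt (𝓡 n) p).symm y))
        (mfderiv (𝓡 n) (𝓡 (n + 1)) ι ((extChartAt (𝓡 n) p).symm y) (symmD p y u)) := by
  rw [← mfderiv_eq_fderiv]
  have h1 : MDifferentiableAt (𝓡 n) (𝓡 (n + 1)) ι ((extChartAt (𝓡 n) p).symm y) :=
    (hι _).mdifferentiableAt (by simp)
  have h2 := mfderiv_comp y (mdiff_chart (x₀ := ι p) hy.2) (h1.comp y (mdiff_chart_symm hy.1))
  rw [mfderiv_comp y h1 (mdiff_chart_symm hy.1)] at h2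
  exact congrArg (fun A : Euc n →L[ℝ] Euc (n + 1) => A u) h2

lemma fderiv_mapInChart_injective (hι : IsImmersion (𝓡 n) (𝓡 (n + 1)) ∞ ι)
    (hy : y ∈ chartDom ι p) : Function.Injective (fderiv ℝ (mapInChart ι p) y) := by
  intro u v huv
  rw [fderiv_mapInChart hι.contMDiff hy, fderiv_mapInChart hι.contMDiff hy] at huv
  have h1 := mfderiv_injective_of_isImmersion hι _ (chartD_injective hy.2 huv)
  exact (chartD_symmD hy.1 u).symm.trans ((congrArg _ h1).trans (chartD_symmD hy.1 v))

lemma fieldInChart_eq (X : (p : S) → TangentSpace (𝓡 (n + 1)) (ι p)) (p : S) (y : Euc n) :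
    fieldInChart ι X p y = chartD (ι p) (ι ((extChartAt (𝓡 n) p).symm y))
      (X ((extChartAt (𝓡 n) p).symm y)) := rfl

lemma fieldInChart_smooth {X : (p : S) → TangentSpace (𝓡 (n + 1)) (ι p)}
    (hX : ContMDiff (𝓡 n) (𝓡 (n + 1)).tangent ∞
      (fun p => (⟨ι p, X p⟩ : TangentBundle (𝓡 (n + 1)) M)))
    (hy : y ∈ chartDom ι p) : ContDiffAt ℝ ∞ (fieldInChart ι X p) y := by
  have ho := isOpen_extChartAt_source (I := 𝓡 (n + 1)) (ι p)
  have h1 := (contMDiffOn_extChartAt (I := 𝓡 (n + 1)) (n := ∞)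
    (x := ι p)).contMDiffOn_tangentMapWithin (m := ∞) (by simp)
    (by rw [← extChartAt_source (𝓡 (n + 1))]; exact ho.uniqueMDiffOn)
  rw [← extChartAt_source (𝓡 (n + 1))] at h1
  have h2 : ContMDiffAt (𝓡 n) (𝓡 (n + 1)).tangent ∞ (fun z : Euc n =>
      (⟨ι ((extChartAt (𝓡 n) p).symm z), X ((extChartAt (𝓡 n) p).symm z)⟩ :
        TangentBundle (𝓡 (n + 1)) M)) y :=
    (hX _).comp y (contMDiffAt_chart_symm hy.1)
  have h3 := (h1.contMDiffAt (x := (⟨ι ((extChartAt (𝓡 n) p).symm y),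
    X ((extChartAt (𝓡 n) p).symm y)⟩ : TangentBundle (𝓡 (n + 1)) M))
    ((ho.preimage (FiberBundle.continuous_proj _ _)).mem_nhds hy.2)).comp y h2
  have h4 := ((contMDiff_snd_tangentBundle_modelSpace (Euc (n + 1)) (𝓡 (n + 1))
    (n := ∞)).contMDiffAt).comp y h3
  refine (ContMDiffAt.contDiffAt h4).congr_of_eventuallyEq ?_
  have hι : Continuous ι :=
    (FiberBundle.continuous_proj (Euc (n + 1)) (TangentSpace (𝓡 (n + 1)))).comp hX.continuous
  filter_upwards [(isOpen_chartDom hι p).mem_nhds hy] with z hz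
  simp only [Function.comp, tangentMapWithin, mfderivWithin_of_isOpen ho hz.2]
  rfl

lemma coeff_fieldInChart (g : Metric (n + 1) M) (hι : ContMDiff (𝓡 n) (𝓡 (n + 1)) ∞ ι)
    (X : (p : S) → TangentSpace (𝓡 (n + 1)) (ι p)) (hy : y ∈ chartDom ι p) (u : Euc n) :
    coeff g (ι p) (mapInChart ι p y) (fieldInChart ι X p y) (fderiv ℝ (mapInChart ι p) y u)
      = g.inner (ι ((extChartAt (𝓡 n) p).symm y)) (X ((extChartAt (𝓡 n) p).symm y))
        (mfderiv (𝓡 n) (𝓡 (n + 1)) ι ((extChartAt (𝓡 n) p).symm y) (symmD p y u)) := by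
  rw [fderiv_mapInChart hι hy, fieldInChart_eq]
  exact coeff_chart g hy.2 _ _

end Hypersurface

end MinimalHypersurface
end

/-! ### Local unit normals and the Jacobi operator in an arbitrary chart -/

noncomputable section

namespace MinimalHypersurface

set_option synthInstance.maxHeartbeats 200000
set_option linter.unusedSectionVars false

variable {n : ℕ}

/-- A unit normal field exists locally. -/
lemma exists_hypData {G : BilinField (n + 1)} {U : Set (Euc (n + 1))} {F : Euc n → Euc (n + 1)}
    {V : Set (Euc n)} (hG : IsRiem G U) (hV : IsOpen V) (hF : MapsTo F V U)
    (hs : ∀ y ∈ V, ContDiffAt ℝ ∞ F y) (hi : ∀ y ∈ V, Function.Injective (fderiv ℝ F y))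
    {y₀ : Euc n} (hy₀ : y₀ ∈ V) :
    ∃ V₀ N, y₀ ∈ V₀ ∧ V₀ ⊆ V ∧ HypData G U F V₀ N := by
  have hγ := isRiem_inducedMetric hG hV hF hs hi
  obtain ⟨w₀, hw₀⟩ : ∃ w₀, w₀ ∉ LinearMap.range (fderiv ℝ F y₀ : Euc n →ₗ[ℝ] Euc (n + 1)) := by
    by_contra hcon
    push Not at hcon
    have h1 : LinearMap.range (fderiv ℝ F y₀ : Euc n →ₗ[ℝ] Euc (n + 1)) = ⊤ :=
      eq_top_iff.2 fun w _ => hcon w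
    have h2 := LinearMap.finrank_range_add_finrank_ker (fderiv ℝ F y₀ : Euc n →ₗ[ℝ] Euc (n + 1))
    rw [h1, finrank_top] at h2
    simp only [finrank_euclideanSpace_fin] at h2
    omega
  -- The normal part of a fixed vector that is not tangent at `y₀` is nonzero near `y₀`, and is then
  -- normalised.
  let ν : Euc n → Euc (n + 1) := fun y => normalPart G F y w₀
  have hνs : ∀ y ∈ V, ContDiffAt ℝ ∞ ν y := by
    intro y hy
    have h1 : ContDiffAt ℝ ∞ (fun y => (G (F y) w₀).comp (fderiv ℝ F y)) y :=
      (((hG.smooth _ (hF hy)).comp y (hs y hy)).clm_apply contDiffAt_const).clm_comp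
        (smooth_fderiv (hs y hy))
    exact contDiffAt_const.sub ((smooth_fderiv (hs y hy)).clm_apply
      ((hγ.inverse_smooth hy).clm_apply h1))
  have hνn : ∀ y ∈ V, ∀ u, G (F y) (ν y) (fderiv ℝ F y u) = 0 := by
    intro y hy u
    have := hγ.inverse_apply hy ((G (F y) w₀).comp (fderiv ℝ F y)) u
    rw [inducedMetric_apply] at this
    simp [ν, normalPart, this]
  have hν0 : ν y₀ ≠ 0 := by
    intro h
    apply hw₀
    exact ⟨_, (sub_eq_zero.1 h).symm⟩
  let q : Euc n → ℝ := fun y => G (F y) (ν y) (ν y)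
  have hqs : ∀ y ∈ V, ContDiffAt ℝ ∞ q y := fun y hy =>
    (((hG.smooth _ (hF hy)).comp y (hs y hy)).clm_apply (hνs y hy)).clm_apply (hνs y hy)
  let V₀ := V ∩ q ⁻¹' Ioi 0
  have hV₀ : IsOpen V₀ :=
    ContinuousOn.isOpen_inter_preimage
      (fun y hy => (hqs y hy).continuousAt.continuousWithinAt) hV isOpen_Ioi
  refine ⟨V₀, fun y => (√(q y))⁻¹ • ν y, ⟨hy₀, hG.pos _ (hF hy₀) _ hν0⟩, inter_subset_left, ?_⟩
  refine ⟨hG, hV₀, fun y hy => hF hy.1, fun y hy => hs y hy.1, fun y hy => hi y hy.1, ?_, ?_⟩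
  · intro y hy
    have hq : 0 < q y := hy.2
    exact (((hqs y hy.1).sqrt hq.ne').inv (Real.sqrt_pos.2 hq).ne').smul (hνs y hy.1)
  · intro y hy
    have hq : 0 < q y := hy.2
    refine ⟨?_, fun u => by simp [hνn y hy.1 u]⟩
    have h2 : √(q y) ≠ 0 := (Real.sqrt_pos.2 hq).ne'
    have h3 : √(q y) * √(q y) = q y := Real.mul_self_sqrt hq.le
    simp only [map_smul, smul_apply, smul_eq_mul]
    change (√(q y))⁻¹ * ((√(q y))⁻¹ * q y) = 1
    have h4 : (√(q y))⁻¹ * ((√(q y))⁻¹ * (√(q y) * √(q y))) = 1 := by field_simp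
    rwa [h3] at h4

variable {M : Type*} [TopologicalSpace M] [ChartedSpace (Euc (n + 1)) M]
  [IsManifold (𝓡 (n + 1)) ∞ M] {S : Type*} [TopologicalSpace S] [ChartedSpace (Euc n) S]
  [IsManifold (𝓡 n) ∞ S] {ι : S → M} {p q : S} {y : Euc n} {g : Metric (n + 1) M}

/-- `V` is a piece of the preferred chart around `p` with a unit normal field `N`. -/
structure IsHypChart (g : Metric (n + 1) M) (ι : S → M) (p : S) (V : Set (Euc n))
    (N : Euc n → Euc (n + 1)) : Prop where
  imm : IsImmersion (𝓡 n) (𝓡 (n + 1)) ∞ ι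
  subset : V ⊆ chartDom ι p
  hyp : HypData (coeff g (ι p)) (extChartAt (𝓡 (n + 1)) (ι p)).target (mapInChart ι p) V N

lemma exists_isHypChart (g : Metric (n + 1) M) (hι : IsImmersion (𝓡 n) (𝓡 (n + 1)) ∞ ι)
    {y₀ : Euc n} (hy₀ : y₀ ∈ chartDom ι p) : ∃ V N, y₀ ∈ V ∧ IsHypChart g ι p V N := by
  obtain ⟨V, N, h1, h2, h3⟩ := exists_hypData (isRiem_coeff g (ι p))
    (isOpen_chartDom hι.contMDiff.continuous p) (fun _ hy => mapInChart_mem hy)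
    (fun y hy => mapInChart_smooth hι.contMDiff hy)
    (fun y hy => fderiv_mapInChart_injective hι hy) hy₀
  exact ⟨V, N, h1, hι, h2, h3⟩

/-- The coefficient of a normal field with respect to a unit normal field. -/
def normalCoeff (g : Metric (n + 1) M) (ι : S → M) (p : S) (N : Euc n → Euc (n + 1))
    (X : (p : S) → TangentSpace (𝓡 (n + 1)) (ι p)) (y : Euc n) : ℝ :=
  coeff g (ι p) (mapInChart ι p y) (N y) (fieldInChart ι X p y)

section

variable {V : Set (Euc n)} {N : Euc n → Euc (n + 1)}
  {X : (p : S) → TangentSpace (𝓡 (n + 1)) (ι p)}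

lemma IsHypChart.fieldInChart_eq (h : IsHypChart g ι p V N) (hX : IsNormalField g ι X)
    (hy : y ∈ V) : fieldInChart ι X p y = normalCoeff g ι p N X y • N y :=
  h.hyp.eq_smul_of_normal hy fun u => by
    rw [coeff_fieldInChart g h.imm.contMDiff X (h.subset hy)]
    exact hX.2 _ _

lemma IsHypChart.normalCoeff_smooth (h : IsHypChart g ι p V N) (hX : IsNormalField g ι X)
    (hy : y ∈ V) : ContDiffAt ℝ ∞ (normalCoeff g ι p N X) y :=
  (((h.hyp.riem.smooth _ (h.hyp.maps hy)).comp y (h.hyp.smooth y hy)).clm_apply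
    (h.hyp.smoothN y hy)).clm_apply (fieldInChart_smooth hX.1 (h.subset hy))

lemma chartD_inverse {m : ℕ} {M : Type*} [TopologicalSpace M] [ChartedSpace (Euc m) M]
    [IsManifold (𝓡 m) ∞ M] {x₀ x : M} (hx : x ∈ (extChartAt (𝓡 m) x₀).source) (v : Euc m) :
    (chartD x₀ x).inverse v = symmD x₀ (extChartAt (𝓡 m) x₀ x) v := by
  have h : (chartD x₀ x).IsInvertible := isInvertible_mfderiv_extChartAt hx
  obtain ⟨e, he⟩ := h
  rw [← he, ContinuousLinearMap.inverse_equiv]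
  have h2 := symmD_chartD hx (e.symm v)
  rw [← he] at h2
  simpa using h2.symm

/-- The Jacobi operator in an arbitrary chart. -/
lemma IsHypChart.chartD_jacobiOperator (h : IsHypChart g ι p V N) (hX : IsNormalField g ι X)
    (hy : y ∈ V) :
    chartD (ι p) (ι ((extChartAt (𝓡 n) p).symm y))
        (jacobiOperator g ι X ((extChartAt (𝓡 n) p).symm y))
      = (lap (inducedMetric (coeff g (ι p)) (mapInChart ι p)) (normalCoeff g ι p N X) y
        + pot (coeff g (ι p)) (mapInChart ι p) N y * normalCoeff g ι p N X y) • N y := by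
  set q : S := (extChartAt (𝓡 n) p).symm y with hq
  have hy' := h.subset hy
  have hqp : q ∈ (extChartAt (𝓡 n) p).source := (extChartAt (𝓡 n) p).map_target hy'.1
  have hyq : extChartAt (𝓡 n) p q = y := (extChartAt (𝓡 n) p).right_inv hy'.1
  have hι := h.imm.contMDiff
  -- At `q` the operator is computed in the charts preferred at `q`. The set `V'` is where the
  -- transitions from these charts to those at `p` are defined and land in `V`, so that the
  -- invariance under a change of charts applies.
  let V' : Set (Euc n) := (chartDom ι q ∩ transitionDom q p) ∩ transition q p ⁻¹' V
  have hV'o : IsOpen V' := by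
    refine ContinuousOn.isOpen_inter_preimage (fun z hz => ?_)
      ((isOpen_chartDom hι.continuous q).inter (isOpen_transitionDom q p)) h.hyp.isOpen
    exact (transition_smooth hz.2).continuousAt.continuousWithinAt
  have hsy : ∀ z ∈ V', (extChartAt (𝓡 n) p).symm (transition q p z)
      = (extChartAt (𝓡 n) q).symm z := fun z hz =>
    (extChartAt (𝓡 n) p).left_inv hz.1.2.2
  have hmaps : MapsTo (mapInChart ι q) V' (transitionDom (ι q) (ι p)) := by
    intro z hz
    refine ⟨mapInChart_mem hz.1.1, ?_⟩
    have h1 := (h.subset hz.2).2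
    rw [mem_preimage, hsy z hz] at h1
    rw [mem_preimage]
    unfold mapInChart
    rwa [(extChartAt (𝓡 (n + 1)) (ι q)).left_inv hz.1.1.2]
  have hc : IsChartChange (mapInChart ι q) V' (mapInChart ι p) V (transition q p)
      (transition (ι q) (ι p)) := by
    refine ⟨hV'o, fun z hz => mapInChart_smooth hι hz.1.1,
      fun z hz => fderiv_mapInChart_injective h.imm hz.1.1, fun z hz => hz.2,
      fun z hz => transition_smooth hz.1.2, fun z hz => ?_⟩
    unfold mapInChart
    rw [hsy z hz, transition, (extChartAt (𝓡 (n + 1)) (ι q)).left_inv hz.1.1.2]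
  have hD : ∀ z ∈ V', ∀ v, fderiv ℝ (transition (ι q) (ι p)) (mapInChart ι q z)
      (chartD (ι q) (ι ((extChartAt (𝓡 n) q).symm z)) v)
        = chartD (ι p) (ι ((extChartAt (𝓡 n) q).symm z)) v := by
    intro z hz v
    rw [fderiv_transition (hmaps hz)]
    unfold mapInChart
    rw [symmD_chartD hz.1.1.2, (extChartAt (𝓡 (n + 1)) (ι q)).left_inv hz.1.1.2]
  have hyq' : extChartAt (𝓡 n) q q ∈ V' := by
    refine ⟨⟨mem_chartDom_self ι q, mem_extChartAt_target q, ?_⟩, ?_⟩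
    · rwa [mem_preimage, (extChartAt (𝓡 n) q).left_inv (mem_extChartAt_source q)]
    · rwa [mem_preimage, transition, (extChartAt (𝓡 n) q).left_inv (mem_extChartAt_source q), hyq]
  have key := h.hyp.jacobiInChart_pullback hc (isLocalIsometry_transition g (ι q) (ι p)) hmaps hyq'
    (X' := fieldInChart ι X q) (f := normalCoeff g ι p N X) (fun z hz => by
      have h0 : ∀ s s' : S, s = s' → chartD (ι p) (ι s) (X s) = chartD (ι p) (ι s') (X s') := by
        rintro s _ rfl; rfl
      exact (hD z hz _).trans ((h0 _ _ (hsy z hz).symm).trans (h.fieldInChart_eq hX hz.2))) (fun z hz => h.normalCoeff_smooth hX hz)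
  have hψ : transition q p (extChartAt (𝓡 n) q q) = y := by
    rw [transition, (extChartAt (𝓡 n) q).left_inv (mem_extChartAt_source q), hyq]
  have hFq : mapInChart ι q (extChartAt (𝓡 n) q q) = extChartAt (𝓡 (n + 1)) (ι q) (ι q) := by
    unfold mapInChart
    rw [(extChartAt (𝓡 n) q).left_inv (mem_extChartAt_source q)]
  rw [hψ] at key
  rw [← key, fderiv_transition (hmaps hyq'), hFq,
    (extChartAt (𝓡 (n + 1)) (ι q)).left_inv (mem_extChartAt_source (ι q))]
  congr 1
  exact chartD_inverse (mem_extChartAt_source (ι q)) _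

end

end MinimalHypersurface
end

/-! ### Riemannian distance and lengths of curves -/

noncomputable section

namespace MinimalHypersurface

set_option synthInstance.maxHeartbeats 200000
set_option linter.unusedSectionVars false

open MeasureTheory
open scoped ENNReal

section Distance

open scoped Bundle

variable {m : ℕ} {M : Type*} [TopologicalSpace M] [ChartedSpace (Euc m) M] [IsManifold (𝓡 m) ∞ M]

/-- The Riemannian distance of the metric `g`. -/
def edistOf (g : Metric m M) (x y : M) : ℝ≥0∞ :=
  letI : Bundle.RiemannianBundle (fun x : M => TangentSpace (𝓡 m) x) := ⟨g.toRiemannianMetric⟩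
  riemannianEDist (𝓡 m) x y

lemma distToSet_eq (g : Metric m M) (A : Set M) (x : M) :
    distToSet g A x = (⨅ y ∈ A, edistOf g x y).toReal := rfl

/-- The speed of a curve. -/
def speed (g : Metric m M) (γ : ℝ → M) (s : ℝ) : ℝ :=
  let v : TangentSpace (𝓡 m) (γ s) := mfderiv 𝓘(ℝ, ℝ) (𝓡 m) γ s (1 : ℝ)
  √(g.inner (γ s) v v)

lemma edistOf_triangle (g : Metric m M) (x y z : M) :
    edistOf g x z ≤ edistOf g x y + edistOf g y z := by
  let _ : Bundle.RiemannianBundle (fun x : M => TangentSpace (𝓡 m) x) := ⟨g.toRiemannianMetric⟩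
  exact riemannianEDist_triangle

lemma edistOf_comm (g : Metric m M) (x y : M) : edistOf g x y = edistOf g y x := by
  let _ : Bundle.RiemannianBundle (fun x : M => TangentSpace (𝓡 m) x) := ⟨g.toRiemannianMetric⟩
  exact riemannianEDist_comm

lemma eventually_edistOf_lt (g : Metric m M) (x : M) {c : ℝ≥0∞} (hc : 0 < c) :
    ∀ᶠ y in 𝓝 x, edistOf g x y < c := by
  let _ : Bundle.RiemannianBundle (fun x : M => TangentSpace (𝓡 m) x) := ⟨g.toRiemannianMetric⟩
  have : IsManifold (𝓡 m) 1 M := .of_le (n := ∞) (by simp)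
  have : IsContinuousRiemannianBundle (Euc m) (fun x : M => TangentSpace (𝓡 m) x) :=
    ⟨g.inner, g.contMDiff.continuous, fun _ _ _ => rfl⟩
  exact eventually_riemannianEDist_lt (𝓡 m) x hc

lemma exists_edistOf_lt_subset [RegularSpace M] (g : Metric m M) {x : M} {s : Set M}
    (hs : s ∈ 𝓝 x) : ∃ c > (0 : ℝ≥0∞), {y | edistOf g x y < c} ⊆ s := by
  let _ : Bundle.RiemannianBundle (fun x : M => TangentSpace (𝓡 m) x) := ⟨g.toRiemannianMetric⟩
  have : IsManifold (𝓡 m) 1 M := .of_le (n := ∞) (by simp)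
  have : IsContinuousRiemannianBundle (Euc m) (fun x : M => TangentSpace (𝓡 m) x) :=
    ⟨g.inner, g.contMDiff.continuous, fun _ _ _ => rfl⟩
  exact setOfPred_riemannianEDist_lt_subset_nhds' (𝓡 m) hs

lemma enorm_eq_speed (g : Metric m M) (γ : ℝ → M) (s : ℝ) :
    letI : Bundle.RiemannianBundle (fun x : M => TangentSpace (𝓡 m) x) := ⟨g.toRiemannianMetric⟩
    ‖mfderiv 𝓘(ℝ, ℝ) (𝓡 m) γ s (1 : ℝ)‖ₑ = ENNReal.ofReal (speed g γ s) := by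
  let _ : Bundle.RiemannianBundle (fun x : M => TangentSpace (𝓡 m) x) := ⟨g.toRiemannianMetric⟩
  rw [← ofReal_norm, norm_eq_sqrt_real_inner]
  rfl

lemma edistOf_le_lintegral (g : Metric m M) {γ : ℝ → M}
    (hγ : ContMDiffOn 𝓘(ℝ, ℝ) (𝓡 m) 1 γ (Icc 0 1)) :
    edistOf g (γ 0) (γ 1) ≤ ∫⁻ s in Icc (0 : ℝ) 1, ENNReal.ofReal (speed g γ s) := by
  let _ : Bundle.RiemannianBundle (fun x : M => TangentSpace (𝓡 m) x) := ⟨g.toRiemannianMetric⟩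
  have h := riemannianEDist_le_pathELength (I := 𝓡 m) hγ rfl rfl zero_le_one
  rw [pathELength_eq_lintegral_mfderiv_Icc] at h
  refine h.trans_eq ?_
  exact lintegral_congr fun s => enorm_eq_speed g γ s

/-- The last clause holds because an initial piece of a path is no longer than the path; it confines
the path to a small ball. -/
lemma exists_path_of_edistOf_lt (g : Metric m M) {x y : M} {r : ℝ≥0∞} (h : edistOf g x y < r) :
    ∃ γ : ℝ → M, γ 0 = x ∧ γ 1 = y ∧ ContMDiff 𝓘(ℝ, ℝ) (𝓡 m) 1 γ ∧
      (∫⁻ s in Icc (0 : ℝ) 1, ENNReal.ofReal (speed g γ s)) < r ∧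
      ∀ s ∈ Icc (0 : ℝ) 1, edistOf g x (γ s) < r := by
  let _ : Bundle.RiemannianBundle (fun x : M => TangentSpace (𝓡 m) x) := ⟨g.toRiemannianMetric⟩
  obtain ⟨γ, h0, h1, hγ, hl, -⟩ := exists_lt_locally_constant_of_riemannianEDist_lt h zero_lt_one
  refine ⟨γ, h0, h1, hγ, ?_, fun s hs => ?_⟩
  · rw [pathELength_eq_lintegral_mfderiv_Icc] at hl
    refine lt_of_eq_of_lt (lintegral_congr fun s => ?_) hl
    exact (enorm_eq_speed g γ s).symm
  · refine lt_of_le_of_lt ?_ hl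
    refine (riemannianEDist_le_pathELength (I := 𝓡 m) (a := 0) (b := s) hγ.contMDiffOn h0 rfl
      hs.1).trans ?_
    exact pathELength_mono le_rfl hs.2

end Distance

/-- Cauchy-Schwarz for a unit covector. -/
lemma IsRiem.abs_apply_le {m : ℕ} {G : BilinField m} {U : Set (Euc m)} (hG : IsRiem G U)
    {x : Euc m} (hx : x ∈ U) {ξ : Euc m →L[ℝ] ℝ} (hξ : ξ ((G x).inverse ξ) = 1) (w : Euc m) :
    |ξ w| ≤ √(G x w w) := by
  set v := (G x).inverse ξ with hv
  have h1 : ∀ w, G x v w = ξ w := fun w => hG.inverse_apply hx ξ w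
  have hnn : ∀ w, 0 ≤ G x w w := by
    intro w
    by_cases hw : w = 0
    · simp [hw]
    · exact (hG.pos x hx w hw).le
  -- Cauchy-Schwarz: `v` is the unit vector dual to `ξ`, and the component of `w` orthogonal to `v`
  -- has nonnegative square.
  have h2 := hnn (w - ξ w • v)
  simp only [map_sub, map_smul, sub_apply, smul_apply, h1, hξ, smul_eq_mul,
    hG.symm x hx w v] at h2
  apply Real.abs_le_sqrt
  nlinarith

end MinimalHypersurface
end

/-! ### The distance to the hypersurface is `|t|` -/

noncomputable section

namespace MinimalHypersurface

set_option synthInstance.maxHeartbeats 200000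
set_option linter.unusedSectionVars false

open MeasureTheory
open scoped ENNReal

section Curves

variable {m : ℕ} {M : Type*} [TopologicalSpace M] [ChartedSpace (Euc m) M] [IsManifold (𝓡 m) ∞ M]
  {x₀ : M}

lemma deriv_chart_comp {γ : ℝ → M} {s : ℝ} (hγ : MDifferentiableAt 𝓘(ℝ, ℝ) (𝓡 m) γ s)
    (hs : γ s ∈ (extChartAt (𝓡 m) x₀).source) :
    deriv (fun r => extChartAt (𝓡 m) x₀ (γ r)) s
      = chartD x₀ (γ s) (mfderiv 𝓘(ℝ, ℝ) (𝓡 m) γ s (1 : ℝ)) := by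
  change fderiv ℝ (fun r => extChartAt (𝓡 m) x₀ (γ r)) s 1 = _
  rw [← mfderiv_eq_fderiv]
  exact congrArg (fun A : ℝ →L[ℝ] Euc m => A 1) (mfderiv_comp s (mdiff_chart hs) hγ)

lemma speed_eq_of_mem (g : Metric m M) {γ : ℝ → M} {s : ℝ}
    (hγ : MDifferentiableAt 𝓘(ℝ, ℝ) (𝓡 m) γ s) (hs : γ s ∈ (extChartAt (𝓡 m) x₀).source) :
    speed g γ s = √(coeff g x₀ (extChartAt (𝓡 m) x₀ (γ s))
      (deriv (fun r => extChartAt (𝓡 m) x₀ (γ r)) s)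
      (deriv (fun r => extChartAt (𝓡 m) x₀ (γ r)) s)) := by
  rw [deriv_chart_comp hγ hs]
  exact congrArg Real.sqrt (coeff_chart g hs _ _).symm

lemma speed_symm_comp (g : Metric m M) {c : ℝ → Euc m} {s : ℝ} (hc : DifferentiableAt ℝ c s)
    (hs : c s ∈ (extChartAt (𝓡 m) x₀).target) :
    speed g (fun r => (extChartAt (𝓡 m) x₀).symm (c r)) s
      = √(coeff g x₀ (c s) (deriv c s) (deriv c s)) := by
  have h1 : (mfderiv 𝓘(ℝ, ℝ) (𝓡 m) (fun r => (extChartAt (𝓡 m) x₀).symm (c r)) s (1 : ℝ) : Euc m)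
      = symmD x₀ (c s) (deriv c s) := by
    have h2 := mfderiv_comp s (mdiff_chart_symm hs) hc.mdifferentiableAt
    change _ = symmD x₀ (c s) (fderiv ℝ c s 1)
    rw [← mfderiv_eq_fderiv]
    exact congrArg (fun A : ℝ →L[ℝ] Euc m => A 1) h2
  rw [coeff_apply, ← h1]
  rfl

end Curves

variable {n : ℕ} {M : Type*} [TopologicalSpace M] [ChartedSpace (Euc (n + 1)) M]
  [IsManifold (𝓡 (n + 1)) ∞ M] {S : Type*} [TopologicalSpace S] [ChartedSpace (Euc n) S]
  [IsManifold (𝓡 n) ∞ S] {ι : S → M} {p q : S} {y : Euc n} {g : Metric (n + 1) M}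
  {V V₀ : Set (Euc n)} {N : Euc n → Euc (n + 1)} {W : Set (Euc (n + 1))} {t : Euc (n + 1) → ℝ}

/-- The normal geodesic from the hypersurface to `x` has constant speed `|t|` on a unit interval. -/
lemma iInf_edistOf_le (h : IsHypChart g ι p V N)
    (ht : IsEikonal (coeff g (ι p)) (extChartAt (𝓡 (n + 1)) (ι p)).target (mapInChart ι p) V V₀ W t)
    {x : M} (hx : x ∈ (extChartAt (𝓡 (n + 1)) (ι p)).source)
    (hxW : extChartAt (𝓡 (n + 1)) (ι p) x ∈ W) :
    ⨅ y ∈ range ι, edistOf g x y ≤ ENNReal.ofReal |t (extChartAt (𝓡 (n + 1)) (ι p) x)| := by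
  set φ := extChartAt (𝓡 (n + 1)) (ι p) with hφ
  obtain ⟨c, ⟨y, hyV, hy0⟩, hc1, hc⟩ := ht.curve _ hxW
  have h0 : φ.symm (c 0) = ι ((extChartAt (𝓡 n) p).symm y) := by
    rw [← hy0]; exact φ.left_inv (h.subset hyV).2
  have h1 : φ.symm (c 1) = x := by rw [hc1]; exact φ.left_inv hx
  have hγ : ContMDiffOn 𝓘(ℝ, ℝ) (𝓡 (n + 1)) 1 (fun s => φ.symm (c s)) (Icc 0 1) := by
    intro s hs
    exact (((contMDiffAt_chart_symm (hc s hs).1).comp s (hc s hs).2.1.contMDiffAt).of_le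
      (by simp)).contMDiffWithinAt
  have h2 := edistOf_le_lintegral g hγ
  rw [h0, h1] at h2
  refine (iInf₂_le _ (mem_range_self ((extChartAt (𝓡 n) p).symm y))).trans ?_
  rw [edistOf_comm]
  refine h2.trans ?_
  have h3 : ∫⁻ s in Icc (0 : ℝ) 1, ENNReal.ofReal (speed g (fun s => φ.symm (c s)) s)
      = ∫⁻ _ in Icc (0 : ℝ) 1, ENNReal.ofReal |t (φ x)| := by
    refine setLIntegral_congr_fun measurableSet_Icc fun s hs => ?_
    rw [speed_symm_comp g (smooth_differentiableAt (hc s hs).2.1) (hc s hs).1, (hc s hs).2.2,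
      Real.sqrt_sq_eq_abs]
  rw [h3]
  simp

/-- By the eikonal equation `t` changes along a path by at most its length. A path from `x` to the
hypersurface shorter than `|t|` would stay in the domain of `t` and end where `t = 0`, a
contradiction. -/
lemma le_iInf_edistOf [RegularSpace M] (h : IsHypChart g ι p V N) (hι : IsEmbedding ι)
    (ht : IsEikonal (coeff g (ι p)) (extChartAt (𝓡 (n + 1)) (ι p)).target (mapInChart ι p) V V₀ W t)
    (hp : extChartAt (𝓡 n) p p ∈ V₀) :
    ∀ᶠ x in 𝓝 (ι p), ENNReal.ofReal |t (extChartAt (𝓡 (n + 1)) (ι p) x)|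
      ≤ ⨅ y ∈ range ι, edistOf g x y := by
  set φ := extChartAt (𝓡 (n + 1)) (ι p) with hφ
  have hps := mem_extChartAt_source (I := 𝓡 (n + 1)) (ι p)
  have hFp : mapInChart ι p (extChartAt (𝓡 n) p p) = φ (ι p) := by
    unfold mapInChart
    rw [(extChartAt (𝓡 n) p).left_inv (mem_extChartAt_source p)]
  have hcont : ContinuousAt φ (ι p) := continuousAt_extChartAt (ι p)
  have hpW : φ (ι p) ∈ W := hFp ▸ ht.maps hp
  have ht0 : t (φ (ι p)) = 0 := hFp ▸ ht.zero _ hp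
  have hV₀S : (extChartAt (𝓡 n) p).source ∩ extChartAt (𝓡 n) p ⁻¹' V₀ ∈ 𝓝 p :=
    inter_mem (extChartAt_source_mem_nhds p)
      ((continuousAt_extChartAt p).preimage_mem_nhds (ht.isOpen₀.mem_nhds hp))
  -- Here it matters that `ι` is a topological embedding: points of the image near `ι p` have
  -- parameters in `V₀`, so no other sheet comes close.
  rw [hι.nhds_eq_comap, mem_comap] at hV₀S
  obtain ⟨O, hO, hOV⟩ := hV₀S
  have hs : φ.source ∩ φ ⁻¹' W ∩ O ∈ 𝓝 (ι p) :=
    inter_mem (inter_mem (extChartAt_source_mem_nhds (ι p))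
      (hcont.preimage_mem_nhds (ht.isOpen.mem_nhds hpW))) hO
  obtain ⟨c, hc0, hc⟩ := exists_edistOf_lt_subset g hs
  -- One `r` bounds the distance from `ι p` to `x` and the other the length of the path, so the path
  -- stays in the ball of radius `c`.
  obtain ⟨r, hr0, hrc⟩ : ∃ r : ℝ≥0∞, 0 < r ∧ r + r ≤ c := by
    refine ⟨c / 2, ENNReal.half_pos hc0.ne', (ENNReal.add_halves c).le⟩
  have hcontt : ContinuousAt (fun x => ENNReal.ofReal |t (φ x)|) (ι p) := by
    refine ENNReal.continuous_ofReal.continuousAt.comp ?_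
    exact (ContinuousAt.comp (g := t) (ht.smooth _ hpW).continuousAt hcont).abs
  have htr : ∀ᶠ x in 𝓝 (ι p), ENNReal.ofReal |t (φ x)| < r := by
    apply hcontt.eventually_lt continuousAt_const
    simpa [ht0] using hr0
  filter_upwards [htr, eventually_edistOf_lt g (ι p) hr0] with x hx1 hx2
  by_contra hcon
  push Not at hcon
  simp only [iInf_lt_iff] at hcon
  obtain ⟨_, ⟨q, rfl⟩, hq⟩ := hcon
  obtain ⟨γ, h0, h1, hγ, hl, hγr⟩ := exists_path_of_edistOf_lt g hq
  have hmem : ∀ s ∈ Icc (0 : ℝ) 1, γ s ∈ φ.source ∩ φ ⁻¹' W ∩ O := by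
    intro s hs
    apply hc
    calc edistOf g (ι p) (γ s) ≤ edistOf g (ι p) x + edistOf g x (γ s) := edistOf_triangle _ _ _ _
      _ < r + r := ENNReal.add_lt_add hx2 ((hγr s hs).trans hx1)
      _ ≤ c := hrc
  have hqV := hOV (show ι q ∈ O from h1 ▸ (hmem 1 (by simp)).2)
  have hq0 : t (φ (γ 1)) = 0 := by
    have h3 := ht.zero _ hqV.2
    unfold mapInChart at h3
    rw [(extChartAt (𝓡 n) p).left_inv hqV.1] at h3
    rw [h1]; exact h3
  have hsm : ∀ s ∈ Icc (0 : ℝ) 1, ContDiffAt ℝ 1 (fun s => φ (γ s)) s := fun s hs =>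
    ContMDiffAt.contDiffAt (((contMDiffAt_chart (hmem s hs).1.1).of_le (by simp)).comp s
      hγ.contMDiffAt)
  have hu : ContDiffOn ℝ 1 (fun s => t (φ (γ s))) (Icc 0 1) := fun s hs =>
    (ContDiffAt.comp (g := t) s ((ht.smooth _ (hmem s hs).1.2).of_le (by simp))
      (hsm s hs)).contDiffWithinAt
  have h4 := enorm_sub_le_lintegral_deriv_of_contDiffOn_Icc hu zero_le_one
  rw [hq0, h0, zero_sub, enorm_neg, Real.enorm_eq_ofReal_abs] at h4
  refine absurd (h4.trans ?_) (not_le.2 hl)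
  refine setLIntegral_mono' measurableSet_Icc fun s hs => ?_
  have hd : HasDerivAt (fun s => t (φ (γ s)))
      (fderiv ℝ t (φ (γ s)) (deriv (fun r => φ (γ r)) s)) s :=
    HasFDerivAt.comp_hasDerivAt (l := t) s
      (smooth_differentiableAt (ht.smooth _ (hmem s hs).1.2)).hasFDerivAt
      ((hsm s hs).differentiableAt (by simp)).hasDerivAt
  rw [hd.deriv, Real.enorm_eq_ofReal_abs,
    speed_eq_of_mem g (hγ.contMDiffAt.mdifferentiableAt (by simp)) (hmem s hs).1.1]
  exact ENNReal.ofReal_le_ofReal (h.hyp.riem.abs_apply_le (ht.subset (hmem s hs).1.2)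
    (ht.eikonal _ (hmem s hs).1.2) _)

lemma IsHypChart.eventually_distToSet_eq [RegularSpace M] (h : IsHypChart g ι p V N)
    (hι : IsEmbedding ι)
    (ht : IsEikonal (coeff g (ι p)) (extChartAt (𝓡 (n + 1)) (ι p)).target (mapInChart ι p) V V₀ W t)
    (hp : extChartAt (𝓡 n) p p ∈ V₀) :
    ∀ᶠ x in 𝓝 (ι p), extChartAt (𝓡 (n + 1)) (ι p) x ∈ W ∧
      distToSet g (range ι) x = |t (extChartAt (𝓡 (n + 1)) (ι p) x)| := by
  have hFp : mapInChart ι p (extChartAt (𝓡 n) p p) = extChartAt (𝓡 (n + 1)) (ι p) (ι p) := by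
    unfold mapInChart
    rw [(extChartAt (𝓡 n) p).left_inv (mem_extChartAt_source p)]
  have hpW : extChartAt (𝓡 (n + 1)) (ι p) (ι p) ∈ W := hFp ▸ ht.maps hp
  filter_upwards [le_iInf_edistOf h hι ht hp, extChartAt_source_mem_nhds (I := 𝓡 (n + 1)) (ι p),
    (continuousAt_extChartAt (I := 𝓡 (n + 1)) (ι p)).preimage_mem_nhds (ht.isOpen.mem_nhds hpW)]
    with x h1 h2 h3
  refine ⟨h3, ?_⟩
  rw [distToSet_eq, le_antisymm (iInf_edistOf_le h ht h2 h3) h1,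
    ENNReal.toReal_ofReal (abs_nonneg _)]

end MinimalHypersurface
end

/-! ### The squared distance: Hessian on the hypersurface, and smooth extension -/

noncomputable section

namespace MinimalHypersurface

set_option synthInstance.maxHeartbeats 200000
set_option linter.unusedSectionVars false

section Chart

variable {n : ℕ} {G : BilinField (n + 1)} {U W : Set (Euc (n + 1))} {F N : Euc n → Euc (n + 1)}
  {V V₀ : Set (Euc n)} {t : Euc (n + 1) → ℝ} {y : Euc n}

/-- As `t` vanishes along `F`, its gradient is a unit normal, that is `± N`; the sign cancels in the
product. -/
lemma IsEikonal.fderiv_mul_fderiv (ht : IsEikonal G U F V V₀ W t) (h : HypData G U F V N)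
    (hy : y ∈ V₀) (u v : Euc (n + 1)) :
    fderiv ℝ t (F y) u * fderiv ℝ t (F y) v = G (F y) (N y) u * G (F y) (N y) v := by
  have hyV := ht.subset₀ hy
  have hU := h.maps hyV
  set w := (G (F y)).inverse (fderiv ℝ t (F y)) with hw
  have h1 : ∀ z, G (F y) w z = fderiv ℝ t (F y) z := fun z => h.riem.inverse_apply hU _ z
  have h2 : ∀ u, G (F y) w (fderiv ℝ F y u) = 0 := by
    intro u
    have e1 : HasFDerivAt (fun z => t (F z)) ((fderiv ℝ t (F y)).comp (fderiv ℝ F y)) y :=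
      HasFDerivAt.comp (g := t) y (smooth_differentiableAt (ht.smooth _ (ht.maps hy))).hasFDerivAt
        (smooth_differentiableAt (h.smooth y hyV)).hasFDerivAt
    have e2 : (fun z => t (F z)) =ᶠ[𝓝 y] fun _ => 0 := by
      filter_upwards [ht.isOpen₀.mem_nhds hy] with z hz using ht.zero z hz
    have e3 := e2.fderiv_eq (𝕜 := ℝ)
    rw [e1.fderiv, fderiv_fun_const] at e3
    rw [h1]
    exact congrArg (fun A : Euc n →L[ℝ] ℝ => A u) e3
  have h3 := h.eq_smul_of_normal hyV h2
  set s := G (F y) (N y) w with hs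
  have h4 : s * s = 1 := by
    have e1 := ht.eikonal _ (ht.maps hy)
    rw [← hw, ← h1, h3] at e1
    simpa [(h.unit y hyV).1] using e1
  have h5 : ∀ z, fderiv ℝ t (F y) z = s * G (F y) (N y) z := by
    intro z
    rw [← h1, h3]
    simp
  rw [h5, h5]
  linear_combination (G (F y) (N y) u * G (F y) (N y) v) * h4

/-- The Hessian of `t²` is `2 dt ⊗ dt + 2 t D²t`, and the second term vanishes on `F`. -/
lemma IsEikonal.hessian_sq (ht : IsEikonal G U F V V₀ W t) (h : HypData G U F V N)
    (hy : y ∈ V₀) (u v : Euc (n + 1)) :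
    fderiv ℝ (fderiv ℝ fun x => t x ^ 2) (F y) u v
      = 2 * G (F y) (N y) u * G (F y) (N y) v := by
  have hW := ht.maps hy
  have e1 : fderiv ℝ (fun x => t x ^ 2) =ᶠ[𝓝 (F y)] fun x => (2 * t x) • fderiv ℝ t x := by
    filter_upwards [ht.isOpen.mem_nhds hW] with x hx
    rw [((smooth_differentiableAt (ht.smooth x hx)).hasFDerivAt.pow 2).fderiv]
    simp
  have hd := smooth_differentiableAt (ht.smooth _ hW)
  have hd2 := smooth_differentiableAt (smooth_fderiv (ht.smooth _ hW))
  rw [e1.fderiv_eq, fderiv_fun_smul (hd.const_mul 2) hd2, fderiv_const_mul hd]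
  have := ht.fderiv_mul_fderiv h hy u v
  simp only [ht.zero y hy, mul_zero, zero_smul, zero_add, ContinuousLinearMap.smulRight_apply,
    smul_apply, smul_eq_mul]
  linear_combination 2 * this

end Chart

variable {n : ℕ} {M : Type*} [TopologicalSpace M] [ChartedSpace (Euc (n + 1)) M]
  [IsManifold (𝓡 (n + 1)) ∞ M] {S : Type*} [TopologicalSpace S] [ChartedSpace (Euc n) S]
  [IsManifold (𝓡 n) ∞ S] {ι : S → M} {p q : S} {y : Euc n} {g : Metric (n + 1) M}
  {V V₀ : Set (Euc n)} {N : Euc n → Euc (n + 1)} {W : Set (Euc (n + 1))} {t : Euc (n + 1) → ℝ}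

lemma mapInChart_self (ι : S → M) (p : S) : mapInChart ι p (extChartAt (𝓡 n) p p)
    = extChartAt (𝓡 (n + 1)) (ι p) (ι p) := by
  unfold mapInChart
  rw [(extChartAt (𝓡 n) p).left_inv (mem_extChartAt_source p)]

open scoped Bundle in
lemma edistOf_self {m : ℕ} {M : Type*} [TopologicalSpace M] [ChartedSpace (Euc m) M]
    [IsManifold (𝓡 m) ∞ M] (g : Metric m M) (x : M) : edistOf g x x = 0 := by
  let _ : Bundle.RiemannianBundle (fun x : M => TangentSpace (𝓡 m) x) := ⟨g.toRiemannianMetric⟩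
  exact riemannianEDist_self

lemma distToSet_of_mem {m : ℕ} {M : Type*} [TopologicalSpace M] [ChartedSpace (Euc m) M]
    [IsManifold (𝓡 m) ∞ M] (g : Metric m M) {A : Set M} {x : M} (hx : x ∈ A) :
    distToSet g A x = 0 := by
  rw [distToSet_eq]
  have : ⨅ y ∈ A, edistOf g x y = 0 :=
    le_antisymm ((iInf₂_le x hx).trans (edistOf_self g x).le) bot_le
  simp [this]

lemma exists_distance_chart [RegularSpace M] (g : Metric (n + 1) M)
    (hι : IsSmoothEmbedding (𝓡 n) (𝓡 (n + 1)) ∞ ι) (p : S) :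
    ∃ (V V₀ : Set (Euc n)) (N : Euc n → Euc (n + 1)) (W : Set (Euc (n + 1)))
      (t : Euc (n + 1) → ℝ), IsHypChart g ι p V N ∧ extChartAt (𝓡 n) p p ∈ V₀ ∧
      IsEikonal (coeff g (ι p)) (extChartAt (𝓡 (n + 1)) (ι p)).target (mapInChart ι p) V V₀ W t ∧
      ∀ᶠ x in 𝓝 (ι p), extChartAt (𝓡 (n + 1)) (ι p) x ∈ W ∧
        distToSet g (range ι) x = |t (extChartAt (𝓡 (n + 1)) (ι p) x)| := by
  obtain ⟨V, N, hp, h⟩ := exists_isHypChart g hι.isImmersion (mem_chartDom_self ι p)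
  obtain ⟨V₀, W, t, hp₀, ht⟩ := h.hyp.exists_eikonal hp
  exact ⟨V, V₀, N, W, t, h, hp₀, ht, h.eventually_distToSet_eq hι.isEmbedding ht hp₀⟩

/-- A smooth function which is the squared distance near the hypersurface. -/
lemma exists_sq_distToSet [T2Space M] [CompactSpace M] [CompactSpace S] (g : Metric (n + 1) M)
    (hι : IsSmoothEmbedding (𝓡 n) (𝓡 (n + 1)) ∞ ι) :
    ∃ h : M → ℝ, ContMDiff (𝓡 (n + 1)) 𝓘(ℝ, ℝ) ∞ h ∧
      (∀ᶠ x in 𝓝ˢ (range ι), h x = distToSet g (range ι) x ^ 2) ∧ ∀ x, 0 ≤ h x := by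
  have hloc : ∀ p : S, ∀ᶠ x in 𝓝 (ι p),
      ContMDiffAt (𝓡 (n + 1)) 𝓘(ℝ, ℝ) ∞ (fun x => distToSet g (range ι) x ^ 2) x := by
    intro p
    obtain ⟨V, V₀, N, W, t, h, hp₀, ht, hd⟩ := exists_distance_chart g hι p
    filter_upwards [eventually_eventually_nhds.2 hd,
      extChartAt_source_mem_nhds (I := 𝓡 (n + 1)) (ι p)] with x hx hxs
    have h1 : ContMDiffAt (𝓡 (n + 1)) 𝓘(ℝ, ℝ) ∞
        (fun x => t (extChartAt (𝓡 (n + 1)) (ι p) x) ^ 2) x := by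
      refine ContMDiffAt.comp (g := fun z => t z ^ 2) x (I' := 𝓡 (n + 1)) ?_ (contMDiffAt_chart hxs)
      exact ((ht.smooth _ hx.self_of_nhds.1).pow 2).contMDiffAt
    refine h1.congr_of_eventuallyEq ?_
    filter_upwards [hx] with z hz
    rw [hz.2, sq_abs]
  have hS : ∀ᶠ x in 𝓝ˢ (range ι),
      ContMDiffAt (𝓡 (n + 1)) 𝓘(ℝ, ℝ) ∞ (fun x => distToSet g (range ι) x ^ 2) x := by
    rw [eventually_nhdsSet_iff_forall]
    rintro _ ⟨p, rfl⟩
    exact hloc p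
  obtain ⟨O, hO, hSO, hsm⟩ := eventually_nhdsSet_iff_exists.1 hS
  have hcl : IsClosed (range ι) := (isCompact_range hι.isEmbedding.continuous).isClosed
  obtain ⟨O', hO', hSO', hcO'⟩ := normal_exists_closure_subset hcl hO hSO
  obtain ⟨χ, hχ1, hχ0, hχ⟩ := exists_contMDiffMap_one_nhds_of_subset_interior (𝓡 (n + 1))
    (n := (⊤ : ℕ∞)) hcl (t := O') (by rwa [hO'.interior_eq])
  -- The squared distance is known to be smooth only on `O`. The cut-off is nonnegative, so the
  -- product stays nonnegative, which later makes the points of the hypersurface critical.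
  refine ⟨fun x => χ x * distToSet g (range ι) x ^ 2, fun x => ?_, ?_, fun x =>
    mul_nonneg (hχ x).1 (sq_nonneg _)⟩
  · by_cases hx : x ∈ O
    · exact (χ.contMDiff x).mul (hsm x hx)
    · have : (fun x => χ x * distToSet g (range ι) x ^ 2) =ᶠ[𝓝 x] fun _ => 0 := by
        have hx' : (closure O')ᶜ ∈ 𝓝 x :=
          isClosed_closure.isOpen_compl.mem_nhds fun h => hx (hcO' h)
        filter_upwards [hx'] with z hz
        rw [hχ0 z fun h => hz (subset_closure h), zero_mul]
      exact contMDiffAt_const.congr_of_eventuallyEq this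
  · filter_upwards [hχ1] with x hx
    rw [hx, one_mul]

/-- The Hessian of the squared distance along the hypersurface. -/
lemma hessian_sq_distToSet [RegularSpace M] (hι : IsSmoothEmbedding (𝓡 n) (𝓡 (n + 1)) ∞ ι)
    {h : M → ℝ} (hh : ∀ᶠ x in 𝓝ˢ (range ι), h x = distToSet g (range ι) x ^ 2) (p : S) :
    ∃ (V : Set (Euc n)) (N : Euc n → Euc (n + 1)), extChartAt (𝓡 n) p p ∈ V ∧
      IsHypChart g ι p V N ∧ ∀ u v,
      fderiv ℝ (fderiv ℝ fun x => h ((extChartAt (𝓡 (n + 1)) (ι p)).symm x))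
        (mapInChart ι p (extChartAt (𝓡 n) p p)) u v
      = 2 * coeff g (ι p) (mapInChart ι p (extChartAt (𝓡 n) p p)) (N (extChartAt (𝓡 n) p p)) u
        * coeff g (ι p) (mapInChart ι p (extChartAt (𝓡 n) p p)) (N (extChartAt (𝓡 n) p p)) v := by
  obtain ⟨V, V₀, N, W, t, hc, hp₀, ht, hd⟩ := exists_distance_chart g hι p
  refine ⟨V, N, ht.subset₀ hp₀, hc, fun u v => ?_⟩
  rw [← ht.hessian_sq hc.hyp hp₀]
  have h1 : ∀ᶠ x in 𝓝 (ι p), h x = t (extChartAt (𝓡 (n + 1)) (ι p) x) ^ 2 := by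
    filter_upwards [hd, (eventually_nhdsSet_iff_forall.1 hh) _ (mem_range_self p)] with x h2 h3
    rw [h3, h2.2, sq_abs]
  have h2 : (fun x => h ((extChartAt (𝓡 (n + 1)) (ι p)).symm x))
      =ᶠ[𝓝 (mapInChart ι p (extChartAt (𝓡 n) p p))] fun x => t x ^ 2 := by
    rw [mapInChart_self]
    have h3 := (continuousAt_extChartAt_symm (I := 𝓡 (n + 1)) (ι p)).eventually
      (p := fun x => h x = t (extChartAt (𝓡 (n + 1)) (ι p) x) ^ 2)
      (by rwa [(extChartAt (𝓡 (n + 1)) (ι p)).left_inv (mem_extChartAt_source (ι p))])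
    filter_upwards [h3, (isOpen_chart_target (ι p)).mem_nhds (mem_extChartAt_target (ι p))]
      with x hx hxt
    rw [hx, (extChartAt (𝓡 (n + 1)) (ι p)).right_inv hxt]
  rw [h2.fderiv.fderiv_eq]

end MinimalHypersurface
end

/-! ### Conformal metrics on the manifold and their smooth convergence -/

noncomputable section

namespace MinimalHypersurface

set_option synthInstance.maxHeartbeats 200000
set_option linter.unusedSectionVars false

/-- The partial iterated derivatives of a smooth family of functions are jointly continuous. -/
lemma continuousOn_iteratedFDeriv_param {m : ℕ} {T : Set (Euc m)} (hT : IsOpen T) (k : ℕ) :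
    ∀ {F : Type} [NormedAddCommGroup F] [NormedSpace ℝ F] {A : ℝ × Euc m → F},
      (∀ z : ℝ × Euc m, z.2 ∈ T → ContDiffAt ℝ ∞ A z) →
      ContinuousOn (fun z : ℝ × Euc m => iteratedFDeriv ℝ k (fun y => A (z.1, y)) z.2)
        (univ ×ˢ T) := by
  induction k with
  | zero =>
    intro F _ _ A hA
    have : (fun z : ℝ × Euc m => iteratedFDeriv ℝ 0 (fun y => A (z.1, y)) z.2)
        = fun z => (continuousMultilinearCurryFin0 ℝ (Euc m) F).symm (A z) := by
      funext z
      rw [iteratedFDeriv_zero_eq_comp]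
      rfl
    rw [this]
    exact (continuousMultilinearCurryFin0 ℝ (Euc m) F).symm.continuous.comp_continuousOn
      fun z hz => (hA z hz.2).continuousAt.continuousWithinAt
  | succ k ih =>
    intro F _ _ A hA
    let B : ℝ × Euc m → Euc m →L[ℝ] F := fun z => (fderiv ℝ A z).comp (.inr ℝ ℝ (Euc m))
    have hB : ∀ z : ℝ × Euc m, z.2 ∈ T → ContDiffAt ℝ ∞ B z := fun z hz =>
      (smooth_fderiv (hA z hz)).clm_comp contDiffAt_const
    have hAB : ∀ z : ℝ × Euc m, z.2 ∈ T →
        fderiv ℝ (fun y => A (z.1, y)) z.2 = B z := by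
      intro z hz
      have h1 : HasFDerivAt (fun y : Euc m => (z.1, y)) (.inr ℝ ℝ (Euc m)) z.2 :=
        hasFDerivAt_prodMk_right _ _
      exact (HasFDerivAt.comp (g := A) z.2
        (smooth_differentiableAt (hA z hz)).hasFDerivAt h1).fderiv
    have h2 : EqOn (fun z : ℝ × Euc m => iteratedFDeriv ℝ (k + 1) (fun y => A (z.1, y)) z.2)
        (fun z => (continuousMultilinearCurryRightEquiv' ℝ k (Euc m) F).symm
          (iteratedFDeriv ℝ k (fun y => B (z.1, y)) z.2)) (univ ×ˢ T) := by
      intro z hz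
      have h3 : fderiv ℝ (fun y => A (z.1, y)) =ᶠ[𝓝 z.2] fun y => B (z.1, y) := by
        filter_upwards [hT.mem_nhds hz.2] with y hy using hAB (z.1, y) hy
      simp only [iteratedFDeriv_succ_eq_comp_right, Function.comp]
      rw [(h3.iteratedFDeriv ℝ k).eq_of_nhds]
    refine ContinuousOn.congr ?_ h2
    exact (continuousMultilinearCurryRightEquiv' ℝ k (Euc m) F).symm.continuous.comp_continuousOn
      (ih hB)

variable {m : ℕ} {M : Type*} [TopologicalSpace M] [ChartedSpace (Euc m) M] [IsManifold (𝓡 m) ∞ M]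

/-- The conformal metric `exp (2 u) g`. -/
def conformalMetric (g : Metric m M) (u : M → ℝ) (hu : ContMDiff (𝓡 m) 𝓘(ℝ, ℝ) ∞ u) :
    Metric m M where
  inner x := Real.exp (2 * u x) • g.inner x
  symm x v w := by
    change Real.exp (2 * u x) * g.inner x v w = Real.exp (2 * u x) * g.inner x w v
    rw [g.symm]
  pos x v hv := mul_pos (Real.exp_pos _) (g.pos x v hv)
  -- The unit ball of `exp(2u) g` is `exp(-u)` times that of `g`.
  isVonNBounded x := by
    have h := (g.isVonNBounded x).image
      (Real.exp (-u x) • ContinuousLinearMap.id ℝ (TangentSpace (𝓡 m) x))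
    refine h.subset fun v hv => ?_
    have hv' : Real.exp (2 * u x) * g.inner x v v < 1 := hv
    refine ⟨Real.exp (u x) • v, ?_, ?_⟩
    · change g.inner x (Real.exp (u x) • v) (Real.exp (u x) • v) < 1
      have : g.inner x (Real.exp (u x) • v) (Real.exp (u x) • v)
          = Real.exp (2 * u x) * g.inner x v v := by
        rw [map_smul, map_smul, smul_apply, smul_eq_mul, smul_eq_mul,
          ← mul_assoc, ← Real.exp_add, two_mul]
      rwa [this]
    · change Real.exp (-u x) • (Real.exp (u x) • v) = v
      rw [smul_smul, ← Real.exp_add, neg_add_cancel, Real.exp_zero, one_smul]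
  contMDiff := by
    have h1 : ContMDiff (𝓡 m) 𝓘(ℝ, ℝ) ∞ fun x => Real.exp (2 * u x) :=
      (Real.contDiff_exp.comp (contDiff_const.mul contDiff_id)).contMDiff.comp hu
    exact ContMDiff.smul_section h1 g.contMDiff

lemma isConformal_coeff (g : Metric m M) {u : M → ℝ} (hu : ContMDiff (𝓡 m) 𝓘(ℝ, ℝ) ∞ u) (x₀ : M) :
    IsConformal (coeff (conformalMetric g u hu) x₀) (coeff g x₀) (extChartAt (𝓡 m) x₀).target
      (fun y => u ((extChartAt (𝓡 m) x₀).symm y)) where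
  riem := isRiem_coeff g x₀
  smooth y hy := ContMDiffAt.contDiffAt ((hu _).comp y (contMDiffAt_chart_symm hy))
  metric _ _ _ _ := rfl

/-- The metrics are the members `s = 1/i` of a family smooth in `(s, y)`. Its `y`-derivatives are
jointly continuous, so they converge uniformly on compact sets as `s → 0`. -/
lemma tendstoSmoothly_conformalMetric (g : Metric m M) {h : M → ℝ}
    (hh : ContMDiff (𝓡 m) 𝓘(ℝ, ℝ) ∞ h)
    (hi : ∀ i : ℕ, ContMDiff (𝓡 m) 𝓘(ℝ, ℝ) ∞ fun x => h x / (i : ℝ)) :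
    TendstoSmoothly (fun i : ℕ => conformalMetric g (fun x => h x / (i : ℝ)) (hi i)) g := by
  intro x₀ k K hK hKT
  set φ := extChartAt (𝓡 m) x₀ with hφ
  let A : ℝ × Euc m → Euc m →L[ℝ] Euc m →L[ℝ] ℝ := fun z =>
    Real.exp (2 * (h (φ.symm z.2) * z.1)) • coeff g x₀ z.2
  have hA : ∀ z : ℝ × Euc m, z.2 ∈ φ.target → ContDiffAt ℝ ∞ A z := by
    intro z hz
    have h1 : ContDiffAt ℝ ∞ (fun y => h (φ.symm y)) z.2 :=
      ContMDiffAt.contDiffAt ((hh _).comp z.2 (contMDiffAt_chart_symm hz))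
    have h2 : ContDiffAt ℝ ∞ (fun z : ℝ × Euc m => h (φ.symm z.2)) z :=
      ContDiffAt.comp (g := fun y => h (φ.symm y)) z h1 contDiffAt_snd
    have h3 : ContDiffAt ℝ ∞ (fun z : ℝ × Euc m => coeff g x₀ z.2) z :=
      ContDiffAt.comp (g := coeff g x₀) z ((isRiem_coeff g x₀).smooth _ hz) contDiffAt_snd
    exact (contDiffAt_const.mul (h2.mul contDiffAt_fst)).exp.smul h3
  have hc := continuousOn_iteratedFDeriv_param (isOpen_chart_target x₀) k hA
  have e0 : coeff g x₀ = fun y => A (0, y) := by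
    funext y; simp [A]
  have ei : ∀ i : ℕ, coeff (conformalMetric g (fun x => h x / (i : ℝ)) (hi i)) x₀
      = fun y => A ((i : ℝ)⁻¹, y) := fun i => rfl
  simp only [e0, ei]
  rw [Metric.tendstoUniformlyOn_iff]
  intro ε hε
  obtain ⟨v, hv, hvK⟩ := hK.mem_uniformity_of_prod (s := univ) (q := (0 : ℝ))
    (f := fun s y => iteratedFDeriv ℝ k (fun y => A (s, y)) y)
    (hc.mono (prod_mono le_rfl hKT)) (mem_univ _) (Metric.dist_mem_uniformity hε)
  rw [nhdsWithin_univ] at hv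
  filter_upwards [tendsto_inv_atTop_nhds_zero_nat.eventually hv] with i hi x hx
  rw [dist_comm]
  exact hvK _ hi x hx

end MinimalHypersurface
end

/-! ### The deformation, granted a spectral gap -/

noncomputable section

namespace MinimalHypersurface

set_option synthInstance.maxHeartbeats 200000
set_option linter.unusedSectionVars false

variable {n : ℕ} {M : Type*} [TopologicalSpace M] [ChartedSpace (Euc (n + 1)) M]
  [IsManifold (𝓡 (n + 1)) ∞ M] {S : Type*} [TopologicalSpace S] [ChartedSpace (Euc n) S]
  [IsManifold (𝓡 n) ∞ S] {ι : S → M} {p q : S} {y : Euc n} {g : Metric (n + 1) M}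
  {V V₀ : Set (Euc n)} {N : Euc n → Euc (n + 1)} {u : M → ℝ} {c : ℝ}
  {X : (p : S) → TangentSpace (𝓡 (n + 1)) (ι p)}

/-- A nonnegative function has a minimum wherever it vanishes, so its differential is zero along the
hypersurface. -/
lemma isFlatConformal_coeff (hu : ContMDiff (𝓡 (n + 1)) 𝓘(ℝ, ℝ) ∞ u) (hu0 : ∀ q, u (ι q) = 0)
    (hun : ∀ x, 0 ≤ u x) (hV : V ⊆ chartDom ι p) :
    IsFlatConformal (coeff (conformalMetric g u hu) (ι p)) (coeff g (ι p))
      (extChartAt (𝓡 (n + 1)) (ι p)).target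
      (fun y => u ((extChartAt (𝓡 (n + 1)) (ι p)).symm y)) (mapInChart ι p) V := by
  have h0 : ∀ y ∈ V, u ((extChartAt (𝓡 (n + 1)) (ι p)).symm (mapInChart ι p y)) = 0 := by
    intro y hy
    unfold mapInChart
    rw [(extChartAt (𝓡 (n + 1)) (ι p)).left_inv (hV hy).2, hu0]
  refine ⟨isConformal_coeff g hu (ι p), h0, fun y hy => IsLocalMin.fderiv_eq_zero ?_⟩
  exact Eventually.of_forall fun x => (h0 y hy).trans_le (hun _)

lemma isMinimal_conformalMetric (hu : ContMDiff (𝓡 (n + 1)) 𝓘(ℝ, ℝ) ∞ u)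
    (hu0 : ∀ q, u (ι q) = 0) (hun : ∀ x, 0 ≤ u x) (hmin : IsMinimal g ι) :
    IsMinimal (conformalMetric g u hu) ι := fun p => by
  rw [(isFlatConformal_coeff hu hu0 hun le_rfl).meanCurvature_eq (mem_chartDom_self ι p)
    (mapInChart_mem (mem_chartDom_self ι p))]
  exact hmin p

lemma isNormalField_conformalMetric (hu : ContMDiff (𝓡 (n + 1)) 𝓘(ℝ, ℝ) ∞ u) :
    IsNormalField (conformalMetric g u hu) ι X ↔ IsNormalField g ι X := by
  refine and_congr_right fun _ => forall₂_congr fun p v => ?_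
  change Real.exp (2 * u (ι p)) * g.inner (ι p) (X p) (mfderiv (𝓡 n) (𝓡 (n + 1)) ι p v) = 0 ↔ _
  simp [(Real.exp_pos _).ne']

lemma chartD_jacobiOperator_self (g : Metric (n + 1) M)
    (X : (p : S) → TangentSpace (𝓡 (n + 1)) (ι p)) (p : S) :
    jacobiOperator g ι X p = symmD (ι p) (extChartAt (𝓡 (n + 1)) (ι p) (ι p))
      (jacobiInChart (coeff g (ι p)) (mapInChart ι p) (fieldInChart ι X p)
        (extChartAt (𝓡 n) p p)) :=
  chartD_inverse (mem_extChartAt_source (ι p)) _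

lemma symmD_fieldInChart (X : (p : S) → TangentSpace (𝓡 (n + 1)) (ι p)) (p : S) :
    symmD (ι p) (extChartAt (𝓡 (n + 1)) (ι p) (ι p))
      (fieldInChart ι X p (extChartAt (𝓡 n) p p)) = X p := by
  have h0 : ∀ s s' : S, s = s' → chartD (ι p) (ι s) (X s) = chartD (ι p) (ι s') (X s') := by
    rintro s _ rfl; rfl
  have h1 : fieldInChart ι X p (extChartAt (𝓡 n) p p) = chartD (ι p) (ι p) (X p) :=
    h0 _ _ ((extChartAt (𝓡 n) p).left_inv (mem_extChartAt_source p))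
  rw [h1]
  exact symmD_chartD (mem_extChartAt_source (ι p)) _

lemma jacobiOperator_conformalMetric (hu : ContMDiff (𝓡 (n + 1)) 𝓘(ℝ, ℝ) ∞ u)
    (hu0 : ∀ q, u (ι q) = 0) (hun : ∀ x, 0 ≤ u x)
    (hp : extChartAt (𝓡 n) p p ∈ V) (hV : IsHypChart g ι p V N)
    (hH : ∀ v w, fderiv ℝ (fderiv ℝ fun x => u ((extChartAt (𝓡 (n + 1)) (ι p)).symm x))
        (mapInChart ι p (extChartAt (𝓡 n) p p)) v w
      = c * coeff g (ι p) (mapInChart ι p (extChartAt (𝓡 n) p p)) (N (extChartAt (𝓡 n) p p)) v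
        * coeff g (ι p) (mapInChart ι p (extChartAt (𝓡 n) p p)) (N (extChartAt (𝓡 n) p p)) w)
    (X : (p : S) → TangentSpace (𝓡 (n + 1)) (ι p)) :
    jacobiOperator (conformalMetric g u hu) ι X p = jacobiOperator g ι X p - (n * c) • X p := by
  rw [chartD_jacobiOperator_self, chartD_jacobiOperator_self,
    (isFlatConformal_coeff hu hu0 hun hV.subset).jacobiInChart_eq hV.hyp hp hH, map_sub, map_smul,
    symmD_fieldInChart]
  rfl

lemma jacobiSpectrum_eq_image {g' : Metric (n + 1) M} {k : ℝ}
    (hN : ∀ X : (p : S) → TangentSpace (𝓡 (n + 1)) (ι p),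
      IsNormalField g' ι X ↔ IsNormalField g ι X)
    (hL : ∀ X : (p : S) → TangentSpace (𝓡 (n + 1)) (ι p), IsNormalField g ι X → ∀ p,
      jacobiOperator g' ι X p = jacobiOperator g ι X p - k • X p) :
    jacobiSpectrum g' ι = (fun c : ℝ => c + k) '' jacobiSpectrum g ι := by
  ext c
  constructor
  · rintro ⟨X, hX, h0, h⟩
    refine ⟨c - k, ⟨X, (hN X).1 hX, h0, fun p => ?_⟩, sub_add_cancel c k⟩
    rw [← h p, hL X ((hN X).1 hX) p]
    module
  · rintro ⟨c, ⟨X, hX, h0, h⟩, rfl⟩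
    refine ⟨X, (hN X).2 hX, h0, fun p => ?_⟩
    rw [hL X hX p, ← h p]
    module

/-- The theorem, given that small positive numbers are not eigenvalues. -/
theorem exists_conformal_deformation [T2Space M] [CompactSpace M] [CompactSpace S] (hn : 1 ≤ n)
    (g : Metric (n + 1) M) (hι : IsSmoothEmbedding (𝓡 n) (𝓡 (n + 1)) ∞ ι) (hmin : IsMinimal g ι)
    (hgap : ∃ ε > 0, ∀ s : ℝ, 0 < s → s < ε → ∀ X : (p : S) → TangentSpace (𝓡 (n + 1)) (ι p),
      IsNormalField g ι X → (∀ p, jacobiOperator g ι X p = s • X p) → ∀ p, X p = 0) :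
    ∃ (h : M → ℝ) (G : ℕ → Metric (n + 1) M),
      ContMDiff (𝓡 (n + 1)) 𝓘(ℝ, ℝ) ∞ h ∧
      (∀ᶠ x in 𝓝ˢ (range ι), h x = distToSet g (range ι) x ^ 2) ∧
      (∀ i : ℕ, 1 ≤ i → ∀ (x : M) (v w : TangentSpace (𝓡 (n + 1)) x),
        (G i).inner x v w = Real.exp (2 * h x / i) * g.inner x v w) ∧
      TendstoSmoothly G g ∧
      (∀ i : ℕ, 1 ≤ i →
        IsMinimal (G i) ι ∧
        (∀ X : (p : S) → TangentSpace (𝓡 (n + 1)) (ι p),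
          (IsNormalField (G i) ι X ↔ IsNormalField g ι X) ∧
          (IsNormalField g ι X → ∀ p,
            jacobiOperator (G i) ι X p = jacobiOperator g ι X p - (2 * n / i : ℝ) • X p)) ∧
        jacobiSpectrum (G i) ι = (fun c : ℝ => c + 2 * n / i) '' jacobiSpectrum g ι) ∧
      (∃ i₀ : ℕ, ∀ i : ℕ, i₀ ≤ i → IsNondegenerate (G i) ι) := by
  obtain ⟨h, hsm, hd, hnn⟩ := exists_sq_distToSet g hι
  -- For `i = 0` the quotient `h x / 0` is `0`, so that the sequence starts with `g` itself.
  have hi : ∀ i : ℕ, ContMDiff (𝓡 (n + 1)) 𝓘(ℝ, ℝ) ∞ fun x => h x / (i : ℝ) := fun i => by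
    simp only [div_eq_mul_inv]
    exact hsm.mul contMDiff_const
  have h0 : ∀ q, h (ι q) = 0 := fun q => by
    rw [(eventually_nhdsSet_iff_forall.1 hd _ (mem_range_self q)).self_of_nhds,
      distToSet_of_mem g (mem_range_self q)]
    simp
  have h0i : ∀ (i : ℕ) q, h (ι q) / (i : ℝ) = 0 := fun i q => by rw [h0, zero_div]
  have hnni : ∀ (i : ℕ) x, 0 ≤ h x / (i : ℝ) := fun i x => div_nonneg (hnn x) (Nat.cast_nonneg i)
  have hN : ∀ (i : ℕ) (X : (p : S) → TangentSpace (𝓡 (n + 1)) (ι p)),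
      IsNormalField (conformalMetric g (fun x => h x / (i : ℝ)) (hi i)) ι X
        ↔ IsNormalField g ι X := fun i X => isNormalField_conformalMetric (hi i)
  have hL : ∀ (i : ℕ) (X : (p : S) → TangentSpace (𝓡 (n + 1)) (ι p)) p,
      jacobiOperator (conformalMetric g (fun x => h x / (i : ℝ)) (hi i)) ι X p
        = jacobiOperator g ι X p - (2 * n / i : ℝ) • X p := by
    intro i X p
    obtain ⟨V, N, hp, hV, hH⟩ := hessian_sq_distToSet hι hd p
    -- The Hessian of `h` is `2 ν ⊗ ν`, so that of `h / i` has the coefficient `2 / i`.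
    rw [jacobiOperator_conformalMetric (c := 2 / i) (hi i) (h0i i) (hnni i) hp hV ?_ X]
    · congr 2; ring
    · intro v w
      have e1 : (fun x => h ((extChartAt (𝓡 (n + 1)) (ι p)).symm x) / (i : ℝ))
          = (i : ℝ)⁻¹ • fun x => h ((extChartAt (𝓡 (n + 1)) (ι p)).symm x) := by
        funext x; simp [div_eq_inv_mul]
      have e2 : fderiv ℝ ((i : ℝ)⁻¹ • fun x => h ((extChartAt (𝓡 (n + 1)) (ι p)).symm x))
          = (i : ℝ)⁻¹ • fderiv ℝ fun x => h ((extChartAt (𝓡 (n + 1)) (ι p)).symm x) := by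
        funext x; rw [fderiv_const_smul_field]
      rw [e1, e2, fderiv_const_smul_field]
      simp only [Pi.smul_apply, smul_apply, hH, smul_eq_mul]
      ring
  refine ⟨h, fun i => conformalMetric g (fun x => h x / (i : ℝ)) (hi i), hsm, hd, ?_,
    tendstoSmoothly_conformalMetric g hsm hi, fun i _ => ⟨?_, fun X => ⟨hN i X, fun _ => hL i X⟩,
      jacobiSpectrum_eq_image (hN i) fun X _ => hL i X⟩, ?_⟩
  · intro i _ x v w
    change Real.exp (2 * (h x / i)) * g.inner x v w = _
    rw [mul_div_assoc]
  · exact isMinimal_conformalMetric (hi i) (h0i i) (hnni i) hmin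
  · obtain ⟨ε, hε, hgap⟩ := hgap
    have hlim : Tendsto (fun i : ℕ => (2 * n / i : ℝ)) atTop (𝓝 0) :=
      tendsto_const_div_atTop_nhds_zero_nat _
    obtain ⟨i₀, hi₀⟩ := eventually_atTop.1 (hlim.eventually (gt_mem_nhds hε))
    -- The index `0` has to be excluded: there `2n / 0 = 0` is not positive. For `i ≥ 1` a Jacobi
    -- field of the new metric satisfies `L X = (2n/i) X` with `2n/i` inside the gap.
    refine ⟨max i₀ 1, fun i hii X hX hLX => ?_⟩
    have hi1 : 1 ≤ i := (le_max_right _ _).trans hii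
    refine hgap (2 * n / i) ?_ (hi₀ i ((le_max_left _ _).trans hii)) X ((hN i X).1 hX) fun p => ?_
    · have : (0 : ℝ) < n := by exact_mod_cast hn
      have : (0 : ℝ) < i := by exact_mod_cast hi1
      positivity
    · have := hLX p
      rw [hL i X p, sub_eq_zero] at this
      exact this

end MinimalHypersurface
end

/-! ### The volume density and the Laplacian in divergence form -/

noncomputable section

namespace MinimalHypersurface

set_option synthInstance.maxHeartbeats 200000
set_option linter.unusedSectionVars false

variable {m : ℕ}

/-- The determinant of the Gram matrix of a bilinear form. -/
def gramDet (B : Euc m →L[ℝ] Euc m →L[ℝ] ℝ) : ℝ :=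
  (Matrix.of fun a b : Fin m => B (stdVec a) (stdVec b)).det

/-- The density of the Riemannian volume. -/
def dens (B : Euc m →L[ℝ] Euc m →L[ℝ] ℝ) : ℝ := √(gramDet B)

lemma gramDet_smooth : ContDiff ℝ ∞ (gramDet (m := m)) := by
  unfold gramDet
  simp only [Matrix.det_apply', Matrix.of_apply]
  refine ContDiff.sum fun σ _ => contDiff_const.mul (contDiff_prod fun i _ => ?_)
  exact (contDiff_id.clm_apply contDiff_const).clm_apply contDiff_const

lemma gramDet_comp (B : Euc m →L[ℝ] Euc m →L[ℝ] ℝ) (A : Euc m →L[ℝ] Euc m) :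
    gramDet (B.bilinearComp A A) = A.det ^ 2 * gramDet B := by
  let b := (EuclideanSpace.basisFun (Fin m) ℝ).toBasis
  let T := LinearMap.toMatrix b b (A : Euc m →ₗ[ℝ] Euc m)
  have hT : T.det = A.det := LinearMap.det_toMatrix b _
  have hA : ∀ a, A (stdVec a) = ∑ c, T c a • stdVec c := by
    intro a
    conv_lhs => rw [← b.sum_repr (A (stdVec a))]
    refine Finset.sum_congr rfl fun c _ => ?_
    simp [T, LinearMap.toMatrix_apply, b, stdVec]
  have h : (Matrix.of fun a c : Fin m => (B.bilinearComp A A) (stdVec a) (stdVec c))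
      = T.transpose * (Matrix.of fun a c : Fin m => B (stdVec a) (stdVec c)) * T := by
    ext a c
    simp only [Matrix.of_apply, ContinuousLinearMap.bilinearComp_apply, hA, Matrix.mul_apply,
      Matrix.transpose_apply, map_sum, map_smul, sum_apply, smul_apply, smul_eq_mul,
      Finset.mul_sum, Finset.sum_mul]
    exact Finset.sum_congr rfl fun i _ => Finset.sum_congr rfl fun j _ => by ring
  rw [gramDet, h, Matrix.det_mul, Matrix.det_mul, Matrix.det_transpose, hT]
  unfold gramDet
  ring

lemma gramDet_pos {B : Euc m →L[ℝ] Euc m →L[ℝ] ℝ} (hs : ∀ v w, B v w = B w v)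
    (hp : ∀ v, v ≠ 0 → 0 < B v v) : 0 < gramDet B := by
  refine (Matrix.PosDef.of_dotProduct_mulVec_pos ?_ fun x hx => ?_).det_pos
  · ext a b
    simp [hs (stdVec a)]
  · have hv : ∑ a, x a • (stdVec a : Euc m) = WithLp.toLp 2 x := by
      ext a; simp [stdVec, Pi.single_apply]
    have h := hp (WithLp.toLp 2 x) (by simpa using hx)
    rw [← hv] at h
    simp only [map_sum, map_smul, sum_apply, smul_apply, smul_eq_mul] at h
    simp only [dotProduct, Matrix.mulVec, Matrix.of_apply, Pi.star_apply, star_trivial,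
      Finset.mul_sum]
    refine h.trans_eq ?_
    simp only [Finset.mul_sum]
    refine Finset.sum_congr rfl fun a _ => Finset.sum_congr rfl fun b _ => ?_
    rw [hs (stdVec b)]
    ring

lemma dens_comp (B : Euc m →L[ℝ] Euc m →L[ℝ] ℝ) (A : Euc m →L[ℝ] Euc m) :
    dens (B.bilinearComp A A) = |A.det| * dens B := by
  rw [dens, gramDet_comp, Real.sqrt_mul (sq_nonneg _), Real.sqrt_sq_eq_abs, dens]

/-- The determinant is a polynomial in `s` whose linear coefficient is the trace. -/
lemma hasDerivAt_det_one_add_smul (P : Euc m →L[ℝ] Euc m) :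
    HasDerivAt (fun s : ℝ => (ContinuousLinearMap.id ℝ (Euc m) + s • P).det)
      (LinearMap.trace ℝ (Euc m) P) 0 := by
  let b := (EuclideanSpace.basisFun (Fin m) ℝ).toBasis
  let T := LinearMap.toMatrix b b (P : Euc m →ₗ[ℝ] Euc m)
  have h : ∀ s : ℝ, (ContinuousLinearMap.id ℝ (Euc m) + s • P).det = 1 + T.trace * s
      + (1 + (Polynomial.X : Polynomial ℝ) • T.map Polynomial.C).det.divX.divX.eval s * s ^ 2 := by
    intro s
    rw [← Matrix.det_one_add_smul, ContinuousLinearMap.det, ← LinearMap.det_toMatrix b]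
    congr 1
    simp [T]
  rw [LinearMap.trace_eq_matrix_trace ℝ b, funext h]
  have h2 := ((((1 + (Polynomial.X : Polynomial ℝ) • T.map Polynomial.C).det.divX.divX.hasDerivAt
    (0 : ℝ)).mul ((hasDerivAt_id (0 : ℝ)).pow 2)).add
    (((hasDerivAt_id (0 : ℝ)).const_mul T.trace).const_add 1))
  refine (h2.congr_deriv ?_).congr_of_eventuallyEq (Eventually.of_forall fun s => ?_)
  · simp [T]
  · simp; ring

/-- The derivative of the Gram determinant. -/
lemma fderiv_gramDet (B : Euc m →L[ℝ] Euc m →L[ℝ] ℝ) (P : Euc m →L[ℝ] Euc m)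
    {H : Euc m →L[ℝ] Euc m →L[ℝ] ℝ} (hH : ∀ u v, H u v = B (P u) v + B u (P v)) :
    fderiv ℝ gramDet B H = 2 * LinearMap.trace ℝ (Euc m) P * gramDet B := by
  -- The quadratic term makes the curve exactly the pull-back of `B` by `1 + s P`, so that
  -- `gramDet_comp` applies.
  let c : ℝ → Euc m →L[ℝ] Euc m →L[ℝ] ℝ := fun s => B + s • H + s ^ 2 • B.bilinearComp P P
  have hc : HasDerivAt c H 0 := by
    have h := (((hasDerivAt_id (0 : ℝ)).smul_const H).const_add B).add
      (((hasDerivAt_id (0 : ℝ)).pow 2).smul_const (B.bilinearComp P P))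
    refine (h.congr_deriv ?_).congr_of_eventuallyEq (Eventually.of_forall fun s => ?_)
    · simp
    · simp [c]
  have hc' : ∀ s, c s = B.bilinearComp (ContinuousLinearMap.id ℝ (Euc m) + s • P)
      (ContinuousLinearMap.id ℝ (Euc m) + s • P) := by
    intro s
    refine ContinuousLinearMap.ext fun u => ContinuousLinearMap.ext fun v => ?_
    simp [c, hH]
    ring
  have h1 : HasDerivAt (fun s => gramDet (c s)) (fderiv ℝ gramDet (c 0) H) 0 :=
    HasFDerivAt.comp_hasDerivAt (l := gramDet) 0
      ((gramDet_smooth.differentiable (by simp)) (c 0)).hasFDerivAt hc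
  have h2 : HasDerivAt (fun s => gramDet (c s)) (2 * LinearMap.trace ℝ (Euc m) P * gramDet B) 0 := by
    simp only [hc', gramDet_comp]
    have := ((hasDerivAt_det_one_add_smul P).pow 2).mul_const (gramDet B)
    refine this.congr_deriv ?_
    simp [ContinuousLinearMap.det]
  have h0 : c 0 = B := by simp [c]
  rw [h0] at h1
  exact h1.unique h2

section Density

variable {γ : BilinField m} {V : Set (Euc m)} {y : Euc m}

lemma IsRiem.gramDet_pos (hγ : IsRiem γ V) (hy : y ∈ V) : 0 < gramDet (γ y) :=
  MinimalHypersurface.gramDet_pos (hγ.symm y hy) (hγ.pos y hy)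

lemma IsRiem.dens_pos (hγ : IsRiem γ V) (hy : y ∈ V) : 0 < dens (γ y) :=
  Real.sqrt_pos.2 (hγ.gramDet_pos hy)

lemma IsRiem.dens_smooth (hγ : IsRiem γ V) (hy : y ∈ V) :
    ContDiffAt ℝ ∞ (fun y => dens (γ y)) y :=
  (gramDet_smooth.contDiffAt.comp y (hγ.smooth y hy)).sqrt (hγ.gramDet_pos hy).ne'

/-- The logarithmic derivative of the volume density is the trace of the Christoffel symbols. -/
lemma IsRiem.fderiv_dens (hγ : IsRiem γ V) (hy : y ∈ V) (w : Euc m) :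
    fderiv ℝ (fun y => dens (γ y)) y w
      = LinearMap.trace ℝ (Euc m) (chris γ y w : Euc m →L[ℝ] Euc m) * dens (γ y) := by
  have h1 : HasFDerivAt (fun y => gramDet (γ y)) ((fderiv ℝ gramDet (γ y)).comp (fderiv ℝ γ y)) y :=
    HasFDerivAt.comp (g := gramDet) y
      ((gramDet_smooth.differentiable (by simp)) (γ y)).hasFDerivAt
      (hγ.differentiableAt hy).hasFDerivAt
  have h2 := h1.sqrt (hγ.gramDet_pos hy).ne'
  unfold dens
  -- Metric compatibility has the form required by `fderiv_gramDet`, with `P` the Christoffel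
  -- endomorphism in the direction `w`.
  rw [h2.fderiv, smul_apply, ContinuousLinearMap.comp_apply,
    fderiv_gramDet (γ y) (chris γ y w) (fun u v => by
      rw [hγ.christoffel_compat hy, chris_apply, chris_apply])]
  have h3 := Real.mul_self_sqrt (hγ.gramDet_pos hy).le
  have h4 : √(gramDet (γ y)) ≠ 0 := (Real.sqrt_pos.2 (hγ.gramDet_pos hy)).ne'
  rw [smul_eq_mul]
  nth_rewrite 2 [← h3]
  field_simp

/-- The gradient of a function. -/
def grad (γ : BilinField m) (f : Euc m → ℝ) (y : Euc m) : Euc m := (γ y).inverse (fderiv ℝ f y)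

lemma IsRiem.grad_smooth (hγ : IsRiem γ V) (hy : y ∈ V) {f : Euc m → ℝ}
    (hf : ContDiffAt ℝ ∞ f y) : ContDiffAt ℝ ∞ (grad γ f) y :=
  (hγ.inverse_smooth hy).clm_apply (smooth_fderiv hf)

/-- The Laplacian in divergence form. -/
lemma IsRiem.lap_mul_dens (hγ : IsRiem γ V) (hy : y ∈ V) {f : Euc m → ℝ}
    (hf : ∀ y ∈ V, ContDiffAt ℝ ∞ f y) :
    lap γ f y * dens (γ y)
      = ∑ a, fderiv ℝ (fun y => grad γ f y a * dens (γ y)) y (stdVec a) := by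
  set W := grad γ f with hW
  have hWs := hγ.grad_smooth hy (hf y hy)
  have hWd := smooth_differentiableAt hWs
  have hWf : ∀ z ∈ V, ∀ v, γ z (W z) v = fderiv ℝ f z v := fun z hz v =>
    hγ.inverse_apply hz _ v
  -- The covariant derivative of the gradient `W`, which represents the Hessian. Its trace is the
  -- coordinate divergence of `W` plus the trace of `Γ(W, ·)`, and the latter is the logarithmic
  -- derivative of the density along `W`.
  let S : Euc m →ₗ[ℝ] Euc m := (fderiv ℝ W y : Euc m →ₗ[ℝ] Euc m) + (chris γ y (W y) : Euc m →L[ℝ] Euc m)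
  have hS : ∀ u v, fderiv ℝ (fderiv ℝ f) y u v - fderiv ℝ f y (christoffel γ y u v)
      = γ y (S u) v := by
    intro u v
    have e1 : fderiv ℝ (fun z => γ z (W z) v) y = fderiv ℝ (fun z => fderiv ℝ f z v) y := by
      refine EventuallyEq.fderiv_eq (𝕜 := ℝ) ?_
      filter_upwards [hγ.mem_nhds hy] with z hz using hWf z hz v
    have e2 : fderiv ℝ (fun z => γ z (W z) v) y u
        = fderiv ℝ γ y u (W y) v + γ y (fderiv ℝ W y u) v := by
      have := ((hγ.differentiableAt hy).hasFDerivAt.clm_apply hWd.hasFDerivAt).clm_apply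
        (hasFDerivAt_const v y)
      rw [this.fderiv]
      simp
      ring
    have e3 : fderiv ℝ (fun z => fderiv ℝ f z v) y u = fderiv ℝ (fderiv ℝ f) y u v := by
      have h2 := ((smooth_differentiableAt (smooth_fderiv (hf y hy))).hasFDerivAt.clm_apply
        (hasFDerivAt_const v y))
      rw [h2.fderiv]
      simp
    rw [← e3, ← e1, e2, ← hWf y hy, hγ.christoffel_compat hy, hγ.christoffel_symm hy u (W y)]
    simp [S, chris_apply]
    ring
  have hlap : lap γ f y = LinearMap.trace ℝ (Euc m) S := by
    let T : Euc m →L[ℝ] Euc m →L[ℝ] ℝ := (γ y).comp S.toContinuousLinearMap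
    have h := traceWith_eq_trace (hγ.symm y hy) (hγ.pos y hy)
      ((ContinuousLinearMap.coeLM ℝ).comp (T : Euc m →ₗ[ℝ] Euc m →L[ℝ] ℝ)) S
      (fun u v => by simp [T])
    rw [← h, lap]
    congr 1
    funext u v
    rw [hS]
    simp [T]
  have hdd := smooth_differentiableAt (hγ.dens_smooth hy)
  have hR : ∀ a, fderiv ℝ (fun y => W y a * dens (γ y)) y (stdVec a)
      = (fderiv ℝ W y (stdVec a)) a * dens (γ y)
        + fderiv ℝ (fun y => dens (γ y)) y (stdVec a) * W y a := by
    intro a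
    have h1 : HasFDerivAt (fun y => W y a) ((EuclideanSpace.proj a).comp (fderiv ℝ W y)) y :=
      (EuclideanSpace.proj a : Euc m →L[ℝ] ℝ).hasFDerivAt.comp y hWd.hasFDerivAt
    rw [(h1.fun_mul hdd.hasFDerivAt).fderiv]
    simp
    ring
  rw [Finset.sum_congr rfl fun a _ => hR a, Finset.sum_add_distrib, ← Finset.sum_mul,
    sum_apply_stdVec_mul, hγ.fderiv_dens hy, hlap, map_add, ← sum_apply_stdVec]
  simp only [ContinuousLinearMap.coe_coe]
  ring

end Density

end MinimalHypersurface
end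

/-! ### A Poincaré inequality on the cubes of a grid -/

noncomputable section

namespace MinimalHypersurface

set_option synthInstance.maxHeartbeats 200000
set_option linter.unusedSectionVars false

open MeasureTheory
open scoped ENNReal

variable {m : ℕ}

lemma sq_lintegral_le {α : Type*} [MeasurableSpace α] (μ : Measure α) {φ : α → ℝ≥0∞}
    (hφ : AEMeasurable φ μ) : (∫⁻ a, φ a ∂μ) ^ 2 ≤ μ univ * ∫⁻ a, φ a ^ 2 ∂μ := by
  have h := ENNReal.lintegral_mul_le_Lp_mul_Lq μ Real.HolderConjugate.two_two hφ
    (aemeasurable_const (b := (1 : ℝ≥0∞)))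
  simp only [Pi.mul_apply, mul_one, lintegral_const, ENNReal.rpow_two, one_pow, one_mul] at h
  calc (∫⁻ a, φ a ∂μ) ^ 2 ≤ ((∫⁻ a, φ a ^ 2 ∂μ) ^ (1 / 2 : ℝ) * μ univ ^ (1 / 2 : ℝ)) ^ 2 := by
        gcongr
    _ = _ := by
        rw [mul_pow, ← ENNReal.rpow_two, ← ENNReal.rpow_two, ← ENNReal.rpow_mul,
          ← ENNReal.rpow_mul]
        norm_num [mul_comm]

lemma sq_enorm_integral_le {α : Type*} [MeasurableSpace α] (μ : Measure α) {φ : α → ℝ}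
    (hφ : AEMeasurable φ μ) : ‖∫ a, φ a ∂μ‖ₑ ^ 2 ≤ μ univ * ∫⁻ a, ‖φ a‖ₑ ^ 2 ∂μ :=
  (pow_le_pow_left₀ zero_le (enorm_integral_le_lintegral_enorm _) 2).trans
    (sq_lintegral_le μ hφ.enorm)

/-- Translations move a function by at most the length times its gradient, in the square mean. -/
lemma lintegral_translate_sub_le {u : Euc m → ℝ} (hu : ContDiff ℝ 1 u) (h : Euc m) :
    ∫⁻ x, ‖u (x + h) - u x‖ₑ ^ 2 ≤ ‖h‖ₑ ^ 2 * ∫⁻ x, ‖fderiv ℝ u x‖ₑ ^ 2 := by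
  have hc : Continuous (fderiv ℝ u) := hu.continuous_fderiv (by simp)
  have h1 : ∀ x, ‖u (x + h) - u x‖ₑ ^ 2
      ≤ ∫⁻ t in Ioc (0 : ℝ) 1, ‖h‖ₑ ^ 2 * ‖fderiv ℝ u (x + t • h)‖ₑ ^ 2 := by
    intro x
    have hd : ∀ t ∈ uIcc (0 : ℝ) 1,
        HasDerivAt (fun t : ℝ => u (x + t • h)) (fderiv ℝ u (x + t • h) h) t := by
      intro t _
      have := ((hasDerivAt_id t).smul_const h).const_add x
      simp only [id, one_smul] at this
      exact HasFDerivAt.comp_hasDerivAt (l := u) t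
        ((hu.differentiable (by simp)) (x + t • h)).hasFDerivAt this
    have hcc : Continuous fun t : ℝ => fderiv ℝ u (x + t • h) h := by fun_prop
    have hi := intervalIntegral.integral_eq_sub_of_hasDerivAt hd (hcc.intervalIntegrable 0 1)
    simp only [one_smul, zero_smul, add_zero] at hi
    rw [← hi, intervalIntegral.integral_of_le zero_le_one]
    refine (sq_enorm_integral_le _ hcc.measurable.aemeasurable).trans ?_
    simp only [Measure.restrict_apply_univ, Real.volume_Ioc, sub_zero, ENNReal.ofReal_one, one_mul]
    refine lintegral_mono fun t => ?_
    rw [← mul_pow, mul_comm]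
    exact pow_le_pow_left₀ zero_le (ContinuousLinearMap.le_opENorm _ _) 2
  refine (lintegral_mono h1).trans ?_
  have hm : Continuous (Function.uncurry fun (x : Euc m) (t : ℝ) =>
      ‖h‖ₑ ^ 2 * ‖fderiv ℝ u (x + t • h)‖ₑ ^ 2) := by
    have : Continuous fun p : Euc m × ℝ => fderiv ℝ u (p.1 + p.2 • h) := by fun_prop
    exact (ENNReal.continuous_const_mul (by simp)).comp
      ((ENNReal.continuous_pow 2).comp this.enorm)
  rw [lintegral_lintegral_swap hm.measurable.aemeasurable]
  have h2 : ∀ t : ℝ, ∫⁻ x, ‖h‖ₑ ^ 2 * ‖fderiv ℝ u (x + t • h)‖ₑ ^ 2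
      = ‖h‖ₑ ^ 2 * ∫⁻ x, ‖fderiv ℝ u x‖ₑ ^ 2 := by
    intro t
    rw [lintegral_const_mul' _ _ (by simp),
      lintegral_add_right_eq_self (fun x => ‖fderiv ℝ u x‖ₑ ^ 2) (t • h)]
  simp [h2]

/-- The cube of the grid of mesh `ε` with lower corner `ε z`. -/
def gridCube (ε : ℝ) (z : Fin m → ℤ) : Set (Euc m) :=
  {x | ∀ a, ε * z a ≤ x a ∧ x a < ε * (z a + 1)}

lemma gridCube_eq (ε : ℝ) (z : Fin m → ℤ) :
    gridCube ε z = (fun x : Euc m => x.ofLp) ⁻¹'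
      (univ.pi fun a => Ico (ε * (z a : ℝ)) (ε * (z a + 1))) := by
  ext x; simp [gridCube]

lemma measurableSet_gridCube (ε : ℝ) (z : Fin m → ℤ) : MeasurableSet (gridCube ε z) := by
  rw [gridCube_eq]
  exact (PiLp.continuous_ofLp 2 _).measurable (MeasurableSet.univ_pi fun a => measurableSet_Ico)

lemma volume_gridCube (ε : ℝ) (z : Fin m → ℤ) :
    volume (gridCube ε z) = ENNReal.ofReal ε ^ m := by
  rw [gridCube_eq]
  refine ((EuclideanSpace.volume_preserving_symm_measurableEquiv_toLp (Fin m)).measure_preimage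
    (MeasurableSet.univ_pi fun a => measurableSet_Ico).nullMeasurableSet).trans ?_
  rw [Real.volume_pi_Ico]
  have : ∀ a, ε * ((z a : ℝ) + 1) - ε * z a = ε := fun a => by ring
  simp [this]

lemma mem_gridCube_floor {ε : ℝ} (hε : 0 < ε) (x : Euc m) :
    x ∈ gridCube ε fun a => ⌊x a / ε⌋ := by
  intro a
  have h1 := Int.floor_le (x a / ε)
  have h2 := Int.lt_floor_add_one (x a / ε)
  rw [le_div_iff₀ hε] at h1
  rw [div_lt_iff₀ hε] at h2
  constructor <;> linarith

lemma norm_sub_le_of_mem_gridCube {ε : ℝ} (hε : 0 < ε) {z : Fin m → ℤ} {x y : Euc m}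
    (hx : x ∈ gridCube ε z) (hy : y ∈ gridCube ε z) : ‖y - x‖ ≤ ε * (m + 1) := by
  have h : ∀ a, |(y - x) a| ≤ ε := fun a => by
    have := hx a; have := hy a
    rw [PiLp.sub_apply, abs_le]
    constructor <;> nlinarith
  rw [EuclideanSpace.norm_eq]
  refine Real.sqrt_le_iff.2 ⟨by positivity, ?_⟩
  calc ∑ a, ‖(y - x) a‖ ^ 2 ≤ ∑ a : Fin m, ε ^ 2 :=
        Finset.sum_le_sum fun a _ => pow_le_pow_left₀ (norm_nonneg _) (h a) 2
    _ = m * ε ^ 2 := by simp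
    _ ≤ _ := by nlinarith [sq_nonneg ε, (Nat.cast_nonneg m : (0 : ℝ) ≤ m), sq_nonneg ((m : ℝ) * ε), mul_nonneg (Nat.cast_nonneg m : (0 : ℝ) ≤ m) (sq_nonneg ε)]

lemma finite_gridCube_meet {ε : ℝ} (hε : 0 < ε) {K : Set (Euc m)} (hK : IsCompact K) :
    {z : Fin m → ℤ | ∃ x ∈ K, z = fun a => ⌊x a / ε⌋}.Finite := by
  obtain ⟨R, hR⟩ := hK.isBounded.exists_norm_le
  refine (Set.Finite.pi' (t := fun _ : Fin m => Icc ⌊-R / ε⌋ ⌊R / ε⌋) fun _ => finite_Icc _ _).subset ?_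
  rintro z ⟨x, hx, rfl⟩ a
  have h := (PiLp.norm_apply_le x a).trans (hR x hx)
  rw [Real.norm_eq_abs, abs_le] at h
  exact ⟨Int.floor_le_floor (by gcongr; exact h.1), Int.floor_le_floor (by gcongr; exact h.2)⟩

/-- The Poincaré inequality for functions with vanishing mean over the cubes of a grid. -/
lemma lintegral_sq_le_of_gridCube {ε : ℝ} (hε : 0 < ε) {u : Euc m → ℝ} (hu : ContDiff ℝ 1 u)
    (hui : Integrable u)
    (hz : ∀ x, u x ≠ 0 → ∫ y in gridCube ε (fun a => ⌊x a / ε⌋), u y = 0) :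
    ∫⁻ x, ‖u x‖ₑ ^ 2 ≤ ENNReal.ofReal ε ^ 2 * (volume (Metric.closedBall (0 : Euc m) (m + 1))
      * ENNReal.ofReal (m + 1) ^ 2) * ∫⁻ x, ‖fderiv ℝ u x‖ₑ ^ 2 := by
  set e := ENNReal.ofReal ε with he
  have he0 : e ≠ 0 := by simpa [he] using hε
  have hep : e ^ m ≠ 0 := pow_ne_zero _ he0
  have het : e ^ m ≠ ⊤ := by simp [he]
  set B : Set (Euc m) := Metric.closedBall 0 (ε * (m + 1)) with hB
  have hcu := hu.continuous
  -- If `u` has mean zero over the cube `Q` of `x`, then `|Q| u(x) = -∫_Q (u(y) - u(x)) dy`.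
  -- Cauchy-Schwarz bounds the square, and `Q - x` lies in a ball `B` independent of `x`; afterwards
  -- Fubini and the translation estimate apply.
  have key : ∀ x, e ^ m * ‖u x‖ₑ ^ 2 ≤ ∫⁻ h in B, ‖u (x + h) - u x‖ₑ ^ 2 := by
    intro x
    by_cases hx : u x = 0
    · simp [hx]
    set Q := gridCube ε fun a => ⌊x a / ε⌋ with hQ
    have hv : volume Q = e ^ m := volume_gridCube ε _
    have hfin : IsFiniteMeasure (volume.restrict Q) :=
      isFiniteMeasure_restrict.2 (by rw [hv]; exact het)
    have h1 : ∫ y in Q, (u y - u x) = - ((e ^ m).toReal * u x) := by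
      rw [integral_sub hui.integrableOn (integrable_const _), hz x hx]
      simp [Measure.real, hv]
    have h2 := sq_enorm_integral_le (volume.restrict Q)
      (φ := fun y => u y - u x) (by fun_prop)
    rw [h1, enorm_neg, enorm_mul, mul_pow, Measure.restrict_apply_univ, hv] at h2
    have h3 : ‖(e ^ m).toReal‖ₑ = e ^ m := by
      rw [Real.enorm_eq_ofReal ENNReal.toReal_nonneg, ENNReal.ofReal_toReal het]
    rw [h3, pow_two (e ^ m), mul_assoc, ENNReal.mul_le_mul_iff_right hep het] at h2
    refine h2.trans ?_
    have h4 : ∫⁻ y in Q, ‖u y - u x‖ₑ ^ 2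
        = ∫⁻ h, Q.indicator (fun y => ‖u y - u x‖ₑ ^ 2) (x + h) := by
      rw [lintegral_add_left_eq_self (Q.indicator fun y => ‖u y - u x‖ₑ ^ 2),
        lintegral_indicator (measurableSet_gridCube _ _)]
    rw [h4, ← lintegral_indicator Metric.isClosed_closedBall.measurableSet]
    refine lintegral_mono fun h => ?_
    by_cases hh : x + h ∈ Q
    · have : h ∈ B := by
        have := norm_sub_le_of_mem_gridCube hε (mem_gridCube_floor hε x) hh
        simpa [hB] using this
      rw [indicator_of_mem hh, indicator_of_mem this]
    · rw [indicator_of_notMem hh]; exact zero_le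
  have hm : Continuous (Function.uncurry fun (x h : Euc m) => ‖u (x + h) - u x‖ₑ ^ 2) := by
    have : Continuous fun p : Euc m × Euc m => u (p.1 + p.2) - u p.1 := by fun_prop
    exact (ENNReal.continuous_pow 2).comp this.enorm
  -- The ball has volume proportional to that of a cube. So `e ^ m` cancels, and the factor `e ^ 2`
  -- from the translation estimate makes the Poincaré constant small.
  have hvB : volume B = e ^ m * volume (Metric.closedBall (0 : Euc m) (m + 1)) := by
    rw [hB, Measure.addHaar_closedBall_mul _ _ hε.le (by positivity)]
    simp [he, ENNReal.ofReal_pow hε.le]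
  have h5 : e ^ m * ∫⁻ x, ‖u x‖ₑ ^ 2
      ≤ e ^ m * (e ^ 2 * (volume (Metric.closedBall (0 : Euc m) (m + 1))
      * ENNReal.ofReal (m + 1) ^ 2) * ∫⁻ x, ‖fderiv ℝ u x‖ₑ ^ 2) := by
    rw [← lintegral_const_mul' _ _ het]
    calc ∫⁻ x, e ^ m * ‖u x‖ₑ ^ 2 ≤ ∫⁻ x, ∫⁻ h in B, ‖u (x + h) - u x‖ₑ ^ 2 := lintegral_mono key
      _ = ∫⁻ h in B, ∫⁻ x, ‖u (x + h) - u x‖ₑ ^ 2 :=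
          lintegral_lintegral_swap hm.measurable.aemeasurable
      _ ≤ ∫⁻ h in B, ENNReal.ofReal (ε * (m + 1)) ^ 2 * ∫⁻ x, ‖fderiv ℝ u x‖ₑ ^ 2 := by
          refine setLIntegral_mono measurable_const fun h hh => ?_
          refine (lintegral_translate_sub_le hu h).trans ?_
          gcongr
          rw [← ofReal_norm]
          exact ENNReal.ofReal_le_ofReal (by simpa [hB] using hh)
      _ = _ := by
          rw [lintegral_const, Measure.restrict_apply_univ, hvB, ENNReal.ofReal_mul hε.le]
          ring
  rwa [ENNReal.mul_le_mul_iff_right hep het] at h5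

lemma integral_sq_le_of_lintegral {X : Type*} [NormedAddCommGroup X] [NormedSpace ℝ X]
    [MeasurableSpace X] {μ : Measure X} {F : Type*} [NormedAddCommGroup F] {u : X → ℝ} {w : X → F}
    {c : ℝ} (hc : 0 ≤ c) (hu : Integrable (fun x => u x ^ 2) μ)
    (hw : Integrable (fun x => ‖w x‖ ^ 2) μ)
    (h : ∫⁻ x, ‖u x‖ₑ ^ 2 ∂μ ≤ ENNReal.ofReal c * ∫⁻ x, ‖w x‖ₑ ^ 2 ∂μ) :
    ∫ x, u x ^ 2 ∂μ ≤ c * ∫ x, ‖w x‖ ^ 2 ∂μ := by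
  have e1 : ∫⁻ x, ‖u x‖ₑ ^ 2 ∂μ = ENNReal.ofReal (∫ x, u x ^ 2 ∂μ) := by
    rw [ofReal_integral_eq_lintegral_ofReal hu (Eventually.of_forall fun x => sq_nonneg _)]
    refine lintegral_congr fun x => ?_
    rw [← ofReal_norm, ← ENNReal.ofReal_pow (norm_nonneg _), Real.norm_eq_abs, sq_abs]
  have e2 : ∫⁻ x, ‖w x‖ₑ ^ 2 ∂μ = ENNReal.ofReal (∫ x, ‖w x‖ ^ 2 ∂μ) := by
    rw [ofReal_integral_eq_lintegral_ofReal hw (Eventually.of_forall fun x => sq_nonneg _)]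
    refine lintegral_congr fun x => ?_
    rw [← ofReal_norm, ← ENNReal.ofReal_pow (norm_nonneg _)]
  have hnn : 0 ≤ ∫ x, ‖w x‖ ^ 2 ∂μ := integral_nonneg fun x => sq_nonneg _
  rw [e1, e2, ← ENNReal.ofReal_mul hc] at h
  exact (ENNReal.ofReal_le_ofReal_iff (mul_nonneg hc hnn)).1 h

/-- A Poincaré inequality with a small constant, on a subspace of finite codimension. -/
lemma exists_poincare {K : Set (Euc m)} (hK : IsCompact K) {δ : ℝ} (hδ : 0 < δ) :
    ∃ (ε : ℝ) (Z : Finset (Fin m → ℤ)), ∀ u : Euc m → ℝ, ContDiff ℝ 1 u → (∀ x ∉ K, u x = 0) →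
      (∀ z ∈ Z, ∫ y in gridCube ε z, u y = 0) →
      ∫ x, u x ^ 2 ≤ δ * ∫ x, ‖fderiv ℝ u x‖ ^ 2 := by
  obtain ⟨c, hc0, hc⟩ : ∃ c : ℝ, 0 ≤ c ∧ volume (Metric.closedBall (0 : Euc m) (m + 1))
      * ENNReal.ofReal (m + 1) ^ 2 = ENNReal.ofReal c :=
    ⟨_, ENNReal.toReal_nonneg, (ENNReal.ofReal_toReal
      (ENNReal.mul_ne_top (isCompact_closedBall _ _).measure_lt_top.ne (by simp))).symm⟩
  obtain ⟨ε, hε, hεδ⟩ : ∃ ε : ℝ, 0 < ε ∧ ε ^ 2 * c ≤ δ := by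
    refine ⟨√(δ / (c + 1)), Real.sqrt_pos.2 (by positivity), ?_⟩
    rw [Real.sq_sqrt (by positivity), div_mul_eq_mul_div, div_le_iff₀ (by positivity)]
    nlinarith
  -- Only cubes that meet the support matter, so the mean conditions are finite in number.
  refine ⟨ε, (finite_gridCube_meet hε hK).toFinset, fun u hu h0 hz => ?_⟩
  have hcs : HasCompactSupport u := HasCompactSupport.intro hK h0
  have hcd : Continuous (fderiv ℝ u) := hu.continuous_fderiv (by simp)
  have hcs' : HasCompactSupport (fderiv ℝ u) := hcs.fderiv ℝ
  have h := lintegral_sq_le_of_gridCube hε hu (hu.continuous.integrable_of_hasCompactSupport hcs)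
    fun x hx => hz _ (by
      rw [Set.Finite.mem_toFinset]
      exact ⟨x, by by_contra hxK; exact hx (h0 x hxK), rfl⟩)
  have i1 : Integrable fun x => u x ^ 2 :=
    (hu.continuous.pow 2).integrable_of_hasCompactSupport
      (hcs.mono fun x hx hx0 => hx (by simp [hx0]))
  have i2 : Integrable fun x => ‖fderiv ℝ u x‖ ^ 2 :=
    (hcd.norm.pow 2).integrable_of_hasCompactSupport
      (hcs'.mono fun x hx hx0 => hx (by simp [hx0]))
  rw [hc, ← ENNReal.ofReal_pow hε.le, ← ENNReal.ofReal_mul (sq_nonneg ε)] at h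
  exact (integral_sq_le_of_lintegral (by positivity) i1 i2 h).trans
    (mul_le_mul_of_nonneg_right hεδ (integral_nonneg fun x => sq_nonneg _))

end MinimalHypersurface
end

/-! ### Green's formula and the energy estimate in a chart -/

noncomputable section

namespace MinimalHypersurface

set_option synthInstance.maxHeartbeats 200000
set_option linter.unusedSectionVars false

open MeasureTheory
open scoped ENNReal

variable {m : ℕ} {V K : Set (Euc m)}

lemma contDiff_indicator (hV : IsOpen V) (hK : IsCompact K) (hKV : K ⊆ V) {f : Euc m → ℝ}
    (hf : ∀ x ∈ V, ContDiffAt ℝ ∞ f x) (h0 : ∀ x ∈ V, x ∉ K → f x = 0) :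
    ContDiff ℝ ∞ (V.indicator f) := by
  refine contDiff_iff_contDiffAt.2 fun x => ?_
  by_cases hx : x ∈ V
  · refine (hf x hx).congr_of_eventuallyEq ?_
    filter_upwards [hV.mem_nhds hx] with y hy using indicator_of_mem hy f
  · refine (contDiffAt_const (c := (0 : ℝ))).congr_of_eventuallyEq ?_
    filter_upwards [hK.isClosed.isOpen_compl.mem_nhds fun h => hx (hKV h)] with y hy
    by_cases hyV : y ∈ V
    · rw [indicator_of_mem hyV, h0 y hyV hy]
    · rw [indicator_of_notMem hyV]

lemma integrableOn_of_eq_zero (hV : IsOpen V) (hK : IsCompact K) (hKV : K ⊆ V)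
    {f : Euc m → ℝ} (hf : ContinuousOn f V) (h0 : ∀ x ∈ V, x ∉ K → f x = 0) :
    IntegrableOn f V :=
  ((hf.mono hKV).integrableOn_compact hK).of_forall_sdiff_eq_zero hV.measurableSet
    fun x hx => h0 x hx.1 hx.2

lemma indicator_eq_zero_of_notMem {f : Euc m → ℝ} (h0 : ∀ x ∈ V, x ∉ K → f x = 0) :
    ∀ x ∉ K, V.indicator f x = 0 := fun x hx => by
  by_cases hxV : x ∈ V
  · rw [indicator_of_mem hxV, h0 x hxV hx]
  · exact indicator_of_notMem hxV f

lemma fderiv_eq_zero_of_eq_zero (hV : IsOpen V) (hK : IsCompact K) {f : Euc m → ℝ}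
    (h0 : ∀ x ∈ V, x ∉ K → f x = 0) {x : Euc m} (hx : x ∈ V) (hxK : x ∉ K) :
    fderiv ℝ f x = 0 := by
  have : f =ᶠ[𝓝 x] fun _ => 0 := by
    filter_upwards [(hV.sdiff hK.isClosed).mem_nhds ⟨hx, hxK⟩] with y hy using h0 y hy.1 hy.2
  rw [this.fderiv_eq (𝕜 := ℝ)]
  simp

lemma lap_eq_zero_of_eq_zero {γ : BilinField m} (hV : IsOpen V) (hK : IsCompact K) {f : Euc m → ℝ}
    (h0 : ∀ x ∈ V, x ∉ K → f x = 0) {x : Euc m} (hx : x ∈ V) (hxK : x ∉ K) :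
    lap γ f x = 0 := by
  have h1 : fderiv ℝ f =ᶠ[𝓝 x] fun _ => 0 := by
    filter_upwards [(hV.sdiff hK.isClosed).mem_nhds ⟨hx, hxK⟩] with y hy using
      fderiv_eq_zero_of_eq_zero hV hK h0 hy.1 hy.2
  rw [lap, h1.fderiv_eq (𝕜 := ℝ), h1.self_of_nhds]
  simp [traceWith]

lemma integral_fderiv_eq_zero {Φ : Euc m → ℝ} (hΦ : ContDiff ℝ 1 Φ) (hc : HasCompactSupport Φ)
    (v : Euc m) : ∫ x, fderiv ℝ Φ x v = 0 := by
  have hcd : Continuous fun x => fderiv ℝ Φ x v := (hΦ.continuous_fderiv (by simp)).clm_apply continuous_const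
  have i1 : Integrable fun x => fderiv ℝ Φ x v :=
    hcd.integrable_of_hasCompactSupport ((hc.fderiv ℝ).mono fun x hx hx0 => hx (by simp [hx0]))
  have h := integral_mul_fderiv_eq_neg_fderiv_mul_of_integrable (μ := volume) (f := fun _ : Euc m => (1 : ℝ))
    (g := Φ) (v := v) (by simp) (by simpa using i1)
    (by simpa using hΦ.continuous.integrable_of_hasCompactSupport hc)
    (by simp) (fun x _ => (hΦ.differentiable (by simp)) x)
  simpa using h

/-- Extended by zero the components are smooth with compact support on the whole space, where
integrals of derivatives vanish. -/
lemma setIntegral_divergence_eq_zero (hV : IsOpen V) (hK : IsCompact K) (hKV : K ⊆ V)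
    {w : Fin m → Euc m → ℝ} (hw : ∀ a, ∀ x ∈ V, ContDiffAt ℝ ∞ (w a) x)
    (h0 : ∀ a, ∀ x ∈ V, x ∉ K → w a x = 0) :
    ∫ x in V, ∑ a, fderiv ℝ (w a) x (stdVec a) = 0 := by
  have hc : ∀ a, ∀ x ∈ V, fderiv ℝ (V.indicator (w a)) x = fderiv ℝ (w a) x := by
    intro a x hx
    refine EventuallyEq.fderiv_eq (𝕜 := ℝ) ?_
    filter_upwards [hV.mem_nhds hx] with y hy using indicator_of_mem hy _
  have hcd : ∀ a, ContDiff ℝ 1 (V.indicator (w a)) := fun a =>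
    (contDiff_indicator hV hK hKV (hw a) (h0 a)).of_le (by simp)
  have h0' := fun a => indicator_eq_zero_of_notMem (h0 a)
  rw [integral_finsetSum]
  · refine Finset.sum_eq_zero fun a _ => ?_
    rw [← integral_fderiv_eq_zero (hcd a) (HasCompactSupport.intro hK (h0' a)) (stdVec a)]
    rw [setIntegral_congr_fun hV.measurableSet fun x hx => by rw [← hc a x hx]]
    refine setIntegral_eq_integral_of_forall_compl_eq_zero fun x hx => ?_
    have : x ∉ K := fun h => hx (hKV h)
    rw [fderiv_eq_zero_of_eq_zero isOpen_univ hK (fun y _ => h0' a y) (mem_univ x) this]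
    simp
  · intro a _
    refine integrableOn_of_eq_zero hV hK hKV
      (fun x hx => (smooth_fderiv_apply (hw a x hx) _).continuousAt.continuousWithinAt)
      fun x hx hxK => ?_
    rw [fderiv_eq_zero_of_eq_zero hV hK (h0 a) hx hxK]
    simp

variable {γ : BilinField m} {f h χ q : Euc m → ℝ}

lemma IsRiem.grad_symm (hγ : IsRiem γ V) {x : Euc m} (hx : x ∈ V) :
    fderiv ℝ h x (grad γ f x) = fderiv ℝ f x (grad γ h x) :=
  hγ.inverse_symm hx _ _

lemma IsRiem.continuousOn_lap (hγ : IsRiem γ V) (hf : ∀ x ∈ V, ContDiffAt ℝ ∞ f x) :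
    ContinuousOn (lap γ f) V := by
  have hdc : ContinuousOn (fun x => dens (γ x)) V := fun x hx =>
    (hγ.dens_smooth hx).continuousAt.continuousWithinAt
  have : ContinuousOn (fun x => (∑ a, fderiv ℝ (fun y => grad γ f y a * dens (γ y)) x (stdVec a))
      / dens (γ x)) V := by
    refine ContinuousOn.div (continuousOn_finsetSum _ fun a _ x hx => ?_) hdc
      fun x hx => (hγ.dens_pos hx).ne'
    exact (smooth_fderiv_apply (((EuclideanSpace.proj a : Euc m →L[ℝ] ℝ).contDiff.contDiffAt.comp x
      (hγ.grad_smooth hx (hf x hx))).mul (hγ.dens_smooth hx)) _).continuousAt.continuousWithinAt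
  refine this.congr fun x hx => ?_
  dsimp only
  rw [← hγ.lap_mul_dens hx hf, mul_div_cancel_right₀ _ (hγ.dens_pos hx).ne']

/-- Green's formula. -/
lemma IsRiem.integral_lap_mul (hγ : IsRiem γ V) (hK : IsCompact K) (hKV : K ⊆ V)
    (hf : ∀ x ∈ V, ContDiffAt ℝ ∞ f x) (hh : ∀ x ∈ V, ContDiffAt ℝ ∞ h x)
    (h0 : (∀ x ∈ V, x ∉ K → f x = 0) ∨ ∀ x ∈ V, x ∉ K → h x = 0) :
    ∫ x in V, lap γ f x * h x * dens (γ x)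
      = - ∫ x in V, fderiv ℝ h x (grad γ f x) * dens (γ x) := by
  have hV := hγ.isOpen
  have hw1 : ∀ x ∈ V, ∀ a, ContDiffAt ℝ ∞ (fun x => grad γ f x a * dens (γ x)) x := fun x hx a =>
    ((EuclideanSpace.proj a : Euc m →L[ℝ] ℝ).contDiff.contDiffAt.comp x
      (hγ.grad_smooth hx (hf x hx))).mul (hγ.dens_smooth hx)
  have hdiv := setIntegral_divergence_eq_zero hV hK hKV
    (w := fun a x => h x * (grad γ f x a * dens (γ x)))
    (fun a x hx => (hh x hx).mul (hw1 x hx a)) (fun a x hx hxK => by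
      rcases h0 with h0 | h0
      · simp only [grad]
        rw [fderiv_eq_zero_of_eq_zero hV hK h0 hx hxK]
        simp
      · rw [h0 x hx hxK, zero_mul])
  have hpt : ∀ x ∈ V, ∑ a, fderiv ℝ (fun x => h x * (grad γ f x a * dens (γ x))) x (stdVec a)
      = lap γ f x * h x * dens (γ x) + fderiv ℝ h x (grad γ f x) * dens (γ x) := by
    intro x hx
    have e : ∀ a, fderiv ℝ (fun x => h x * (grad γ f x a * dens (γ x))) x (stdVec a)
        = h x * fderiv ℝ (fun x => grad γ f x a * dens (γ x)) x (stdVec a)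
          + fderiv ℝ h x (stdVec a) * grad γ f x a * dens (γ x) := by
      intro a
      rw [((smooth_differentiableAt (hh x hx)).hasFDerivAt.fun_mul
        (smooth_differentiableAt (hw1 x hx a)).hasFDerivAt).fderiv]
      simp
      ring
    rw [Finset.sum_congr rfl fun a _ => e a, Finset.sum_add_distrib, ← Finset.mul_sum,
      ← Finset.sum_mul, sum_apply_stdVec_mul, ← hγ.lap_mul_dens hx hf]
    ring
  have hdc : ContinuousOn (fun x => dens (γ x)) V := fun x hx =>
    (hγ.dens_smooth hx).continuousAt.continuousWithinAt
  have hlc := hγ.continuousOn_lap hf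
  have hhc : ContinuousOn h V := fun x hx => (hh x hx).continuousAt.continuousWithinAt
  have hgc : ContinuousOn (fun x => fderiv ℝ h x (grad γ f x)) V := fun x hx =>
    ((smooth_fderiv (hh x hx)).clm_apply
      (hγ.grad_smooth hx (hf x hx))).continuousAt.continuousWithinAt
  rw [setIntegral_congr_fun hV.measurableSet hpt, integral_add] at hdiv
  · linarith
  · refine integrableOn_of_eq_zero hV hK hKV ((hlc.mul hhc).mul hdc) fun x hx hxK => ?_
    rcases h0 with h0 | h0
    · simp [lap_eq_zero_of_eq_zero hV hK h0 hx hxK]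
    · simp [h0 x hx hxK]
  · refine integrableOn_of_eq_zero hV hK hKV (hgc.mul hdc) fun x hx hxK => ?_
    rcases h0 with h0 | h0
    · rw [hγ.grad_symm hx, fderiv_eq_zero_of_eq_zero hV hK h0 hx hxK]
      simp
    · rw [fderiv_eq_zero_of_eq_zero hV hK h0 hx hxK]
      simp

/-- Schrödinger operators are symmetric. -/
lemma IsRiem.integral_lap_add_mul_symm (hγ : IsRiem γ V) (hK : IsCompact K) (hKV : K ⊆ V)
    (hf : ∀ x ∈ V, ContDiffAt ℝ ∞ f x) (hh : ∀ x ∈ V, ContDiffAt ℝ ∞ h x)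
    (hq : ContinuousOn q V) (h0 : ∀ x ∈ V, x ∉ K → f x = 0) :
    ∫ x in V, (lap γ f x + q x * f x) * h x * dens (γ x)
      = ∫ x in V, f x * (lap γ h x + q x * h x) * dens (γ x) := by
  have hV := hγ.isOpen
  have hdc : ContinuousOn (fun x => dens (γ x)) V := fun x hx =>
    (hγ.dens_smooth hx).continuousAt.continuousWithinAt
  have hfc : ContinuousOn f V := fun x hx => (hf x hx).continuousAt.continuousWithinAt
  have hhc : ContinuousOn h V := fun x hx => (hh x hx).continuousAt.continuousWithinAt
  have i0 : IntegrableOn (fun x => q x * f x * h x * dens (γ x)) V :=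
    integrableOn_of_eq_zero hV hK hKV (((hq.mul hfc).mul hhc).mul hdc)
      fun x hx hxK => by simp [h0 x hx hxK]
  have i1 : IntegrableOn (fun x => lap γ f x * h x * dens (γ x)) V :=
    integrableOn_of_eq_zero hV hK hKV (((hγ.continuousOn_lap hf).mul hhc).mul hdc)
      fun x hx hxK => by simp [lap_eq_zero_of_eq_zero hV hK h0 hx hxK]
  have i2 : IntegrableOn (fun x => lap γ h x * f x * dens (γ x)) V :=
    integrableOn_of_eq_zero hV hK hKV (((hγ.continuousOn_lap hh).mul hfc).mul hdc)
      fun x hx hxK => by simp [h0 x hx hxK]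
  have e1 : ∀ x, (lap γ f x + q x * f x) * h x * dens (γ x)
      = lap γ f x * h x * dens (γ x) + q x * f x * h x * dens (γ x) := fun x => by ring
  have e2 : ∀ x, f x * (lap γ h x + q x * h x) * dens (γ x)
      = lap γ h x * f x * dens (γ x) + q x * f x * h x * dens (γ x) := fun x => by ring
  simp only [e1, e2]
  rw [integral_add i1 i0, integral_add i2 i0, hγ.integral_lap_mul hK hKV hf hh (Or.inl h0),
    hγ.integral_lap_mul hK hKV hh hf (Or.inr h0),
    setIntegral_congr_fun hV.measurableSet fun x hx => by rw [hγ.grad_symm hx]]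

/-- The energy identity with a cut-off. -/
lemma IsRiem.integral_lap_mul_sq (hγ : IsRiem γ V) (hK : IsCompact K) (hKV : K ⊆ V)
    (hf : ∀ x ∈ V, ContDiffAt ℝ ∞ f x) (hχ : ∀ x ∈ V, ContDiffAt ℝ ∞ χ x)
    (h0 : ∀ x ∈ V, x ∉ K → χ x = 0) :
    ∫ x in V, lap γ f x * (χ x ^ 2 * f x) * dens (γ x)
      = - (∫ x in V, fderiv ℝ (fun x => χ x * f x) x (grad γ (fun x => χ x * f x) x) * dens (γ x))
        + ∫ x in V, f x ^ 2 * fderiv ℝ χ x (grad γ χ x) * dens (γ x) := by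
  have hV := hγ.isOpen
  have hdc : ContinuousOn (fun x => dens (γ x)) V := fun x hx =>
    (hγ.dens_smooth hx).continuousAt.continuousWithinAt
  have hfc : ContinuousOn f V := fun x hx => (hf x hx).continuousAt.continuousWithinAt
  have hu : ∀ x ∈ V, ContDiffAt ℝ ∞ (fun x => χ x * f x) x := fun x hx => (hχ x hx).mul (hf x hx)
  have hgc : ∀ {u : Euc m → ℝ}, (∀ x ∈ V, ContDiffAt ℝ ∞ u x) →
      ContinuousOn (fun x => fderiv ℝ u x (grad γ u x)) V := fun hu x hx =>
    ((smooth_fderiv (hu x hx)).clm_apply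
      (hγ.grad_smooth hx (hu x hx))).continuousAt.continuousWithinAt
  rw [hγ.integral_lap_mul hK hKV hf (fun x hx => ((hχ x hx).pow 2).mul (hf x hx))
    (Or.inr fun x hx hxK => by simp [h0 x hx hxK])]
  rw [neg_add_eq_sub, ← neg_sub, neg_inj, ← integral_sub]
  -- Pointwise, `⟨∇(χ² f), ∇f⟩ = |∇(χ f)|² - f² |∇χ|²`.
  · refine setIntegral_congr_fun hV.measurableSet fun x hx => ?_
    have df := (smooth_differentiableAt (hf x hx)).hasFDerivAt
    have dχ := (smooth_differentiableAt (hχ x hx)).hasFDerivAt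
    have e1 : fderiv ℝ (fun x => χ x * f x) x = χ x • fderiv ℝ f x + f x • fderiv ℝ χ x :=
      (dχ.fun_mul df).fderiv
    have e2 : fderiv ℝ (fun x => χ x ^ 2 * f x) x
        = χ x ^ 2 • fderiv ℝ f x + f x • ((2 * χ x) • fderiv ℝ χ x) := by
      have : (fun x => χ x ^ 2 * f x) = fun x => χ x * (χ x * f x) := by funext x; ring
      rw [this, (dχ.fun_mul (dχ.fun_mul df)).fderiv]
      module
    have e3 := hγ.grad_symm hx (f := f) (h := χ)
    simp only [grad] at e3 ⊢
    simp only [e1, e2, map_add, map_smul, add_apply, smul_apply, smul_eq_mul, e3]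
    ring
  · exact integrableOn_of_eq_zero hV hK hKV ((hgc hu).mul hdc) fun x hx hxK => by
      rw [fderiv_eq_zero_of_eq_zero hV hK (fun y hy hyK => by rw [h0 y hy hyK, zero_mul]) hx hxK]
      simp
  · exact integrableOn_of_eq_zero hV hK hKV (((hfc.pow 2).mul (hgc hχ)).mul hdc)
      fun x hx hxK => by
        rw [fderiv_eq_zero_of_eq_zero hV hK h0 hx hxK]
        simp

/-- Cauchy-Schwarz for `γ` combined with `γ(v, v) ≤ ‖γ‖ ‖v‖²`. It converts the Riemannian energy
into the Euclidean one of the Poincaré inequality. -/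
lemma IsRiem.norm_sq_le (hγ : IsRiem γ V) {x : Euc m} (hx : x ∈ V) (α : Euc m →L[ℝ] ℝ) :
    ‖α‖ ^ 2 ≤ ‖γ x‖ * α ((γ x).inverse α) := by
  set w := (γ x).inverse α with hw
  have h1 : ∀ v, γ x w v = α v := fun v => hγ.inverse_apply hx α v
  by_cases hw0 : w = 0
  · have : α = 0 := ContinuousLinearMap.ext fun v => by rw [← h1, hw0]; simp
    simp [this]
  have hQ : 0 < α w := by rw [← h1]; exact hγ.pos x hx w hw0
  have hnn : ∀ v, 0 ≤ γ x v v := fun v => by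
    by_cases hv : v = 0
    · simp [hv]
    · exact (hγ.pos x hx v hv).le
  have h2 : ∀ v, α v ^ 2 ≤ α w * γ x v v := by
    intro v
    have h := hnn (α w • v - α v • w)
    simp only [map_sub, map_smul, sub_apply, smul_apply, h1, smul_eq_mul, hγ.symm x hx v w] at h
    have : 0 ≤ α w * (α w * γ x v v - α v ^ 2) := by linarith
    exact sub_nonneg.1 (nonneg_of_mul_nonneg_right this hQ)
  have h3 : ‖α‖ ≤ √(‖γ x‖ * α w) := by
    refine ContinuousLinearMap.opNorm_le_bound _ (Real.sqrt_nonneg _) fun v => ?_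
    rw [Real.norm_eq_abs, ← Real.sqrt_sq (norm_nonneg v), ← Real.sqrt_mul (by positivity)]
    refine Real.abs_le_sqrt ((h2 v).trans ?_)
    have := (Real.le_norm_self _).trans ((γ x).le_opNorm₂ v v)
    nlinarith
  calc ‖α‖ ^ 2 ≤ √(‖γ x‖ * α w) ^ 2 := pow_le_pow_left₀ (norm_nonneg _) h3 2
    _ = _ := Real.sq_sqrt (by positivity)

/-- The energy estimate with a cut-off. -/
lemma IsRiem.exists_energy (hγ : IsRiem γ V) (hK : IsCompact K) (hKV : K ⊆ V)
    (hχ : ∀ x ∈ V, ContDiffAt ℝ ∞ χ x) (h0 : ∀ x ∈ V, x ∉ K → χ x = 0)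
    (hq : ContinuousOn q V) :
    ∃ c > 0, ∃ C ≥ 0, ∀ f : Euc m → ℝ, (∀ x ∈ V, ContDiffAt ℝ ∞ f x) → ∀ η : Euc m → ℝ,
      (∀ x ∈ V, 0 ≤ η x) → (∀ x ∈ K, η x = 1) →
      IntegrableOn (fun x => η x * f x ^ 2 * dens (γ x)) V →
      ∫ x in V, χ x ^ 2 * ((lap γ f x + q x * f x) * f x) * dens (γ x)
        ≤ - c * (∫ x, ‖fderiv ℝ (V.indicator fun x => χ x * f x) x‖ ^ 2)
          + C * ∫ x in V, η x * f x ^ 2 * dens (γ x) := by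
  have hV := hγ.isOpen
  have hdc : ContinuousOn (fun x => dens (γ x)) V := fun x hx =>
    (hγ.dens_smooth hx).continuousAt.continuousWithinAt
  have hχc : ContinuousOn χ V := fun x hx => (hχ x hx).continuousAt.continuousWithinAt
  have hgc : ∀ {u : Euc m → ℝ}, (∀ x ∈ V, ContDiffAt ℝ ∞ u x) →
      ContinuousOn (fun x => fderiv ℝ u x (grad γ u x)) V := fun hu x hx =>
    ((smooth_fderiv (hu x hx)).clm_apply
      (hγ.grad_smooth hx (hu x hx))).continuousAt.continuousWithinAt
  have hγc : ContinuousOn γ V := fun x hx => (hγ.smooth x hx).continuousAt.continuousWithinAt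
  obtain ⟨d, hd, hdK⟩ := hK.exists_forall_le' (hdc.mono hKV) fun x hx => hγ.dens_pos (hKV hx)
  obtain ⟨Λ, hΛ⟩ := hK.exists_bound_of_continuousOn (hγc.mono hKV)
  obtain ⟨A, hA⟩ := hK.exists_bound_of_continuousOn ((hgc hχ).mono hKV)
  obtain ⟨B, hB⟩ := hK.exists_bound_of_continuousOn ((hq.mul (hχc.pow 2)).mono hKV)
  have hΛ' : ∀ x ∈ K, ‖γ x‖ ≤ |Λ| + 1 := fun x hx =>
    (hΛ x hx).trans ((le_abs_self Λ).trans (by linarith))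
  -- On `K`, `d` bounds the density from below, and `Λ`, `A`, `B` bound the metric, `|∇χ|²` and `q
  -- χ²`; absolute values guard against an empty `K`. The function `η` localises the error term,
  -- since `f² dens` need not be integrable on `V`.
  refine ⟨d / (|Λ| + 1), by positivity, |A| + |B|, by positivity, fun f hf η hη hηK hi => ?_⟩
  have hfc : ContinuousOn f V := fun x hx => (hf x hx).continuousAt.continuousWithinAt
  have hu : ∀ x ∈ V, ContDiffAt ℝ ∞ (fun x => χ x * f x) x := fun x hx => (hχ x hx).mul (hf x hx)
  have hu0 : ∀ x ∈ V, x ∉ K → χ x * f x = 0 := fun x hx hxK => by rw [h0 x hx hxK, zero_mul]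
  have hDu0 : ∀ x ∈ V, x ∉ K → fderiv ℝ (fun x => χ x * f x) x = 0 := fun x hx hxK =>
    fderiv_eq_zero_of_eq_zero hV hK hu0 hx hxK
  have hDχ0 : ∀ x ∈ V, x ∉ K → fderiv ℝ χ x = 0 := fun x hx hxK =>
    fderiv_eq_zero_of_eq_zero hV hK h0 hx hxK
  have i1 : IntegrableOn (fun x => lap γ f x * (χ x ^ 2 * f x) * dens (γ x)) V :=
    integrableOn_of_eq_zero hV hK hKV
      (((hγ.continuousOn_lap hf).mul ((hχc.pow 2).mul hfc)).mul hdc)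
      fun x hx hxK => by simp [h0 x hx hxK]
  have i2 : IntegrableOn (fun x => q x * χ x ^ 2 * f x ^ 2 * dens (γ x)) V :=
    integrableOn_of_eq_zero hV hK hKV (((hq.mul (hχc.pow 2)).mul (hfc.pow 2)).mul hdc)
      fun x hx hxK => by simp [h0 x hx hxK]
  have i3 : IntegrableOn (fun x => f x ^ 2 * fderiv ℝ χ x (grad γ χ x) * dens (γ x)) V :=
    integrableOn_of_eq_zero hV hK hKV (((hfc.pow 2).mul (hgc hχ)).mul hdc)
      fun x hx hxK => by simp [hDχ0 x hx hxK]
  have i4 : IntegrableOn (fun x => fderiv ℝ (fun x => χ x * f x) x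
      (grad γ (fun x => χ x * f x) x) * dens (γ x)) V :=
    integrableOn_of_eq_zero hV hK hKV ((hgc hu).mul hdc) fun x hx hxK => by
      rw [hDu0 x hx hxK]; simp
  have i5 : IntegrableOn (fun x => ‖fderiv ℝ (fun x => χ x * f x) x‖ ^ 2) V :=
    integrableOn_of_eq_zero hV hK hKV (ContinuousOn.pow (ContinuousOn.norm fun x hx =>
      (smooth_fderiv (hu x hx)).continuousAt.continuousWithinAt) 2) fun x hx hxK => by
      rw [hDu0 x hx hxK]; simp
  have e0 : ∀ x, χ x ^ 2 * ((lap γ f x + q x * f x) * f x) * dens (γ x)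
      = lap γ f x * (χ x ^ 2 * f x) * dens (γ x) + q x * χ x ^ 2 * f x ^ 2 * dens (γ x) :=
    fun x => by ring
  have e1 : ∫ x, ‖fderiv ℝ (V.indicator fun x => χ x * f x) x‖ ^ 2
      = ∫ x in V, ‖fderiv ℝ (fun x => χ x * f x) x‖ ^ 2 := by
    rw [← setIntegral_eq_integral_of_forall_compl_eq_zero (s := V)]
    · refine setIntegral_congr_fun hV.measurableSet fun x hx => ?_
      have : V.indicator (fun x => χ x * f x) =ᶠ[𝓝 x] fun x => χ x * f x := by
        filter_upwards [hV.mem_nhds hx] with y hy using indicator_of_mem hy _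
      simp only [this.fderiv_eq (𝕜 := ℝ)]
    · intro x hx
      rw [fderiv_eq_zero_of_eq_zero isOpen_univ hK
        (fun y _ => indicator_eq_zero_of_notMem hu0 y) (mem_univ x) fun h => hx (hKV h)]
      simp
  have h1 : d / (|Λ| + 1) * ∫ x in V, ‖fderiv ℝ (fun x => χ x * f x) x‖ ^ 2
      ≤ ∫ x in V, fderiv ℝ (fun x => χ x * f x) x (grad γ (fun x => χ x * f x) x) * dens (γ x) := by
    rw [← integral_const_mul]
    refine setIntegral_mono_on (i5.const_mul _) i4 hV.measurableSet fun x hx => ?_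
    by_cases hxK : x ∈ K
    · have h2 := hγ.norm_sq_le hx (fderiv ℝ (fun x => χ x * f x) x)
      set α := fderiv ℝ (fun x => χ x * f x) x
      change _ ≤ α ((γ x).inverse α) * dens (γ x)
      set P := α ((γ x).inverse α)
      have hP : 0 ≤ P := by
        by_contra hP
        have hlt : P < 0 := not_le.1 hP
        have h3 : ‖α‖ ^ 2 ≤ 0 := h2.trans (mul_nonpos_of_nonneg_of_nonpos (norm_nonneg _) hlt.le)
        have h4 : α = 0 := norm_eq_zero.1 (pow_eq_zero_iff two_ne_zero |>.1 (le_antisymm h3 (sq_nonneg _)))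
        have h5 : P = 0 := by
          change α ((γ x).inverse α) = 0
          rw [h4]; simp
        linarith
      have h3 : ‖α‖ ^ 2 ≤ (|Λ| + 1) * P := h2.trans (mul_le_mul_of_nonneg_right (hΛ' x hxK) hP)
      rw [div_mul_eq_mul_div, div_le_iff₀ (by positivity)]
      calc d * ‖α‖ ^ 2 ≤ dens (γ x) * ((|Λ| + 1) * P) :=
            mul_le_mul (hdK x hxK) h3 (sq_nonneg _) (hγ.dens_pos hx).le
        _ = _ := by ring
    · rw [hDu0 x hx hxK]; simp
  have h2 : (∫ x in V, f x ^ 2 * fderiv ℝ χ x (grad γ χ x) * dens (γ x))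
      + ∫ x in V, q x * χ x ^ 2 * f x ^ 2 * dens (γ x)
      ≤ (|A| + |B|) * ∫ x in V, η x * f x ^ 2 * dens (γ x) := by
    rw [← integral_add i3 i2, ← integral_const_mul]
    refine setIntegral_mono_on (i3.add i2) (hi.const_mul _) hV.measurableSet fun x hx => ?_
    have hfd : 0 ≤ f x ^ 2 * dens (γ x) := mul_nonneg (sq_nonneg _) (hγ.dens_pos hx).le
    by_cases hxK : x ∈ K
    · have ha := ((Real.le_norm_self _).trans (hA x hxK)).trans (le_abs_self A)
      have hb := ((Real.le_norm_self _).trans (hB x hxK)).trans (le_abs_self B)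
      rw [hηK x hxK]
      calc _ = (fderiv ℝ χ x (grad γ χ x) + q x * χ x ^ 2) * (f x ^ 2 * dens (γ x)) := by ring
        _ ≤ (|A| + |B|) * (f x ^ 2 * dens (γ x)) := mul_le_mul_of_nonneg_right (add_le_add ha hb) hfd
        _ = _ := by ring
    · rw [hDχ0 x hx hxK, h0 x hx hxK]
      have : 0 ≤ (|A| + |B|) * (η x * f x ^ 2 * dens (γ x)) :=
        mul_nonneg (by positivity) (by rw [mul_assoc]; exact mul_nonneg (hη x hx) hfd)
      simpa using this
  simp only [e0]
  rw [integral_add i1 i2, hγ.integral_lap_mul_sq hK hKV hf hχ h0, e1]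
  linarith

end MinimalHypersurface
end

/-! ### Finitely many positive eigenvalues -/

noncomputable section

namespace MinimalHypersurface

set_option synthInstance.maxHeartbeats 200000
set_option linter.unusedSectionVars false

/-- A symmetric form which is negative on a subspace of finite codimension has only finitely many
positive eigenvalues. -/
lemma finite_setOf_pos_eigenvalue {E F : Type*} [AddCommGroup E] [Module ℝ E] [AddCommGroup F]
    [Module ℝ F] [Module.Finite ℝ F] (A B : E →ₗ[ℝ] E →ₗ[ℝ] ℝ) (ℓ : E →ₗ[ℝ] F)
    (hA : ∀ x y, A x y = A y x) (hB : ∀ x y, B x y = B y x) (hpos : ∀ x, x ≠ 0 → 0 < B x x)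
    (hneg : ∀ x, ℓ x = 0 → 0 ≤ A x x → x = 0) :
    {s : ℝ | 0 < s ∧ ∃ x, x ≠ 0 ∧ ∀ y, A x y = s * B x y}.Finite := by
  by_contra hinf
  obtain ⟨T, hTs, hTc⟩ := Set.Infinite.exists_subset_card_eq hinf (Module.finrank ℝ F + 1)
  have hT : ∀ s : T, ∃ x, x ≠ 0 ∧ ∀ y, A x y = (s : ℝ) * B x y := fun s => (hTs s.2).2
  have hTpos : ∀ s : T, (0 : ℝ) < s := fun s => (hTs s.2).1
  choose x hx0 hx using hT
  -- Eigenvectors for different eigenvalues are orthogonal, by the symmetry of both forms.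
  have hB0 : ∀ s t, s ≠ t → B (x s) (x t) = 0 := by
    intro s t hst
    have h1 := hx s (x t)
    have h2 := hx t (x s)
    rw [hA, h2, hB (x t)] at h1
    have h3 : ((t : ℝ) - s) * B (x s) (x t) = 0 := by linarith
    refine (mul_eq_zero.1 h3).resolve_left fun h => hst ?_
    exact Subtype.ext (by linarith)
  -- There is one eigenvector more than the dimension of `F`, so a nontrivial combination `w` lies
  -- in the kernel of `ℓ`.
  have hdep : ¬ LinearIndependent ℝ fun s => ℓ (x s) := fun h => by
    have := h.fintype_card_le_finrank
    rw [Fintype.card_coe, hTc] at this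
    omega
  obtain ⟨c, hc, t, ht⟩ := Fintype.not_linearIndependent_iff.1 hdep
  set w := ∑ s, c s • x s with hw
  have hBw : ∀ s, B (x s) w = c s * B (x s) (x s) := by
    intro s
    rw [hw, map_sum, Finset.sum_eq_single s]
    · simp
    · intro t _ hts; simp [hB0 s t (Ne.symm hts)]
    · simp
  have hAw : A w w = ∑ s : T, (s : ℝ) * (c s ^ 2 * B (x s) (x s)) := by
    have : A w w = ∑ s, c s * A (x s) w := by
      conv_lhs => rw [hA, hw, map_sum]
      refine Finset.sum_congr rfl fun s _ => ?_
      rw [map_smul, ← hw, hA w, smul_eq_mul]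
    rw [this]
    refine Finset.sum_congr rfl fun s _ => ?_
    rw [hx, hBw]
    ring
  -- By orthogonality `A(w, w)` is a sum of nonnegative terms, so `hneg` kills `w`; pairing with an
  -- eigenvector whose coefficient is nonzero gives a contradiction.
  have hw0 : w = 0 := by
    refine hneg w ?_ ?_
    · rw [hw, map_sum]
      simpa using hc
    · rw [hAw]
      exact Finset.sum_nonneg fun s _ => mul_nonneg (hTpos s).le
        (mul_nonneg (sq_nonneg _) (hpos _ (hx0 s)).le)
  have h := hBw t
  rw [hw0, map_zero] at h
  rcases mul_eq_zero.1 h.symm with h | h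
  · exact ht h
  · exact (hpos _ (hx0 t)).ne' h

/-- The positive eigenvalues are bounded away from zero. -/
lemma exists_forall_eigenvector_eq_zero {E F : Type*} [AddCommGroup E] [Module ℝ E]
    [AddCommGroup F] [Module ℝ F] [Module.Finite ℝ F] (A B : E →ₗ[ℝ] E →ₗ[ℝ] ℝ) (ℓ : E →ₗ[ℝ] F)
    (hA : ∀ x y, A x y = A y x) (hB : ∀ x y, B x y = B y x) (hpos : ∀ x, x ≠ 0 → 0 < B x x)
    (hneg : ∀ x, ℓ x = 0 → 0 ≤ A x x → x = 0) :
    ∃ ε > 0, ∀ s : ℝ, 0 < s → s < ε → ∀ x, (∀ y, A x y = s * B x y) → x = 0 := by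
  have hfin := finite_setOf_pos_eigenvalue A B ℓ hA hB hpos hneg
  have h0 : (0 : ℝ) ∉ {s : ℝ | 0 < s ∧ ∃ x, x ≠ 0 ∧ ∀ y, A x y = s * B x y} := fun h =>
    lt_irrefl _ h.1
  obtain ⟨ε, hε, hball⟩ := Metric.isOpen_iff.1 hfin.isClosed.isOpen_compl 0 h0
  refine ⟨ε, hε, fun s hs hsε x hx => ?_⟩
  by_contra hx0
  refine hball (a := s) ?_ ⟨hs, x, hx0, hx⟩
  simpa [abs_of_pos hs] using hsε

end MinimalHypersurface
end

/-! ### Integration over the hypersurface in charts -/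

noncomputable section

namespace MinimalHypersurface

set_option synthInstance.maxHeartbeats 200000
set_option linter.unusedSectionVars false

open MeasureTheory
open scoped ENNReal

variable {n : ℕ} {M : Type*} [TopologicalSpace M] [ChartedSpace (Euc (n + 1)) M]
  [IsManifold (𝓡 (n + 1)) ∞ M] {S : Type*} [TopologicalSpace S] [ChartedSpace (Euc n) S]
  [IsManifold (𝓡 n) ∞ S] {ι : S → M} {p p' q : S} {y : Euc n} {g : Metric (n + 1) M}
  {V V' : Set (Euc n)}

/-- The metric of the hypersurface in the preferred chart around `p`. -/
abbrev surfMetric (g : Metric (n + 1) M) (ι : S → M) (p : S) : BilinField n :=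
  inducedMetric (coeff g (ι p)) (mapInChart ι p)

/-- The piece of `S` which corresponds to the set `V` in the preferred chart around `p`. -/
def chartPiece (p : S) (V : Set (Euc n)) : Set S :=
  (extChartAt (𝓡 n) p).source ∩ extChartAt (𝓡 n) p ⁻¹' V

lemma isOpen_chartPiece (p : S) (hV : IsOpen V) : IsOpen (chartPiece p V) :=
  (continuousOn_extChartAt p).isOpen_inter_preimage (isOpen_extChartAt_source p) hV

lemma symm_mem_chartPiece (hV : V ⊆ chartDom ι p) (hy : y ∈ V) :
    (extChartAt (𝓡 n) p).symm y ∈ chartPiece p V :=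
  ⟨(extChartAt (𝓡 n) p).map_target (hV hy).1, by
    rwa [mem_preimage, (extChartAt (𝓡 n) p).right_inv (hV hy).1]⟩

lemma surfMetric_apply (hι : ContMDiff (𝓡 n) (𝓡 (n + 1)) ∞ ι) (hy : y ∈ chartDom ι p)
    (u v : Euc n) : surfMetric g ι p y u v
      = g.inner (ι ((extChartAt (𝓡 n) p).symm y))
        (mfderiv (𝓡 n) (𝓡 (n + 1)) ι ((extChartAt (𝓡 n) p).symm y) (symmD p y u))
        (mfderiv (𝓡 n) (𝓡 (n + 1)) ι ((extChartAt (𝓡 n) p).symm y) (symmD p y v)) := by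
  rw [inducedMetric_apply, fderiv_mapInChart hι hy, fderiv_mapInChart hι hy]
  exact coeff_chart g hy.2 _ _

/-- Both densities belong to the same metric on `S`, and Gram determinants change by the square of
the Jacobian. -/
lemma dens_surfMetric_eq (hι : ContMDiff (𝓡 n) (𝓡 (n + 1)) ∞ ι) (hy : y ∈ chartDom ι p)
    (hy' : y ∈ transitionDom p p') (hψ : transition p p' y ∈ chartDom ι p') :
    dens (surfMetric g ι p y)
      = |(fderiv ℝ (transition p p') y).det| * dens (surfMetric g ι p' (transition p p' y)) := by
  rw [← dens_comp]
  congr 1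
  refine ContinuousLinearMap.ext fun u => ContinuousLinearMap.ext fun v => ?_
  rw [ContinuousLinearMap.bilinearComp_apply, surfMetric_apply hι hy, surfMetric_apply hι hψ,
    fderiv_transition hy', fderiv_transition hy']
  have hs : (extChartAt (𝓡 n) p').symm (transition p p' y) = (extChartAt (𝓡 n) p).symm y :=
    (extChartAt (𝓡 n) p').left_inv hy'.2
  have key : ∀ s : S, s = (extChartAt (𝓡 n) p).symm y → ∀ u v : Euc n,
      g.inner (ι ((extChartAt (𝓡 n) p).symm y))
        (mfderiv (𝓡 n) (𝓡 (n + 1)) ι ((extChartAt (𝓡 n) p).symm y) u)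
        (mfderiv (𝓡 n) (𝓡 (n + 1)) ι ((extChartAt (𝓡 n) p).symm y) v)
      = g.inner (ι s) (mfderiv (𝓡 n) (𝓡 (n + 1)) ι s u) (mfderiv (𝓡 n) (𝓡 (n + 1)) ι s v) := by
    rintro _ rfl u v; rfl
  have hD : ∀ w : Euc n, symmD p' (transition p p' y)
      (chartD p' ((extChartAt (𝓡 n) p).symm y) w) = w := fun w => symmD_chartD hy'.2 w
  rw [hD, hD]
  exact key _ hs _ _

/-- The integral of a function over the hypersurface does not depend on the chart. -/
lemma setIntegral_chart_eq (hι : ContMDiff (𝓡 n) (𝓡 (n + 1)) ∞ ι) (hVo : IsOpen V)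
    (hV : V ⊆ chartDom ι p) (hVo' : IsOpen V') (hV' : V' ⊆ chartDom ι p') {φ : S → ℝ}
    (h1 : ∀ q ∉ chartPiece p V, φ q = 0) (h2 : ∀ q ∉ chartPiece p' V', φ q = 0) :
    ∫ y in V, φ ((extChartAt (𝓡 n) p).symm y) * dens (surfMetric g ι p y)
      = ∫ y in V', φ ((extChartAt (𝓡 n) p').symm y) * dens (surfMetric g ι p' y) := by
  set D : Set (Euc n) := V ∩ (extChartAt (𝓡 n) p).symm ⁻¹' chartPiece p' V' with hD
  set D' : Set (Euc n) := V' ∩ (extChartAt (𝓡 n) p').symm ⁻¹' chartPiece p V with hD'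
  have hDo : IsOpen D :=
    ((continuousOn_extChartAt_symm (I := 𝓡 n) p).mono fun y hy => (hV hy).1).isOpen_inter_preimage
      hVo (isOpen_chartPiece p' hVo')
  have hDt : ∀ y ∈ D, y ∈ transitionDom p p' := fun y hy => ⟨(hV hy.1).1, hy.2.1⟩
  have hs : ∀ y ∈ D, (extChartAt (𝓡 n) p').symm (transition p p' y) = (extChartAt (𝓡 n) p).symm y :=
    fun y hy => (extChartAt (𝓡 n) p').left_inv hy.2.1
  have himg : transition p p' '' D = D' := by
    refine Subset.antisymm ?_ fun z hz => ?_
    · rintro _ ⟨y, hy, rfl⟩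
      refine ⟨hy.2.2, ?_⟩
      rw [mem_preimage, hs y hy]
      exact symm_mem_chartPiece hV hy.1
    · refine ⟨extChartAt (𝓡 n) p ((extChartAt (𝓡 n) p').symm z), ⟨hz.2.2, ?_⟩, ?_⟩
      · rw [mem_preimage, (extChartAt (𝓡 n) p).left_inv hz.2.1]
        exact symm_mem_chartPiece hV' hz.1
      · rw [transition, (extChartAt (𝓡 n) p).left_inv hz.2.1,
          (extChartAt (𝓡 n) p').right_inv (hV' hz.1).1]
  have hinj : InjOn (transition p p') D := by
    intro y hy z hz h
    have := congrArg (extChartAt (𝓡 n) p').symm h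
    rw [hs y hy, hs z hz] at this
    exact (extChartAt (𝓡 n) p).symm.injOn (hV hy.1).1 (hV hz.1).1 this
  have e1 : ∫ y in V, φ ((extChartAt (𝓡 n) p).symm y) * dens (surfMetric g ι p y)
      = ∫ y in D, φ ((extChartAt (𝓡 n) p).symm y) * dens (surfMetric g ι p y) := by
    refine setIntegral_eq_of_subset_of_forall_sdiff_eq_zero hVo.measurableSet inter_subset_left
      fun y hy => ?_
    rw [h2 _ fun h => hy.2 ⟨hy.1, h⟩, zero_mul]
  have e2 : ∫ y in V', φ ((extChartAt (𝓡 n) p').symm y) * dens (surfMetric g ι p' y)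
      = ∫ y in D', φ ((extChartAt (𝓡 n) p').symm y) * dens (surfMetric g ι p' y) := by
    refine setIntegral_eq_of_subset_of_forall_sdiff_eq_zero hVo'.measurableSet inter_subset_left
      fun y hy => ?_
    rw [h1 _ fun h => hy.2 ⟨hy.1, h⟩, zero_mul]
  rw [e1, e2, ← himg, integral_image_eq_integral_abs_det_fderiv_smul volume hDo.measurableSet
    (fun y hy => (smooth_differentiableAt
      (transition_smooth (hDt y hy))).hasFDerivAt.hasFDerivWithinAt) hinj]
  refine setIntegral_congr_fun hDo.measurableSet fun y hy => ?_
  rw [hs y hy, dens_surfMetric_eq hι (hV hy.1) (hDt y hy) (hV' hy.2.2), smul_eq_mul]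
  ring

end MinimalHypersurface
end

/-! ### Normal fields and a partition of unity by squares -/

noncomputable section

namespace MinimalHypersurface

set_option synthInstance.maxHeartbeats 200000
set_option linter.unusedSectionVars false

variable {n : ℕ} {M : Type*} [TopologicalSpace M] [ChartedSpace (Euc (n + 1)) M]
  [IsManifold (𝓡 (n + 1)) ∞ M] {S : Type*} [TopologicalSpace S] [ChartedSpace (Euc n) S]
  [IsManifold (𝓡 n) ∞ S] {ι : S → M} {g : Metric (n + 1) M}

/-- Normal fields form a module over the smooth functions. -/
lemma IsNormalField.smul_add_smul {X Y : (p : S) → TangentSpace (𝓡 (n + 1)) (ι p)}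
    (hX : IsNormalField g ι X) (hY : IsNormalField g ι Y) {a b : S → ℝ}
    (ha : ContMDiff (𝓡 n) 𝓘(ℝ, ℝ) ∞ a) (hb : ContMDiff (𝓡 n) 𝓘(ℝ, ℝ) ∞ b) :
    IsNormalField g ι fun p => a p • X p + b p • Y p := by
  refine ⟨fun p₀ => ?_, fun p v => ?_⟩
  · have h1 := Bundle.contMDiffAt_totalSpace.1 (hX.1 p₀)
    have h2 := Bundle.contMDiffAt_totalSpace.1 (hY.1 p₀)
    refine Bundle.contMDiffAt_totalSpace.2 ⟨h1.1, ?_⟩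
    refine (((ha p₀).smul h1.2).add ((hb p₀).smul h2.2)).congr_of_eventuallyEq ?_
    set e := trivializationAt (Euc (n + 1)) (TangentSpace (𝓡 (n + 1)) : M → Type _) (ι p₀) with he
    have hp : ∀ᶠ p in 𝓝 p₀, ι p ∈ e.baseSet :=
      h1.1.continuousAt.eventually (e.open_baseSet.mem_nhds
        (FiberBundle.mem_baseSet_trivializationAt' (ι p₀)))
    filter_upwards [hp] with p hp
    have hl := e.linear ℝ hp
    exact (hl.map_add _ _).trans (congrArg₂ _ (hl.map_smul _ _) (hl.map_smul _ _))
  · rw [map_add, map_smul, map_smul, add_apply, smul_apply, smul_apply, hX.2, hY.2]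
    simp

/-- The space of normal fields. -/
def normalFields (g : Metric (n + 1) M) {ι : S → M} (hι : ContMDiff (𝓡 n) (𝓡 (n + 1)) ∞ ι) :
    Submodule ℝ ((p : S) → TangentSpace (𝓡 (n + 1)) (ι p)) where
  carrier := {X | IsNormalField g ι X}
  zero_mem' := by
    refine ⟨?_, fun p v => by simp⟩
    exact (Bundle.contMDiff_zeroSection ℝ (TangentSpace (𝓡 (n + 1)) : M → Type _)).comp hι
  add_mem' {X Y} hX hY := by
    have h := IsNormalField.smul_add_smul hX hY (a := fun _ => 1) (b := fun _ => 1)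
      contMDiff_const contMDiff_const
    have e : (fun p => (1 : ℝ) • X p + (1 : ℝ) • Y p) = X + Y := by
      funext p; rw [one_smul, one_smul]; rfl
    rw [e] at h
    exact h
  smul_mem' c X hX := by
    have h := IsNormalField.smul_add_smul hX hX (a := fun _ => c) (b := fun _ => 0)
      contMDiff_const contMDiff_const
    have e : (fun p => c • X p + (0 : ℝ) • X p) = c • X := by
      funext p; rw [zero_smul, add_zero]; rfl
    rw [e] at h
    exact h

/-- Finitely many chart pieces covering `S`, with a smooth partition of unity by squares. -/
structure HypCover (g : Metric (n + 1) M) (ι : S → M) (J : Type*) [Fintype J] where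
  p : J → S
  V : J → Set (Euc n)
  N : J → Euc n → Euc (n + 1)
  chart : ∀ j, IsHypChart g ι (p j) (V j) (N j)
  χ : J → S → ℝ
  smooth : ∀ j, ContMDiff (𝓡 n) 𝓘(ℝ, ℝ) ∞ (χ j)
  supp : ∀ j, tsupport (χ j) ⊆ chartPiece (p j) (V j)
  sum_sq : ∀ q, ∑ j, χ j q ^ 2 = 1

/-- A partition of unity is divided by the root of its sum of squares. Squares are wanted because
the energy identity turns the weight `χ²` into the energy of `χ f`. -/
lemma exists_hypCover [CompactSpace S] [T2Space S] (g : Metric (n + 1) M)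
    (hι : IsImmersion (𝓡 n) (𝓡 (n + 1)) ∞ ι) : ∃ t : Finset S, Nonempty (HypCover g ι t) := by
  choose V N hV hc using fun p : S => exists_isHypChart g hι (mem_chartDom_self ι p)
  have hU : ∀ p, IsOpen (chartPiece p (V p)) := fun p => isOpen_chartPiece p (hc p).hyp.isOpen
  obtain ⟨t, ht⟩ := isCompact_univ.elim_finite_subcover (fun p => chartPiece p (V p)) hU
    fun p _ => mem_iUnion.2 ⟨p, mem_extChartAt_source p, hV p⟩
  obtain ⟨ρ, hρ⟩ := SmoothPartitionOfUnity.exists_isSubordinate (𝓡 n) isClosed_univ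
    (fun p : t => chartPiece (p : S) (V p)) (fun p => hU p) (by
      refine ht.trans fun q hq => ?_
      simp only [mem_iUnion] at hq ⊢
      obtain ⟨p, hp, hq⟩ := hq
      exact ⟨⟨p, hp⟩, hq⟩)
  set s : S → ℝ := fun q => ∑ p, ρ p q ^ 2 with hs
  have hspos : ∀ q, 0 < s q := by
    intro q
    obtain ⟨i, hi⟩ := ρ.exists_pos_of_mem (mem_univ q)
    exact Finset.sum_pos' (fun _ _ => sq_nonneg _) ⟨i, Finset.mem_univ i, pow_pos hi 2⟩
  have hssm : ContMDiff (𝓡 n) 𝓘(ℝ, ℝ) ∞ s :=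
    contMDiff_finsetSum fun p _ => (ρ p).contMDiff.pow 2
  have hr : ContMDiff (𝓡 n) 𝓘(ℝ, ℝ) ∞ fun q => (√(s q))⁻¹ := by
    intro q
    have h1 : ContDiffAt ℝ ∞ (fun r : ℝ => (√r)⁻¹) (s q) :=
      (Real.contDiffAt_sqrt (hspos q).ne').inv (Real.sqrt_pos.2 (hspos q)).ne'
    exact h1.contMDiffAt.comp q (hssm q)
  refine ⟨t, ⟨⟨fun j => j, fun j => V j, fun j => N j, fun j => hc j,
    fun j q => ρ j q * (√(s q))⁻¹, fun j => (ρ j).contMDiff.mul hr, fun j => ?_, fun q => ?_⟩⟩⟩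
  · exact (closure_mono fun q hq => left_ne_zero_of_mul hq).trans (hρ j)
  · simp only [mul_pow, ← Finset.sum_mul, inv_pow, Real.sq_sqrt (hspos q).le]
    exact mul_inv_cancel₀ (hspos q).ne'

end MinimalHypersurface
end

/-! ### The `L²` pairing of local expressions -/

noncomputable section

namespace MinimalHypersurface

set_option synthInstance.maxHeartbeats 200000
set_option linter.unusedSectionVars false

open MeasureTheory

variable {n : ℕ} {M : Type*} [TopologicalSpace M] [ChartedSpace (Euc (n + 1)) M]
  [IsManifold (𝓡 (n + 1)) ∞ M] {S : Type*} [TopologicalSpace S] [ChartedSpace (Euc n) S]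
  [IsManifold (𝓡 n) ∞ S] {ι : S → M} {g : Metric (n + 1) M} {p : S} {V : Set (Euc n)}

lemma isCompact_image_chart [CompactSpace S] {T : Set S} (hT : IsClosed T)
    (hTV : T ⊆ chartPiece p V) : IsCompact (extChartAt (𝓡 n) p '' T) :=
  hT.isCompact.image_of_continuousOn ((continuousOn_extChartAt p).mono fun _ hq => (hTV hq).1)

lemma image_chart_subset {T : Set S} (hTV : T ⊆ chartPiece p V) : extChartAt (𝓡 n) p '' T ⊆ V := by
  rintro _ ⟨q, hq, rfl⟩
  exact (hTV hq).2

lemma symm_notMem_of_notMem_image {T : Set S} (hV : V ⊆ chartDom ι p) {y : Euc n} (hy : y ∈ V)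
    (hyT : y ∉ extChartAt (𝓡 n) p '' T) : (extChartAt (𝓡 n) p).symm y ∉ T := fun h =>
  hyT ⟨_, h, (extChartAt (𝓡 n) p).right_inv (hV hy).1⟩

lemma smooth_comp_chart_symm {ρ : S → ℝ} (hρ : ContMDiff (𝓡 n) 𝓘(ℝ, ℝ) ∞ ρ) {y : Euc n}
    (hy : y ∈ (extChartAt (𝓡 n) p).target) :
    ContDiffAt ℝ ∞ (fun y => ρ ((extChartAt (𝓡 n) p).symm y)) y :=
  ContMDiffAt.contDiffAt ((hρ _).comp y (contMDiffAt_chart_symm hy))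

lemma continuousOn_comp_chart_symm {ρ : S → ℝ} (hρ : Continuous ρ) (hV : V ⊆ chartDom ι p) :
    ContinuousOn (fun y => ρ ((extChartAt (𝓡 n) p).symm y)) V :=
  hρ.comp_continuousOn ((continuousOn_extChartAt_symm p).mono fun _ hy => (hV hy).1)

namespace HypCover

variable {J : Type*} [Fintype J] (C : HypCover g ι J)

/-- The metric of the hypersurface in the `j`-th chart. -/
def γ (j : J) : BilinField n := surfMetric g ι (C.p j)

/-- The inverse of the `j`-th chart. -/
def σ (j : J) (y : Euc n) : S := (extChartAt (𝓡 n) (C.p j)).symm y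

/-- The support of the `j`-th cut-off function in the `j`-th chart. -/
def K (j : J) : Set (Euc n) := extChartAt (𝓡 n) (C.p j) '' tsupport (C.χ j)

lemma isRiem (j : J) : IsRiem (C.γ j) (C.V j) := (C.chart j).hyp.isRiem

lemma isOpen_V (j : J) : IsOpen (C.V j) := (C.chart j).hyp.isOpen

lemma continuousOn_dens (j : J) : ContinuousOn (fun y => dens (C.γ j y)) (C.V j) := fun _ hy =>
  ((C.isRiem j).dens_smooth hy).continuousAt.continuousWithinAt

lemma isCompact_K [CompactSpace S] (j : J) : IsCompact (C.K j) :=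
  isCompact_image_chart (isClosed_tsupport _) (C.supp j)

lemma K_subset (j : J) : C.K j ⊆ C.V j := image_chart_subset (C.supp j)

lemma χ_smooth (j k : J) {y : Euc n} (hy : y ∈ C.V k) :
    ContDiffAt ℝ ∞ (fun y => C.χ j (C.σ k y)) y :=
  smooth_comp_chart_symm (C.smooth j) ((C.chart k).subset hy).1

lemma continuousOn_χ (j k : J) : ContinuousOn (fun y => C.χ j (C.σ k y)) (C.V k) :=
  fun _ hy => (C.χ_smooth j k hy).continuousAt.continuousWithinAt

lemma χ_eq_zero (j : J) {y : Euc n} (hy : y ∈ C.V j) (hyK : y ∉ C.K j) : C.χ j (C.σ j y) = 0 :=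
  image_eq_zero_of_notMem_tsupport (symm_notMem_of_notMem_image (C.chart j).subset hy hyK)

lemma exists_mem_chartPiece (q : S) : ∃ j, q ∈ chartPiece (C.p j) (C.V j) := by
  by_contra! h
  have h1 := C.sum_sq q
  rw [Finset.sum_eq_zero fun j _ => by
    rw [image_eq_zero_of_notMem_tsupport fun hq => h j (C.supp j hq)]; simp] at h1
  exact zero_ne_one h1

lemma exists_eq_σ (q : S) : ∃ j, ∃ y ∈ C.V j, C.σ j y = q := by
  obtain ⟨j, hj⟩ := C.exists_mem_chartPiece q
  exact ⟨j, _, hj.2, (extChartAt (𝓡 n) (C.p j)).left_inv hj.1⟩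

/-- The `L²` product of two functions which are given by their local expressions. -/
def pair (a b : J → Euc n → ℝ) : ℝ :=
  ∑ j, ∫ y in C.V j, C.χ j (C.σ j y) ^ 2 * (a j y * b j y) * dens (C.γ j y)

/-- Continuity of local expressions. -/
def Cont (a : J → Euc n → ℝ) : Prop := ∀ j, ContinuousOn (a j) (C.V j)

variable {C} {a a' b : J → Euc n → ℝ}

section

variable [CompactSpace S]

lemma Cont.integrableOn (ha : C.Cont a) (hb : C.Cont b) (j : J) :
    IntegrableOn (fun y => C.χ j (C.σ j y) ^ 2 * (a j y * b j y) * dens (C.γ j y)) (C.V j) :=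
  integrableOn_of_eq_zero (C.isOpen_V j) (C.isCompact_K j) (C.K_subset j)
    ((((C.continuousOn_χ j j).pow 2).mul ((ha j).mul (hb j))).mul (C.continuousOn_dens j))
    fun y hy hyK => by simp [C.χ_eq_zero j hy hyK]

lemma pair_add_left (ha : C.Cont a) (ha' : C.Cont a') (hb : C.Cont b) :
    C.pair (fun j y => a j y + a' j y) b = C.pair a b + C.pair a' b := by
  unfold pair
  rw [← Finset.sum_add_distrib]
  refine Finset.sum_congr rfl fun j _ => ?_
  rw [← integral_add (ha.integrableOn hb j) (ha'.integrableOn hb j)]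
  congr 1
  funext y
  ring

end

lemma pair_congr {b' : J → Euc n → ℝ} (h : ∀ j, ∀ y ∈ C.V j, a j y = a' j y)
    (h' : ∀ j, ∀ y ∈ C.V j, b j y = b' j y) : C.pair a b = C.pair a' b' :=
  Finset.sum_congr rfl fun j _ => setIntegral_congr_fun (C.isOpen_V j).measurableSet
    fun y hy => by simp only [h j y hy, h' j y hy]

lemma pair_smul_left (c : ℝ) : C.pair (fun j y => c * a j y) b = c * C.pair a b := by
  unfold pair
  rw [Finset.mul_sum]
  refine Finset.sum_congr rfl fun j _ => ?_
  rw [← integral_const_mul]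
  congr 1
  funext y
  ring

lemma pair_comm : C.pair a b = C.pair b a := by
  unfold pair
  simp only [mul_comm (a _ _)]

/-- A pairing with support in one chart can be computed in that chart. -/
lemma pair_eq_setIntegral [CompactSpace S] (hι : ContMDiff (𝓡 n) (𝓡 (n + 1)) ∞ ι) (ha : C.Cont a)
    (hb : C.Cont b) {φ : S → ℝ} (hφ : ∀ j, ∀ y ∈ C.V j, a j y * b j y = φ (C.σ j y)) {k : J}
    {T : Set S} (hT : IsClosed T) (hTk : T ⊆ chartPiece (C.p k) (C.V k)) (h0 : ∀ q ∉ T, φ q = 0) :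
    C.pair a b = ∫ y in C.V k, a k y * b k y * dens (C.γ k y) := by
  have hV := fun j => (C.chart j).subset
  -- Each term is supported in chart `k` as well and is moved there by change of variables; the
  -- weights then add up to `1`.
  have e : ∀ j, ∫ y in C.V j, C.χ j (C.σ j y) ^ 2 * (a j y * b j y) * dens (C.γ j y)
      = ∫ y in C.V k, C.χ j (C.σ k y) ^ 2 * (a k y * b k y) * dens (C.γ k y) := by
    intro j
    have h := setIntegral_chart_eq (g := g) (φ := fun q => C.χ j q ^ 2 * φ q) hι (C.isOpen_V j) (hV j)
      (C.isOpen_V k) (hV k) (fun q hq => by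
        rw [image_eq_zero_of_notMem_tsupport fun hq' => hq (C.supp j hq')]; simp)
      (fun q hq => by rw [h0 q fun hq' => hq (hTk hq'), mul_zero])
    refine (setIntegral_congr_fun (C.isOpen_V j).measurableSet fun y hy => ?_).trans
      (h.trans (setIntegral_congr_fun (C.isOpen_V k).measurableSet fun y hy => ?_))
    · simp only [hφ j y hy]; rfl
    · simp only [hφ k y hy]; rfl
  rw [pair, Finset.sum_congr rfl fun j _ => e j, ← integral_finsetSum]
  · congr 1
    funext y
    rw [← Finset.sum_mul, ← Finset.sum_mul, C.sum_sq, one_mul]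
  · intro j _
    refine integrableOn_of_eq_zero (C.isOpen_V k) (isCompact_image_chart hT hTk)
      (image_chart_subset hTk)
      ((((C.continuousOn_χ j k).pow 2).mul ((ha k).mul (hb k))).mul (C.continuousOn_dens k))
      fun y hy hyT => ?_
    rw [hφ k y hy, h0 (C.σ k y) (symm_notMem_of_notMem_image (hV k) hy hyT)]
    simp

end HypCover

end MinimalHypersurface
end

/-! ### The Jacobi operator on local expressions, and its symmetry -/

noncomputable section

namespace MinimalHypersurface

set_option synthInstance.maxHeartbeats 200000
set_option linter.unusedSectionVars false

open MeasureTheory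

section Lap

variable {m : ℕ} {γ : BilinField m} {V : Set (Euc m)} {f h : Euc m → ℝ} {y : Euc m}

lemma lap_congr (hfh : f =ᶠ[𝓝 y] h) : lap γ f y = lap γ h y := by
  have h1 : fderiv ℝ f =ᶠ[𝓝 y] fderiv ℝ h := hfh.fderiv
  rw [lap, lap, h1.fderiv_eq (𝕜 := ℝ), h1.self_of_nhds]

lemma lap_add (hV : IsOpen V) (hf : ∀ y ∈ V, ContDiffAt ℝ ∞ f y)
    (hh : ∀ y ∈ V, ContDiffAt ℝ ∞ h y) (hy : y ∈ V) :
    lap γ (fun y => f y + h y) y = lap γ f y + lap γ h y := by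
  have e1 : ∀ z ∈ V, fderiv ℝ (fun y => f y + h y) z = fderiv ℝ f z + fderiv ℝ h z := fun z hz =>
    fderiv_fun_add (smooth_differentiableAt (hf z hz)) (smooth_differentiableAt (hh z hz))
  have e2 : fderiv ℝ (fderiv ℝ fun y => f y + h y) y
      = fderiv ℝ (fderiv ℝ f) y + fderiv ℝ (fderiv ℝ h) y := by
    have : fderiv ℝ (fun y => f y + h y) =ᶠ[𝓝 y] fun z => fderiv ℝ f z + fderiv ℝ h z := by
      filter_upwards [hV.mem_nhds hy] with z hz using e1 z hz
    rw [this.fderiv_eq (𝕜 := ℝ)]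
    exact fderiv_fun_add (smooth_differentiableAt (smooth_fderiv (hf y hy)))
      (smooth_differentiableAt (smooth_fderiv (hh y hy)))
  simp only [lap, traceWith, e1 y hy, e2, add_apply, ← Finset.sum_add_distrib]
  exact Finset.sum_congr rfl fun a _ => by ring

lemma lap_const_mul (c : ℝ) : lap γ (fun y => c * f y) y = c * lap γ f y := by
  have e1 : fderiv ℝ (fun y => c * f y) = c • fderiv ℝ f := by
    funext z
    change fderiv ℝ (c • f) z = _
    rw [fderiv_const_smul_field]
  simp only [lap, traceWith, e1, fderiv_const_smul_field, Pi.smul_apply, smul_apply, smul_eq_mul,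
    Finset.mul_sum]
  exact Finset.sum_congr rfl fun a _ => by ring

lemma lap_zero : lap γ (fun _ => (0 : ℝ)) y = 0 := by
  simpa using lap_const_mul (γ := γ) (y := y) (f := fun _ => (0 : ℝ)) 0

end Lap

variable {n : ℕ} {M : Type*} [TopologicalSpace M] [ChartedSpace (Euc (n + 1)) M]
  [IsManifold (𝓡 (n + 1)) ∞ M] {S : Type*} [TopologicalSpace S] [ChartedSpace (Euc n) S]
  [IsManifold (𝓡 n) ∞ S] {ι : S → M} {g : Metric (n + 1) M}

namespace HypCover

variable {J : Type*} [Fintype J] (C : HypCover g ι J)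
  {X Y : (p : S) → TangentSpace (𝓡 (n + 1)) (ι p)} {j : J} {y : Euc n}

/-- The local expressions of a normal field. -/
def coef (X : (p : S) → TangentSpace (𝓡 (n + 1)) (ι p)) (j : J) : Euc n → ℝ :=
  normalCoeff g ι (C.p j) (C.N j) X

/-- The potential of the Jacobi operator in the `j`-th chart. -/
def q (j : J) : Euc n → ℝ := pot (coeff g (ι (C.p j))) (mapInChart ι (C.p j)) (C.N j)

/-- The local expressions of the Jacobi operator. -/
def jac (X : (p : S) → TangentSpace (𝓡 (n + 1)) (ι p)) (j : J) (y : Euc n) : ℝ :=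
  lap (C.γ j) (C.coef X j) y + C.q j y * C.coef X j y

variable {C}

lemma coef_smooth (hX : IsNormalField g ι X) (hy : y ∈ C.V j) : ContDiffAt ℝ ∞ (C.coef X j) y :=
  (C.chart j).normalCoeff_smooth hX hy

lemma cont_coef (hX : IsNormalField g ι X) : C.Cont (C.coef X) := fun _ _ hy =>
  (coef_smooth hX hy).continuousAt.continuousWithinAt

lemma continuousOn_q (j : J) : ContinuousOn (C.q j) (C.V j) := (C.chart j).hyp.continuousOn_pot

lemma cont_jac (hX : IsNormalField g ι X) : C.Cont (C.jac X) := fun j =>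
  ((C.isRiem j).continuousOn_lap fun _ hy => coef_smooth hX hy).add
    ((continuousOn_q j).mul (cont_coef hX j))

lemma coef_add_smul (a b : S → ℝ) (j : J) (y : Euc n) :
    C.coef (fun p => a p • X p + b p • Y p) j y
      = a (C.σ j y) * C.coef X j y + b (C.σ j y) * C.coef Y j y := by
  have h : fieldInChart ι (fun p => a p • X p + b p • Y p) (C.p j) y
      = a (C.σ j y) • fieldInChart ι X (C.p j) y + b (C.σ j y) • fieldInChart ι Y (C.p j) y :=
    (map_add (chartD (ι (C.p j)) (ι (C.σ j y))) _ _).trans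
      (congrArg₂ _ (map_smul (chartD (ι (C.p j)) (ι (C.σ j y))) _ _)
        (map_smul (chartD (ι (C.p j)) (ι (C.σ j y))) _ _))
  simp only [coef, normalCoeff, h, map_add, map_smul, smul_eq_mul]

lemma coeff_N (hy : y ∈ C.V j) (s t : ℝ) :
    coeff g (ι (C.p j)) (mapInChart ι (C.p j) y) (s • C.N j y) (t • C.N j y) = s * t := by
  have h := ((C.chart j).hyp.unit y hy).1
  simp only [map_smul, smul_apply, smul_eq_mul, h]
  ring

/-- A single coefficient depends on the sign of the local normal, but a product of two is the value
of a global function. So integrals can be moved between charts even if the hypersurface is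
one-sided. -/
lemma inner_eq (hX : IsNormalField g ι X) (hY : IsNormalField g ι Y) (hy : y ∈ C.V j) :
    C.coef X j y * C.coef Y j y = g.inner (ι (C.σ j y)) (X (C.σ j y)) (Y (C.σ j y)) := by
  rw [← coeff_N hy]
  refine Eq.trans ?_ (coeff_chart g ((C.chart j).subset hy).2 _ _)
  exact congrArg₂ (fun u v => coeff g (ι (C.p j)) (mapInChart ι (C.p j) y) u v)
    ((C.chart j).fieldInChart_eq hX hy).symm ((C.chart j).fieldInChart_eq hY hy).symm

lemma inner_jacobiOperator (hX : IsNormalField g ι X) (hY : IsNormalField g ι Y) (hy : y ∈ C.V j) :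
    C.jac X j y * C.coef Y j y
      = g.inner (ι (C.σ j y)) (jacobiOperator g ι X (C.σ j y)) (Y (C.σ j y)) := by
  rw [← coeff_N hy]
  refine Eq.trans ?_ (coeff_chart g ((C.chart j).subset hy).2 _ _)
  exact congrArg₂ (fun u v => coeff g (ι (C.p j)) (mapInChart ι (C.p j) y) u v)
    ((C.chart j).chartD_jacobiOperator hX hy).symm ((C.chart j).fieldInChart_eq hY hy).symm

lemma jac_eq_of_eigen (hX : IsNormalField g ι X) {s : ℝ}
    (hs : ∀ p, jacobiOperator g ι X p = s • X p) (hy : y ∈ C.V j) :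
    C.jac X j y = s * C.coef X j y := by
  have h1 := (C.chart j).chartD_jacobiOperator hX hy
  have h2 := (C.chart j).fieldInChart_eq hX hy
  have h3 : C.jac X j y • C.N j y = (s * C.coef X j y) • C.N j y := by
    refine h1.symm.trans ?_
    rw [mul_smul]
    refine Eq.trans ?_ (congrArg (s • ·) h2)
    exact (congrArg _ (hs _)).trans (map_smul _ _ _)
  have h4 := congrArg (fun v => coeff g (ι (C.p j)) (mapInChart ι (C.p j) y) v (C.N j y)) h3
  have h5 := ((C.chart j).hyp.unit y hy).1
  simpa [h5] using h4

/-- The Jacobi operator is symmetric when one argument is supported in a chart. -/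
lemma pair_jac_symm_of_support [CompactSpace S] (hι : ContMDiff (𝓡 n) (𝓡 (n + 1)) ∞ ι)
    (hX : IsNormalField g ι X) (hY : IsNormalField g ι Y) {k : J} {T : Set S} (hT : IsClosed T)
    (hTk : T ⊆ chartPiece (C.p k) (C.V k)) (h0 : ∀ q ∉ T, X q = 0) :
    C.pair (C.jac X) (C.coef Y) = C.pair (C.coef X) (C.jac Y) := by
  have hc0 : ∀ j, ∀ y, C.σ j y ∉ T → C.coef X j y = 0 := by
    intro j y hy
    simp only [coef, normalCoeff, fieldInChart]
    have h1 : X ((extChartAt (𝓡 n) (C.p j)).symm y) = 0 := h0 _ hy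
    rw [h1, map_zero]
    exact map_zero _
  have hj0 : ∀ j, ∀ y ∈ C.V j, C.σ j y ∉ T → C.jac X j y = 0 := by
    intro j y hy hyT
    have ho : IsOpen (C.V j ∩ C.σ j ⁻¹' Tᶜ) :=
      ((continuousOn_extChartAt_symm (C.p j)).mono
        fun _ hy => ((C.chart j).subset hy).1).isOpen_inter_preimage (C.isOpen_V j) hT.isOpen_compl
    have : C.coef X j =ᶠ[𝓝 y] fun _ => 0 := by
      filter_upwards [ho.mem_nhds ⟨hy, hyT⟩] with z hz using hc0 j z hz.2
    rw [jac, lap_congr this, lap_zero, hc0 j y hyT]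
    simp
  have e1 := pair_eq_setIntegral hι (cont_jac hX) (cont_coef hY)
    (φ := fun q => g.inner (ι q) (jacobiOperator g ι X q) (Y q))
    (fun j y hy => inner_jacobiOperator hX hY hy) hT hTk (fun q hq => by
      obtain ⟨j, y, hy, rfl⟩ := C.exists_eq_σ q
      rw [← inner_jacobiOperator hX hY hy, hj0 j y hy hq, zero_mul])
  have e2 := pair_eq_setIntegral hι (cont_coef hX) (cont_jac hY)
    (φ := fun q => g.inner (ι q) (jacobiOperator g ι Y q) (X q))
    (fun j y hy => by rw [mul_comm]; exact inner_jacobiOperator hY hX hy) hT hTk (fun q hq => by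
      rw [h0 q hq, map_zero])
  rw [e1, e2]
  exact (C.isRiem k).integral_lap_add_mul_symm (isCompact_image_chart hT hTk)
    (image_chart_subset hTk) (fun y hy => coef_smooth hX hy) (fun y hy => coef_smooth hY hy)
    (continuousOn_q k)
    fun y hy hyT => hc0 k y (symm_notMem_of_notMem_image (C.chart k).subset hy hyT)

end HypCover

end MinimalHypersurface
end

/-! ### The quadratic forms and the spectral gap -/

noncomputable section

namespace MinimalHypersurface

set_option synthInstance.maxHeartbeats 200000
set_option linter.unusedSectionVars false

open MeasureTheory

lemma eqOn_zero_of_setIntegral_nonpos {m : ℕ} {V K : Set (Euc m)} {f : Euc m → ℝ} (hV : IsOpen V)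
    (hK : IsCompact K) (hKV : K ⊆ V) (hf : ContinuousOn f V) (h0 : ∀ x ∈ V, x ∉ K → f x = 0)
    (hnn : ∀ x ∈ V, 0 ≤ f x) (hint : ∫ x in V, f x ≤ 0) : ∀ x ∈ V, f x = 0 := by
  intro x hx
  by_contra hne
  have hi := integrableOn_of_eq_zero hV hK hKV hf h0
  have hpos : 0 < ∫ x in V, f x := by
    rw [setIntegral_pos_iff_support_of_nonneg_ae
      ((ae_restrict_iff' hV.measurableSet).2 (Eventually.of_forall hnn)) hi]
    have ho : IsOpen (V ∩ f ⁻¹' {0}ᶜ) := hf.isOpen_inter_preimage hV isOpen_compl_singleton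
    rw [inter_comm]
    exact ho.measure_pos volume ⟨x, hx, hne⟩
  exact hint.not_gt hpos

variable {n : ℕ} {M : Type*} [TopologicalSpace M] [ChartedSpace (Euc (n + 1)) M]
  [IsManifold (𝓡 (n + 1)) ∞ M] {S : Type*} [TopologicalSpace S] [ChartedSpace (Euc n) S]
  [IsManifold (𝓡 n) ∞ S] {ι : S → M} {g : Metric (n + 1) M}

namespace HypCover

variable {J : Type*} [Fintype J] {C : HypCover g ι J}
  {X Y : (p : S) → TangentSpace (𝓡 (n + 1)) (ι p)} {j : J} {y : Euc n}

lemma coef_add (j : J) (y : Euc n) : C.coef (X + Y) j y = C.coef X j y + C.coef Y j y := by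
  have h := C.coef_add_smul (X := X) (Y := Y) (fun _ => 1) (fun _ => 1) j y
  simp only [one_smul, one_mul] at h
  exact h

lemma coef_smul (c : ℝ) (j : J) (y : Euc n) : C.coef (c • X) j y = c * C.coef X j y := by
  have h := C.coef_add_smul (X := X) (Y := X) (fun _ => c) (fun _ => 0) j y
  simp only [zero_smul, zero_mul, add_zero] at h
  exact h

lemma jac_add (hX : IsNormalField g ι X) (hY : IsNormalField g ι Y) (hy : y ∈ C.V j) :
    C.jac (X + Y) j y = C.jac X j y + C.jac Y j y := by
  have h : C.coef (X + Y) j = fun y => C.coef X j y + C.coef Y j y := funext (coef_add j)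
  simp only [jac, h]
  rw [lap_add (C.isOpen_V j) (fun _ => coef_smooth hX) (fun _ => coef_smooth hY) hy]
  ring

lemma jac_smul (c : ℝ) (j : J) (y : Euc n) : C.jac (c • X) j y = c * C.jac X j y := by
  have h : C.coef (c • X) j = fun y => c * C.coef X j y := funext (coef_smul c j)
  simp only [jac, h]
  rw [lap_const_mul]
  ring

/-- The product of a normal field with a cut-off function, in the chart and extended by zero. -/
def cut (C : HypCover g ι J) (X : (p : S) → TangentSpace (𝓡 (n + 1)) (ι p)) (j : J) :
    Euc n → ℝ :=
  (C.V j).indicator fun y => C.χ j (C.σ j y) * C.coef X j y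

lemma cut_eq_zero (hyK : y ∉ C.K j) : C.cut X j y = 0 :=
  indicator_eq_zero_of_notMem (fun y hy hyK => by rw [C.χ_eq_zero j hy hyK, zero_mul]) y hyK

lemma cut_add : C.cut (X + Y) j = C.cut X j + C.cut Y j := by
  unfold cut
  rw [← indicator_add']
  congr 1
  funext y
  rw [coef_add, mul_add]
  rfl

lemma cut_smul (c : ℝ) : C.cut (c • X) j = c • C.cut X j := by
  funext y
  by_cases hy : y ∈ C.V j
  · simp only [cut, indicator_of_mem hy, Pi.smul_apply, coef_smul, smul_eq_mul]
    ring
  · simp only [cut, indicator_of_notMem hy, Pi.smul_apply, smul_zero]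

section

variable [CompactSpace S]

lemma cut_smooth (hX : IsNormalField g ι X) : ContDiff ℝ ∞ (C.cut X j) :=
  contDiff_indicator (C.isOpen_V j) (C.isCompact_K j) (C.K_subset j)
    (fun _ hy => (C.χ_smooth j j hy).mul (coef_smooth hX hy))
    fun y hy hyK => by rw [C.χ_eq_zero j hy hyK, zero_mul]

lemma integrable_cut (hX : IsNormalField g ι X) : Integrable (C.cut X j) :=
  (cut_smooth hX).continuous.integrable_of_hasCompactSupport
    (HasCompactSupport.intro (C.isCompact_K j) fun _ hy => cut_eq_zero hy)

lemma integral_cut_sq : ∫ y, C.cut X j y ^ 2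
    = ∫ y in C.V j, (C.χ j (C.σ j y) * C.coef X j y) ^ 2 := by
  rw [← setIntegral_eq_integral_of_forall_compl_eq_zero (s := C.V j)]
  · refine setIntegral_congr_fun (C.isOpen_V j).measurableSet fun y hy => ?_
    simp only [cut, indicator_of_mem hy]
  · intro y hy
    simp only [cut, indicator_of_notMem hy]
    simp

lemma eq_zero_of_cut (hX : IsNormalField g ι X)
    (hz : ∀ j, ∀ y ∈ C.V j, C.χ j (C.σ j y) * C.coef X j y = 0) : X = 0 := by
  funext q
  obtain ⟨j, hj⟩ : ∃ j, C.χ j q ≠ 0 := by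
    by_contra! h0
    have := C.sum_sq q
    simp [h0] at this
  have hq := C.supp j (subset_tsupport _ hj)
  have hσ : C.σ j (extChartAt (𝓡 n) (C.p j) q) = q := (extChartAt (𝓡 n) (C.p j)).left_inv hq.1
  have h1 := hz j _ hq.2
  rw [hσ] at h1
  have h2 := inner_eq hX hX hq.2
  rw [(mul_eq_zero.1 h1).resolve_left hj, zero_mul] at h2
  have h3 : ∀ q', q' = q → 0 = g.inner (ι q') (X q') (X q') → X q = 0 := by
    rintro _ rfl h3
    by_contra h0
    exact (g.pos _ _ h0).ne h3
  exact h3 _ hσ h2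

/-- A normal field vanishes if its cut-offs vanish in the square mean. -/
lemma eq_zero_of_integral_cut_sq (hX : IsNormalField g ι X)
    (h : ∀ j, ∫ y, C.cut X j y ^ 2 ≤ 0) : X = 0 := by
  refine eq_zero_of_cut (C := C) hX fun j y hy => ?_
  have := eqOn_zero_of_setIntegral_nonpos (C.isOpen_V j) (C.isCompact_K j) (C.K_subset j)
    (((C.continuousOn_χ j j).mul (cont_coef hX j)).pow 2)
    (fun y hy hyK => by simp [C.χ_eq_zero j hy hyK]) (fun _ _ => sq_nonneg _)
    (integral_cut_sq.symm.le.trans (h j)) y hy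
  exact pow_eq_zero_iff two_ne_zero |>.1 this

lemma pair_coef_pos (hX : IsNormalField g ι X) (hX0 : X ≠ 0) :
    0 < C.pair (C.coef X) (C.coef X) := by
  have hnn : ∀ j, ∀ y ∈ C.V j,
      0 ≤ C.χ j (C.σ j y) ^ 2 * (C.coef X j y * C.coef X j y) * dens (C.γ j y) := fun j y hy =>
    mul_nonneg (mul_nonneg (sq_nonneg _) (mul_self_nonneg _)) ((C.isRiem j).dens_pos hy).le
  have hint : ∀ j ∈ Finset.univ, 0 ≤ ∫ y in C.V j,
      C.χ j (C.σ j y) ^ 2 * (C.coef X j y * C.coef X j y) * dens (C.γ j y) := fun j _ =>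
    setIntegral_nonneg (C.isOpen_V j).measurableSet (hnn j)
  by_contra h
  have hz := (Finset.sum_eq_zero_iff_of_nonneg hint).1
    (le_antisymm (not_lt.1 h) (Finset.sum_nonneg hint))
  refine hX0 (eq_zero_of_cut (C := C) hX fun j y hy => ?_)
  have := eqOn_zero_of_setIntegral_nonpos (C.isOpen_V j) (C.isCompact_K j) (C.K_subset j)
    ((((C.continuousOn_χ j j).pow 2).mul ((cont_coef hX j).mul (cont_coef hX j))).mul
      (C.continuousOn_dens j))
    (fun y hy hyK => by simp [C.χ_eq_zero j hy hyK]) (hnn j)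
    (hz j (Finset.mem_univ j)).le y hy
  have h2 := (mul_eq_zero.1 this).resolve_right ((C.isRiem j).dens_pos hy).ne'
  refine pow_eq_zero_iff two_ne_zero |>.1 (Eq.trans ?_ h2)
  simp only [Pi.pow_apply, Pi.mul_apply]
  ring

/-- The density is bounded on the compact supports of the cut-offs. This allows the Poincaré
inequality, which is Euclidean, to control the `L²` norm. -/
lemma pair_coef_le : ∃ D : J → ℝ, (∀ j, 0 ≤ D j) ∧ ∀ X, IsNormalField g ι X →
    C.pair (C.coef X) (C.coef X) ≤ ∑ j, D j * ∫ y, C.cut X j y ^ 2 := by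
  choose D hD using fun j => (C.isCompact_K j).exists_bound_of_continuousOn
    ((C.continuousOn_dens j).mono (C.K_subset j))
  refine ⟨fun j => |D j|, fun j => abs_nonneg _, fun X hX => Finset.sum_le_sum fun j _ => ?_⟩
  rw [integral_cut_sq, ← integral_const_mul]
  refine setIntegral_mono_on ((cont_coef hX).integrableOn (cont_coef hX) j) ?_
    (C.isOpen_V j).measurableSet fun y hy => ?_
  · exact integrableOn_of_eq_zero (C.isOpen_V j) (C.isCompact_K j) (C.K_subset j)
      (continuousOn_const.mul (((C.continuousOn_χ j j).mul (cont_coef hX j)).pow 2))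
      fun y hy hyK => by simp [C.χ_eq_zero j hy hyK]
  · by_cases hyK : y ∈ C.K j
    · have := ((Real.le_norm_self _).trans (hD j y hyK)).trans (le_abs_self _)
      calc _ = dens (C.γ j y) * (C.χ j (C.σ j y) * C.coef X j y) ^ 2 := by ring
        _ ≤ _ := mul_le_mul_of_nonneg_right this (sq_nonneg _)
    · simp [C.χ_eq_zero j hy hyK]

variable [T2Space S]

/-- The energy estimate in one chart. -/
lemma exists_energy_bound (hι : ContMDiff (𝓡 n) (𝓡 (n + 1)) ∞ ι) (j : J) :
    ∃ c > 0, ∃ B ≥ 0, ∀ X, IsNormalField g ι X →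
      ∫ y in C.V j, C.χ j (C.σ j y) ^ 2 * (C.jac X j y * C.coef X j y) * dens (C.γ j y)
        ≤ - c * (∫ y, ‖fderiv ℝ (C.cut X j) y‖ ^ 2) + B * C.pair (C.coef X) (C.coef X) := by
  obtain ⟨c, hc, B, hB, h⟩ := (C.isRiem j).exists_energy (C.isCompact_K j) (C.K_subset j)
    (χ := fun y => C.χ j (C.σ j y)) (fun _ hy => C.χ_smooth j j hy)
    (fun _ hy hyK => C.χ_eq_zero j hy hyK) (continuousOn_q (C := C) j)
  refine ⟨c, hc, B, hB, fun X hX => ?_⟩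
  -- A cut-off on `S`, equal to `1` on the support of `χ j` and supported in the chart piece. The
  -- error term of the energy estimate is thereby a global pairing, at most the full `L²` norm.
  obtain ⟨η, hη1, hη2, hη3⟩ := exists_tsupport_one_of_isOpen_isClosed
    (isOpen_chartPiece (C.p j) (C.isOpen_V j)) isClosed_closure.isCompact
    (isClosed_tsupport (C.χ j)) (C.supp j)
  have hηc : ∀ k, ContinuousOn (fun y => η (C.σ k y)) (C.V k) := fun k =>
    continuousOn_comp_chart_symm η.continuous (C.chart k).subset
  have hi : IntegrableOn (fun y => η (C.σ j y) * C.coef X j y ^ 2 * dens (C.γ j y)) (C.V j) :=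
    integrableOn_of_eq_zero (C.isOpen_V j) (isCompact_image_chart (isClosed_tsupport _) hη1)
      (image_chart_subset hη1)
      (((hηc j).mul ((cont_coef hX j).pow 2)).mul (C.continuousOn_dens j))
      fun y hy hyT => by
        have : η (C.σ j y) = 0 := image_eq_zero_of_notMem_tsupport
          (symm_notMem_of_notMem_image (C.chart j).subset hy hyT)
        simp [this]
  have ha : C.Cont fun k y => η (C.σ k y) * C.coef X k y := fun k => (hηc k).mul (cont_coef hX k)
  have e := pair_eq_setIntegral hι ha (cont_coef hX)
    (φ := fun q => η q * g.inner (ι q) (X q) (X q)) (k := j)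
    (fun k y hy => by rw [← inner_eq hX hX hy]; ring) (isClosed_tsupport η) hη1
    (fun q hq => by rw [image_eq_zero_of_notMem_tsupport hq, zero_mul])
  have hle : C.pair (fun k y => η (C.σ k y) * C.coef X k y) (C.coef X)
      ≤ C.pair (C.coef X) (C.coef X) := by
    refine Finset.sum_le_sum fun k _ => setIntegral_mono_on (ha.integrableOn (cont_coef hX) k)
      ((cont_coef hX).integrableOn (cont_coef hX) k) (C.isOpen_V k).measurableSet fun y hy => ?_
    have h1 : 0 ≤ C.χ k (C.σ k y) ^ 2 * (C.coef X k y * C.coef X k y) * dens (C.γ k y) :=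
      mul_nonneg (mul_nonneg (sq_nonneg _) (mul_self_nonneg _)) ((C.isRiem k).dens_pos hy).le
    calc _ = η (C.σ k y)
          * (C.χ k (C.σ k y) ^ 2 * (C.coef X k y * C.coef X k y) * dens (C.γ k y)) := by ring
      _ ≤ _ := mul_le_of_le_one_left h1 (hη3 _).2
  have e' : ∫ y in C.V j, η (C.σ j y) * C.coef X j y ^ 2 * dens (C.γ j y)
      ≤ C.pair (C.coef X) (C.coef X) := by
    refine le_of_eq_of_le ?_ (e.symm.le.trans hle)
    congr 1
    funext y
    ring
  have h2 := h (C.coef X j) (fun _ hy => coef_smooth hX hy) (fun y => η (C.σ j y))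
    (fun y _ => (hη3 _).1) (by
      rintro _ ⟨q, hq, rfl⟩
      have : C.σ j (extChartAt (𝓡 n) (C.p j) q) = q :=
        (extChartAt (𝓡 n) (C.p j)).left_inv (C.supp j hq).1
      rw [this]
      exact hη2 hq) hi
  refine le_trans h2 (add_le_add le_rfl (mul_le_mul_of_nonneg_left e' hB))

end

section Forms

variable [CompactSpace S] (hι : ContMDiff (𝓡 n) (𝓡 (n + 1)) ∞ ι)

/-- The quadratic form of the Jacobi operator. -/
def jacForm (C : HypCover g ι J) : normalFields g hι →ₗ[ℝ] normalFields g hι →ₗ[ℝ] ℝ :=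
  LinearMap.mk₂ ℝ (fun X Y => C.pair (C.jac X.1) (C.coef Y.1))
    (fun X X' Y => by
      rw [← pair_add_left (cont_jac X.2) (cont_jac X'.2) (cont_coef Y.2)]
      exact pair_congr (fun j y hy => jac_add X.2 X'.2 hy) fun _ _ _ => rfl)
    (fun c X Y => by
      rw [smul_eq_mul, ← pair_smul_left]
      exact pair_congr (fun j y hy => jac_smul c j y) fun _ _ _ => rfl)
    (fun X Y Y' => by
      rw [pair_comm, pair_comm (b := C.coef Y.1), pair_comm (b := C.coef Y'.1),
        ← pair_add_left (cont_coef Y.2) (cont_coef Y'.2) (cont_jac X.2)]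
      exact pair_congr (fun j y hy => coef_add j y) fun _ _ _ => rfl)
    (fun c X Y => by
      rw [pair_comm, pair_comm (b := C.coef Y.1), smul_eq_mul, ← pair_smul_left]
      exact pair_congr (fun j y hy => coef_smul c j y) fun _ _ _ => rfl)

/-- The `L²` product of normal fields. -/
def prodForm (C : HypCover g ι J) : normalFields g hι →ₗ[ℝ] normalFields g hι →ₗ[ℝ] ℝ :=
  LinearMap.mk₂ ℝ (fun X Y => C.pair (C.coef X.1) (C.coef Y.1))
    (fun X X' Y => by
      rw [← pair_add_left (cont_coef X.2) (cont_coef X'.2) (cont_coef Y.2)]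
      exact pair_congr (fun j y hy => coef_add j y) fun _ _ _ => rfl)
    (fun c X Y => by
      rw [smul_eq_mul, ← pair_smul_left]
      exact pair_congr (fun j y hy => coef_smul c j y) fun _ _ _ => rfl)
    (fun X Y Y' => by
      rw [pair_comm, pair_comm (b := C.coef Y.1), pair_comm (b := C.coef Y'.1),
        ← pair_add_left (cont_coef Y.2) (cont_coef Y'.2) (cont_coef X.2)]
      exact pair_congr (fun j y hy => coef_add j y) fun _ _ _ => rfl)
    (fun c X Y => by
      rw [pair_comm, pair_comm (b := C.coef Y.1), smul_eq_mul, ← pair_smul_left]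
      exact pair_congr (fun j y hy => coef_smul c j y) fun _ _ _ => rfl)

/-- The means of the cut-offs over the cubes of grids. -/
def meanMap (C : HypCover g ι J) (ε : J → ℝ) (Z : J → Finset (Fin n → ℤ)) :
    normalFields g hι →ₗ[ℝ] ((j : J) → Z j → ℝ) :=
  LinearMap.pi fun j => LinearMap.pi fun z =>
    { toFun := fun X => ∫ y in gridCube (ε j) (z : Fin n → ℤ), C.cut X.1 j y
      map_add' := fun X Y => by
        rw [← integral_add (integrable_cut (C := C) X.2).integrableOn
          (integrable_cut (C := C) Y.2).integrableOn]
        exact congrArg (fun f : Euc n → ℝ => ∫ y in gridCube (ε j) (z : Fin n → ℤ), f y)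
          (cut_add (C := C) (X := X.1) (Y := Y.1) (j := j))
      map_smul' := fun c X => by
        rw [RingHom.id_apply, ← integral_smul]
        exact congrArg (fun f : Euc n → ℝ => ∫ y in gridCube (ε j) (z : Fin n → ℤ), f y)
          (cut_smul (C := C) (X := X.1) (j := j) c) }

variable {hι}

/-- The Jacobi operator is symmetric. -/
lemma jacForm_symm (X Y : normalFields g hι) : C.jacForm hι X Y = C.jacForm hι Y X := by
  -- The field is split into the pieces `χ² X`, each supported in one chart, where Green's formula
  -- gives the symmetry.
  let P : J → normalFields g hι := fun k =>
    ⟨fun p => C.χ k p ^ 2 • X.1 p + (0 : ℝ) • X.1 p,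
      IsNormalField.smul_add_smul X.2 X.2 ((C.smooth k).pow 2) contMDiff_const⟩
  have hP : ∑ k, P k = X := by
    refine Subtype.ext (funext fun p => ?_)
    rw [Submodule.coe_sum, Finset.sum_apply]
    simp only [P, zero_smul, add_zero]
    rw [← Finset.sum_smul, C.sum_sq, one_smul]
  rw [← hP, map_sum, map_sum, LinearMap.sum_apply]
  refine Finset.sum_congr rfl fun k _ => ?_
  refine (pair_jac_symm_of_support hι (P k).2 Y.2 (isClosed_tsupport (C.χ k)) (C.supp k)
    fun q hq => ?_).trans pair_comm
  simp only [P]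
  rw [image_eq_zero_of_notMem_tsupport hq]
  simp

lemma prodForm_symm (X Y : normalFields g hι) : C.prodForm hι X Y = C.prodForm hι Y X := pair_comm

lemma prodForm_pos {X : normalFields g hι} (hX : X ≠ 0) : 0 < C.prodForm hι X X :=
  pair_coef_pos X.2 fun h => hX (Subtype.ext h)

variable [T2Space S]

/-- On the kernel of the mean map, the energy estimates give `A(X, X) ≤ -∑ cⱼ Pⱼ + B' ‖X‖²`, with
`Pⱼ` the energy of the cut-off field. A fine grid gives `B' ‖X‖² ≤ ½ ∑ cⱼ Pⱼ`. So `A(X, X) ≥ 0`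
forces every `Pⱼ` to vanish, and then the Poincaré inequality forces `X = 0`. -/
lemma exists_grid : ∃ (ε : J → ℝ) (Z : J → Finset (Fin n → ℤ)), ∀ X : normalFields g hι,
    C.meanMap hι ε Z X = 0 → 0 ≤ C.jacForm hι X X → X = 0 := by
  choose c hc B hB hE using exists_energy_bound (C := C) hι
  obtain ⟨D, hD, hDle⟩ := pair_coef_le (C := C)
  set B' := ∑ j, B j with hB'
  have hB'0 : 0 ≤ B' := Finset.sum_nonneg fun j _ => hB j
  -- This Poincaré constant, times `B' D j`, is at most `c j / 2`; the summand `1` prevents a zero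
  -- denominator.
  have hδ : ∀ j, 0 < c j / (2 * (B' * D j + 1)) := fun j => by
    have := mul_nonneg hB'0 (hD j)
    have := hc j
    positivity
  choose ε Z hP using fun j => exists_poincare (C.isCompact_K j) (hδ j)
  refine ⟨ε, Z, fun X hℓ hA => ?_⟩
  have hPX : ∀ j, ∫ y, C.cut X.1 j y ^ 2
      ≤ c j / (2 * (B' * D j + 1)) * ∫ y, ‖fderiv ℝ (C.cut X.1 j) y‖ ^ 2 := fun j =>
    hP j _ ((cut_smooth X.2).of_le (by simp)) (fun _ hy => cut_eq_zero hy) fun z hz =>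
      congrFun (congrFun hℓ j) ⟨z, hz⟩
  set P : J → ℝ := fun j => ∫ y, ‖fderiv ℝ (C.cut X.1 j) y‖ ^ 2 with hPdef
  have hP0 : ∀ j, 0 ≤ P j := fun j => integral_nonneg fun _ => sq_nonneg _
  have h1 : C.jacForm hι X X ≤ ∑ j, (- c j * P j) + B' * C.pair (C.coef X.1) (C.coef X.1) := by
    rw [hB', Finset.sum_mul, ← Finset.sum_add_distrib]
    exact Finset.sum_le_sum fun j _ => hE j X.1 X.2
  have h2 : B' * C.pair (C.coef X.1) (C.coef X.1) ≤ ∑ j, c j / 2 * P j := by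
    refine (mul_le_mul_of_nonneg_left (hDle X.1 X.2) hB'0).trans ?_
    rw [Finset.mul_sum]
    refine Finset.sum_le_sum fun j _ => ?_
    have hBD := mul_nonneg hB'0 (hD j)
    calc B' * (D j * ∫ y, C.cut X.1 j y ^ 2)
        ≤ B' * (D j * (c j / (2 * (B' * D j + 1)) * P j)) := by
          have := hPX j; have := hD j; gcongr
      _ = (B' * D j / (B' * D j + 1)) * (c j / 2 * P j) := by field_simp
      _ ≤ 1 * (c j / 2 * P j) := by
          refine mul_le_mul_of_nonneg_right ?_ (mul_nonneg (half_pos (hc j)).le (hP0 j))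
          rw [div_le_one (by linarith)]
          linarith
      _ = _ := one_mul _
  have h3 : ∑ j, c j / 2 * P j ≤ 0 := by
    have : ∑ j, (- c j * P j) = - (2 * ∑ j, c j / 2 * P j) := by
      rw [Finset.mul_sum, ← Finset.sum_neg_distrib]
      exact Finset.sum_congr rfl fun j _ => by ring
    linarith
  have h4 : ∀ j, P j = 0 := fun j => by
    have hnn : ∀ j ∈ Finset.univ, 0 ≤ c j / 2 * P j := fun j _ =>
      mul_nonneg (half_pos (hc j)).le (hP0 j)
    have := (Finset.sum_eq_zero_iff_of_nonneg hnn).1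
      (le_antisymm h3 (Finset.sum_nonneg hnn)) j (Finset.mem_univ j)
    exact (mul_eq_zero.1 this).resolve_left (half_pos (hc j)).ne'
  refine Subtype.ext (eq_zero_of_integral_cut_sq (C := C) X.2 fun j => ?_)
  have := hPX j
  rwa [show (∫ y, ‖fderiv ℝ (C.cut X.1 j) y‖ ^ 2) = 0 from h4 j, mul_zero] at this

end Forms

end HypCover

/-- The positive eigenvalues of the Jacobi operator of a closed hypersurface are bounded away
from zero. -/
lemma exists_spectral_gap [CompactSpace S] [T2Space S] (g : Metric (n + 1) M)
    (hι : IsImmersion (𝓡 n) (𝓡 (n + 1)) ∞ ι) :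
    ∃ ε > 0, ∀ s : ℝ, 0 < s → s < ε → ∀ X : (p : S) → TangentSpace (𝓡 (n + 1)) (ι p),
      IsNormalField g ι X → (∀ p, jacobiOperator g ι X p = s • X p) → ∀ p, X p = 0 := by
  obtain ⟨t, ⟨C⟩⟩ := exists_hypCover g hι
  obtain ⟨ε, Z, h⟩ := HypCover.exists_grid (C := C) (hι := hι.contMDiff)
  obtain ⟨δ, hδ, hgap⟩ := exists_forall_eigenvector_eq_zero (C.jacForm hι.contMDiff)
    (C.prodForm hι.contMDiff) (C.meanMap hι.contMDiff ε Z) HypCover.jacForm_symm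
    HypCover.prodForm_symm (fun _ => HypCover.prodForm_pos) h
  refine ⟨δ, hδ, fun s hs hsδ X hX hLX p => ?_⟩
  have h0 : (⟨X, hX⟩ : normalFields g hι.contMDiff) = 0 := by
    refine hgap s hs hsδ _ fun Y => ?_
    refine Eq.trans ?_ (HypCover.pair_smul_left s)
    exact HypCover.pair_congr (fun j y hy => HypCover.jac_eq_of_eigen hX hLX hy) fun _ _ _ => rfl
  exact congrFun (congrArg Subtype.val h0) p

end MinimalHypersurface
end

theorem proposition2p3 (n : ℕ) (hn : 1 ≤ n)
    {M : Type*} [TopologicalSpace M] [T2Space M] [CompactSpace M]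
    [ChartedSpace (EuclideanSpace ℝ (Fin (n + 1))) M] [IsManifold (𝓡 (n + 1)) ∞ M]
    (g : MinimalHypersurface.Metric (n + 1) M)
    {S : Type*} [TopologicalSpace S] [CompactSpace S]
    [ChartedSpace (EuclideanSpace ℝ (Fin n)) S] [IsManifold (𝓡 n) ∞ S]
    (ι : S → M) (hι : IsSmoothEmbedding (𝓡 n) (𝓡 (n + 1)) ∞ ι)
    (hmin : MinimalHypersurface.IsMinimal g ι) :
    ∃ (h : M → ℝ) (G : ℕ → MinimalHypersurface.Metric (n + 1) M),
      ContMDiff (𝓡 (n + 1)) 𝓘(ℝ, ℝ) ∞ h ∧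
      (∀ᶠ x in 𝓝ˢ (range ι), h x = MinimalHypersurface.distToSet g (range ι) x ^ 2) ∧
      (∀ i : ℕ, 1 ≤ i → ∀ (x : M) (v w : TangentSpace (𝓡 (n + 1)) x),
        (G i).inner x v w = Real.exp (2 * h x / i) * g.inner x v w) ∧
      MinimalHypersurface.TendstoSmoothly G g ∧
      (∀ i : ℕ, 1 ≤ i →
        MinimalHypersurface.IsMinimal (G i) ι ∧
        (∀ X : (p : S) → TangentSpace (𝓡 (n + 1)) (ι p),
          (MinimalHypersurface.IsNormalField (G i) ι X ↔
            MinimalHypersurface.IsNormalField g ι X) ∧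
          (MinimalHypersurface.IsNormalField g ι X → ∀ p,
            MinimalHypersurface.jacobiOperator (G i) ι X p
              = MinimalHypersurface.jacobiOperator g ι X p - (2 * n / i : ℝ) • X p)) ∧
        MinimalHypersurface.jacobiSpectrum (G i) ι
          = (fun c : ℝ => c + 2 * n / i) '' MinimalHypersurface.jacobiSpectrum g ι) ∧
      (∃ i₀ : ℕ, ∀ i : ℕ, i₀ ≤ i → MinimalHypersurface.IsNondegenerate (G i) ι) :=
  -- The Hausdorff property, needed for partitions of unity on `S`, is inherited from `M` through
  -- the embedding.
  have : T2Space S := hι.isEmbedding.t2Space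
  MinimalHypersurface.exists_conformal_deformation hn g hι hmin
    (MinimalHypersurface.exists_spectral_gap g hι.isImmersion)
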